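/- Fix an infinite cardinal $\kappa$. For an exact category $\mathcal{A}$ let $\mathsf{Lex}\,\mathcal{A}$ be the category of left exact presheaves of abelian groups on $\mathcal{A}$ (additive functors $F\colon\mathcal{A}^{op}\to\mathsf{Ab}$ such that $0\to F(Z)\to F(Y)\to F(X)$ is exact for every short exact sequence $X\hookrightarrow Y\twoheadrightarrow Z$). For a full subcategory $\mathcal{B}\subset\mathcal{A}$ that contains a zero object and is closed under extensions, let $\mathsf{Ind}(\mathcal{A},\mathcal{B})\subset\mathsf{Lex}\,\mathcal{A}$ be the full subcategory of the colimits of diagrams $X\colon I\to\mathcal{A}$ indexed by nonempty directed posets with $|I|\le\kappa$ such that, for all $i\le j$, $X_i\to X_j$ is an admissible monomorphism with $X_j/X_i\in\mathcal{B}$; its short exact sequences are those that are short exact in $\mathsf{Lex}\,\mathcal{A}$. Put $\mathsf{Ind}(\mathcal{A})=\mathsf{Ind}(\mathcal{A},\mathcal{A})$ and $\mathsf{Pro}(\mathcal{A})=\mathsf{Ind}(\mathcal{A}^{op})^{op}$. For an extension-closed full subcategory $\mathsf{C}\subset\mathsf{D}$ of an exact category (with the inherited exact structure) put $\mathsf{Tate}^{el}(\mathsf{D},\mathsf{C})=\mathsf{Ind}(\mathsf{Pro}(\mathsf{D}),\mathsf{C})$.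 It contains $\mathsf{Pro}(\mathsf{D})$ and $\mathsf{Ind}(\mathsf{C})$ (the colimits of admissible Ind diagrams in $\mathsf{C}$) as full subcategories. A fully faithful exact inclusion $\mathsf{C}\subset\mathcal{A}$ of exact categories is called right s-filtering if (i) every morphism $Y\to X$ in $\mathcal{A}$ with $X\in\mathsf{C}$ factors through an admissible epimorphism $Y\twoheadrightarrow X'$ with $X'\in\mathsf{C}$, and (ii) for every short exact sequence $Z\hookrightarrow G\twoheadrightarrow F$ in $\mathcal{A}$ with $Z\in\mathsf{C}$ there is a morphism of short exact sequences, equal to the identity on $Z$, to a short exact sequence $Z\hookrightarrow Y\twoheadrightarrow X$ of $\mathsf{C}$. For a full subcategory $\mathcal{B}\subset\mathcal{A}$, the quotient $\mathcal{A}/\mathcal{B}$ is the localization of $\mathcal{A}$ at the admissible monomorphisms with cokernel in $\mathcal{B}$ and the admissible epimorphisms with kernel in $\mathcal{B}$; its short exact sequences are the sequences isomorphic to images of short exact sequences of $\mathcal{A}$. Proposition. Let $\mathsf{D}$ be an idempotent complete exact category and let $\mathsf{C}\subset\mathsf{D}$ be an extension-closed full subcategory that is right s-filtering in $\mathsf{D}$.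 Then $\mathsf{Pro}(\mathsf{D})$ is an exact category and $\mathsf{C}\subset\mathsf{Pro}(\mathsf{D})$ is right s-filtering. The quotients $\mathsf{Pro}(\mathsf{D})/\mathsf{C}$ and $\mathsf{Tate}^{el}(\mathsf{D},\mathsf{C})/\mathsf{Ind}(\mathsf{C})$ are exact categories and their localization functors are exact. The inclusion $\mathsf{Pro}(\mathsf{D})\subset\mathsf{Tate}^{el}(\mathsf{D},\mathsf{C})$ induces an exact functor $$\mathsf{Pro}(\mathsf{D})\to\mathsf{Tate}^{el}(\mathsf{D},\mathsf{C})/\mathsf{Ind}(\mathsf{C}),$$ which factors through the localization functor $\mathsf{Pro}(\mathsf{D})\to\mathsf{Pro}(\mathsf{D})/\mathsf{C}$, and the induced functor $$\mathsf{Pro}(\mathsf{D})/\mathsf{C}\to\mathsf{Tate}^{el}(\mathsf{D},\mathsf{C})/\mathsf{Ind}(\mathsf{C})$$ is an equivalence of exact categories. -/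

import Mathlib

open CategoryTheory CategoryTheory.Limits

universe w v u v' u'

namespace RelTate

/-! ### Exact categories

A class of conflations (short exact sequences) on a preadditive category `A` is a property of
short complexes `E : ObjectProperty (ShortComplex A)`.  It is a Quillen exact structure when
`IsExactStructure E` holds. -/

section Exact

variable {A : Type u} [Category.{v} A] [Preadditive A]

/-- A sequence `X ⟶ Y ⟶ Z` in which the first map is a kernel of the second one and the second
map is a cokernel of the first one. -/
def IsKernelCokernelPair (S : ShortComplex A) : Prop :=
  Nonempty (IsLimit (KernelFork.ofι S.f S.zero)) ∧
    Nonempty (IsColimit (CokernelCofork.ofπ S.g S.zero))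

/-- Admissible monomorphisms whose cokernel lies in `P`. -/
def monoCokerIn (E : ObjectProperty (ShortComplex A)) (P : ObjectProperty A) :
    MorphismProperty A :=
  fun _ Y f => ∃ (Z : A) (g : Y ⟶ Z) (h : f ≫ g = 0), P Z ∧ E (ShortComplex.mk f g h)

/-- Admissible epimorphisms whose kernel lies in `P`. -/
def epiKerIn (E : ObjectProperty (ShortComplex A)) (P : ObjectProperty A) :
    MorphismProperty A :=
  fun Y _ g => ∃ (X : A) (f : X ⟶ Y) (h : f ≫ g = 0), P X ∧ E (ShortComplex.mk f g h)

/-- Admissible monomorphisms. -/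
abbrev admMono (E : ObjectProperty (ShortComplex A)) : MorphismProperty A := monoCokerIn E ⊤

/-- Admissible epimorphisms. -/
abbrev admEpi (E : ObjectProperty (ShortComplex A)) : MorphismProperty A := epiKerIn E ⊤

/-- `E` is the class of short exact sequences of an exact category in the sense of Quillen
(in Bühler's formulation). -/
structure IsExactStructure (E : ObjectProperty (ShortComplex A)) : Prop where
  hasZeroObject : HasZeroObject A
  hasBinaryBiproducts : HasBinaryBiproducts A
  of_iso : ∀ {S T : ShortComplex A}, (S ≅ T) → E S → E T
  isKernelCokernelPair : ∀ {S : ShortComplex A}, E S → IsKernelCokernelPair S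
  id_admMono : ∀ X : A, admMono E (𝟙 X)
  id_admEpi : ∀ X : A, admEpi E (𝟙 X)
  comp_admMono : ∀ {X Y Z : A} (f : X ⟶ Y) (g : Y ⟶ Z),
    admMono E f → admMono E g → admMono E (f ≫ g)
  comp_admEpi : ∀ {X Y Z : A} (f : X ⟶ Y) (g : Y ⟶ Z),
    admEpi E f → admEpi E g → admEpi E (f ≫ g)
  pushout_admMono : ∀ {X Y X' : A} (i : X ⟶ Y) (f : X ⟶ X'), admMono E i →
    ∃ (Y' : A) (f' : Y ⟶ Y') (i' : X' ⟶ Y'), IsPushout i f f' i' ∧ admMono E i'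
  pullback_admEpi : ∀ {Y Z Z' : A} (p : Y ⟶ Z) (f : Z' ⟶ Z), admEpi E p →
    ∃ (Y' : A) (f' : Y' ⟶ Y) (p' : Y' ⟶ Z'), IsPullback f' p' p f ∧ admEpi E p'

/-- An additive functor that preserves short exact sequences. -/
structure IsExactFunctor {B : Type u'} [Category.{v'} B] [Preadditive B]
    (E : ObjectProperty (ShortComplex A)) (E' : ObjectProperty (ShortComplex B))
    (F : A ⥤ B) : Prop where
  additive : F.Additive
  map_mem : ∀ S : ShortComplex A, E S → E' (S.map F)

/-- An equivalence of exact categories: an additive equivalence of categories under which the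
short exact sequences of the two sides correspond to each other. -/
structure IsExactEquivalence {B : Type u'} [Category.{v'} B] [Preadditive B]
    (E : ObjectProperty (ShortComplex A)) (E' : ObjectProperty (ShortComplex B))
    (F : A ⥤ B) : Prop where
  isEquivalence : F.IsEquivalence
  additive : F.Additive
  map_mem_iff : ∀ S : ShortComplex A, E' (S.map F) ↔ E S

/-- The full subcategory `C` contains a zero object and is closed under extensions. -/
structure IsExtensionClosed (E : ObjectProperty (ShortComplex A)) (C : ObjectProperty A) :
    Prop where
  zero : ∃ Z : A, IsZero Z ∧ C Z
  ext : ∀ S : ShortComplex A, E S → C S.X₁ → C S.X₃ → C S.X₂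

/-- The exact structure inherited by a full subcategory. -/
def restrict (E : ObjectProperty (ShortComplex A)) (C : ObjectProperty A) :
    ObjectProperty (ShortComplex C.FullSubcategory) :=
  fun S => E (S.map C.ι)

/-- The opposite exact structure. -/
def opConfl (E : ObjectProperty (ShortComplex A)) : ObjectProperty (ShortComplex Aᵒᵖ) :=
  fun S => E S.unop

/-- A functor `i : C ⥤ A` between exact categories is (the inclusion of) a right s-filtering
subcategory: it is fully faithful and exact, it is right filtering (every morphism `Y ⟶ X` with
`X` in `C` factors through an admissible epimorphism `Y ↠ X'` with `X'` in `C`), and it is right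
special (for every short exact sequence `Z ↪ G ↠ F` with `Z` in `C` there is a morphism of short
exact sequences, which is the identity on `Z`, to a short exact sequence `Z ↪ Y ↠ X` of `C`). -/
structure IsRightSFiltering {C : Type u'} [Category.{v'} C] [Preadditive C]
    (EC : ObjectProperty (ShortComplex C)) (E : ObjectProperty (ShortComplex A))
    (i : C ⥤ A) : Prop where
  full : i.Full
  faithful : i.Faithful
  exact : IsExactFunctor EC E i
  filtering : ∀ {Y : A} {X : C} (f : Y ⟶ i.obj X),
    ∃ (X' : C) (p : Y ⟶ i.obj X') (g : i.obj X' ⟶ i.obj X), admEpi E p ∧ p ≫ g = f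
  special : ∀ {Z : C} {G F : A} (a : i.obj Z ⟶ G) (b : G ⟶ F) (h : a ≫ b = 0),
    E (ShortComplex.mk a b h) →
    ∃ (Y X : C) (j : Z ⟶ Y) (q : Y ⟶ X) (h' : j ≫ q = 0), EC (ShortComplex.mk j q h') ∧
      ∃ (s : G ⟶ i.obj Y) (t : F ⟶ i.obj X), a ≫ s = i.map j ∧ b ≫ t = s ≫ i.map q

/-- The morphisms that become invertible in the quotient `A / P`: admissible monomorphisms with
cokernel in `P` and admissible epimorphisms with kernel in `P`. -/
def weakIso (E : ObjectProperty (ShortComplex A)) (P : ObjectProperty A) : MorphismProperty A :=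
  monoCokerIn E P ⊔ epiKerIn E P

/-- The quotient category `A / P`: the localization of `A` at `weakIso E P`. -/
abbrev Quot (E : ObjectProperty (ShortComplex A)) (P : ObjectProperty A) :=
  (weakIso E P).Localization

/-- The localization functor `A ⥤ A / P`. -/
abbrev quotFunctor (E : ObjectProperty (ShortComplex A)) (P : ObjectProperty A) :
    A ⥤ Quot E P :=
  (weakIso E P).Q

/-- The short exact sequences of `A / P`: the sequences isomorphic to the image of a short exact
sequence of `A`. -/
def quotConfl (E : ObjectProperty (ShortComplex A)) (P : ObjectProperty A)
    [Preadditive (Quot E P)] : ObjectProperty (ShortComplex (Quot E P)) :=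
  fun T => ∃ S : ShortComplex A, E S ∧
    ∃ (e₁ : (quotFunctor E P).obj S.X₁ ≅ T.X₁) (e₂ : (quotFunctor E P).obj S.X₂ ≅ T.X₂)
      (e₃ : (quotFunctor E P).obj S.X₃ ≅ T.X₃),
      (quotFunctor E P).map S.f ≫ e₂.hom = e₁.hom ≫ T.f ∧
      (quotFunctor E P).map S.g ≫ e₃.hom = e₂.hom ≫ T.g

/-! ### Left exact presheaves and admissible Ind objects -/

/-- Left exact presheaves of abelian groups: `0 → F Z → F Y → F X` is exact for every short exact
sequence `X ↪ Y ↠ Z`. -/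
def isLeftExact (E : ObjectProperty (ShortComplex A)) :
    ObjectProperty (Aᵒᵖ ⥤ AddCommGrpCat.{v}) :=
  fun F => F.Additive ∧ ∀ S : ShortComplex A, E S →
    Function.Injective (F.map S.g.op) ∧ Function.Exact (F.map S.g.op) (F.map S.f.op)

/-- The category `Lex A` of left exact presheaves. -/
abbrev Lex (E : ObjectProperty (ShortComplex A)) := (isLeftExact E).FullSubcategory

/-- The objects of `Lex A` that are colimits of a diagram `X : I ⥤ A`, where `I` is a nonempty
directed poset of cardinality at most `κ`, such that every `X i` lies in `P` and such that, for
`i ≤ j`, the map `X i ⟶ X j` is an admissible monomorphism with `X j / X i` in `Q`.  (A filtered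
colimit of left exact presheaves is computed in the category of all presheaves.) -/
def indPresented (κ : Cardinal.{w}) (E : ObjectProperty (ShortComplex A))
    (P Q : ObjectProperty A) : ObjectProperty (Lex E) :=
  fun F => ∃ (I : Type w) (_ : PartialOrder I) (_ : Nonempty I) (_ : IsDirected I (· ≤ ·))
    (X : I ⥤ A) (c : X ⋙ preadditiveYoneda ⟶ (Functor.const I).obj F.obj),
    Cardinal.mk I ≤ κ ∧ (∀ i, P (X.obj i)) ∧
    (∀ {i j : I} (f : i ⟶ j), monoCokerIn E Q (X.map f)) ∧
    Nonempty (IsColimit (Cocone.mk F.obj c))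

/-- The category `Ind(A, Q)` of relative admissible Ind objects. -/
abbrev IndRel (κ : Cardinal.{w}) (E : ObjectProperty (ShortComplex A)) (Q : ObjectProperty A) :=
  (indPresented κ E ⊤ Q).FullSubcategory

/-- The inclusion `Ind(A, Q) ⥤ Lex A`. -/
abbrev IndRel.toLex (κ : Cardinal.{w}) (E : ObjectProperty (ShortComplex A))
    (Q : ObjectProperty A) : IndRel κ E Q ⥤ Lex E :=
  (indPresented κ E ⊤ Q).ι

/-- The short exact sequences of `Ind(A, Q)` are the sequences that are short exact in the abelian
category `Lex A`. -/
def indConfl (κ : Cardinal.{w}) (E : ObjectProperty (ShortComplex A)) (Q : ObjectProperty A) :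
    ObjectProperty (ShortComplex (IndRel κ E Q)) :=
  fun S => IsKernelCokernelPair (S.map (IndRel.toLex κ E Q))

lemma comp_g_eq_zero (S : ShortComplex A) {X : A} (z : S.X₃ ⟶ X) : S.f ≫ S.g ≫ z = 0 := by
  rw [S.zero_assoc, zero_comp]

lemma yoneda_isLeftExact {E : ObjectProperty (ShortComplex A)}
    (h₁ : ∀ S : ShortComplex A, E S → Nonempty (IsColimit (CokernelCofork.ofπ S.g S.zero)))
    (X : A) : isLeftExact E (preadditiveYoneda.obj X) := by
  refine ⟨inferInstance, fun S hS => ?_⟩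
  obtain ⟨hc⟩ := h₁ S hS
  constructor
  · intro a b hab
    exact Cofork.IsColimit.hom_ext hc hab
  · intro y
    constructor
    · intro hy
      obtain ⟨l, hl⟩ := CokernelCofork.IsColimit.desc' hc y hy
      exact ⟨l, hl⟩
    · rintro ⟨z, rfl⟩
      exact comp_g_eq_zero S z

lemma yoneda_indPresented {κ : Cardinal.{w}} (hκ : Cardinal.aleph0 ≤ κ)
    {E : ObjectProperty (ShortComplex A)} {P Q : ObjectProperty A}
    (h₁ : ∀ S : ShortComplex A, E S → Nonempty (IsColimit (CokernelCofork.ofπ S.g S.zero)))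
    (h₂ : ∀ X : A, monoCokerIn E Q (𝟙 X)) (X : A) (hX : P X) :
    indPresented κ E P Q ⟨preadditiveYoneda.obj X, yoneda_isLeftExact h₁ X⟩ := by
  refine ⟨PUnit, inferInstance, inferInstance, inferInstance, (Functor.const _).obj X,
    { app := fun _ => 𝟙 _ }, ?_, fun _ => hX, fun _ => h₂ X, ⟨?_⟩⟩
  · rw [Cardinal.mk_punit]
    exact Cardinal.one_le_aleph0.trans hκ
  · exact
      { desc := fun s => s.ι.app PUnit.unit
        fac := fun s j => by
          cases j
          exact Category.id_comp _
        uniq := fun s m hm => by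
          rw [← hm PUnit.unit]
          exact (Category.id_comp _).symm }

/-- The inclusion `A ⥤ Ind(A, Q)`, `X ↦ Hom(-, X)`. -/
def toInd {κ : Cardinal.{w}} (hκ : Cardinal.aleph0 ≤ κ)
    {E : ObjectProperty (ShortComplex A)} {Q : ObjectProperty A}
    (h₁ : ∀ S : ShortComplex A, E S → Nonempty (IsColimit (CokernelCofork.ofπ S.g S.zero)))
    (h₂ : ∀ X : A, monoCokerIn E Q (𝟙 X)) : A ⥤ IndRel κ E Q :=
  ObjectProperty.lift _
    (ObjectProperty.lift _ preadditiveYoneda (yoneda_isLeftExact h₁))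
    (fun X => yoneda_indPresented hκ h₁ h₂ X trivial)

end Exact

/-! ### Admissible Pro objects and relative elementary Tate objects -/

section Pro

variable {D : Type u} [Category.{v} D] [Preadditive D]

/-- The category `Pro(D) = Ind(Dᵒᵖ)ᵒᵖ` of admissible Pro objects. -/
abbrev Pro (κ : Cardinal.{w}) (E : ObjectProperty (ShortComplex D)) :=
  (IndRel κ (opConfl E) ⊤)ᵒᵖ

/-- The short exact sequences of `Pro(D)`. -/
abbrev proConfl (κ : Cardinal.{w}) (E : ObjectProperty (ShortComplex D)) :
    ObjectProperty (ShortComplex (Pro κ E)) :=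
  opConfl (indConfl κ (opConfl E) ⊤)

lemma opConfl_cokernel {E : ObjectProperty (ShortComplex D)} (hE : IsExactStructure E)
    (S : ShortComplex Dᵒᵖ) (hS : opConfl E S) :
    Nonempty (IsColimit (CokernelCofork.ofπ S.g S.zero)) := by
  obtain ⟨⟨hl⟩, -⟩ := hE.isKernelCokernelPair hS
  refine ⟨CokernelCofork.IsColimit.ofπ _ _
    (fun k hk => (KernelFork.IsLimit.lift' hl k.unop (Quiver.Hom.op_inj hk)).1.op)
    (fun k hk => Quiver.Hom.unop_inj
      (KernelFork.IsLimit.lift' hl k.unop (Quiver.Hom.op_inj hk)).2)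
    (fun k hk m hm => ?_)⟩
  apply Quiver.Hom.unop_inj
  apply Fork.IsLimit.hom_ext hl
  exact (congrArg Quiver.Hom.unop hm).trans
    (KernelFork.IsLimit.lift' hl k.unop (Quiver.Hom.op_inj hk)).2.symm

lemma opConfl_id {E : ObjectProperty (ShortComplex D)} (hE : IsExactStructure E) (X : Dᵒᵖ) :
    monoCokerIn (opConfl E) ⊤ (𝟙 X) := by
  obtain ⟨K, f, h, -, hS⟩ := hE.id_admEpi X.unop
  exact ⟨Opposite.op K, f.op, Quiver.Hom.unop_inj h, trivial, hS⟩

/-- The inclusion `D ⥤ Pro(D)`. -/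
def toPro {κ : Cardinal.{w}} (hκ : Cardinal.aleph0 ≤ κ) {E : ObjectProperty (ShortComplex D)}
    (hE : IsExactStructure E) : D ⥤ Pro κ E :=
  opOp D ⋙ (toInd hκ (opConfl_cokernel hE) (opConfl_id hE)).op

/-- The full subcategory `C ⊆ Pro(D)` (closed under isomorphisms), for `C ⊆ D`. -/
abbrev inPro {κ : Cardinal.{w}} (hκ : Cardinal.aleph0 ≤ κ)
    {E : ObjectProperty (ShortComplex D)} (hE : IsExactStructure E) (C : ObjectProperty D) :
    ObjectProperty (Pro κ E) :=
  C.map (toPro hκ hE)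

/-- The category of relative elementary Tate objects, `Ind(Pro(D), C)`. -/
abbrev ElTate {κ : Cardinal.{w}} (hκ : Cardinal.aleph0 ≤ κ)
    {E : ObjectProperty (ShortComplex D)} (hE : IsExactStructure E) (C : ObjectProperty D) :=
  IndRel κ (proConfl κ E) (inPro hκ hE C)

/-- The short exact sequences of relative elementary Tate objects. -/
abbrev tateConfl {κ : Cardinal.{w}} (hκ : Cardinal.aleph0 ≤ κ)
    {E : ObjectProperty (ShortComplex D)} (hE : IsExactStructure E) (C : ObjectProperty D) :
    ObjectProperty (ShortComplex (ElTate hκ hE C)) :=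
  indConfl κ (proConfl κ E) (inPro hκ hE C)

/-- The full subcategory `Ind(C)` of the category of relative elementary Tate objects: the objects
that are the colimit of an admissible Ind diagram in `C`. -/
def indInTate {κ : Cardinal.{w}} (hκ : Cardinal.aleph0 ≤ κ)
    {E : ObjectProperty (ShortComplex D)} (hE : IsExactStructure E) (C : ObjectProperty D) :
    ObjectProperty (ElTate hκ hE C) :=
  fun V => indPresented κ (proConfl κ E) (inPro hκ hE C) (inPro hκ hE C) V.obj

lemma proConfl_cokernel {κ : Cardinal.{w}} {E : ObjectProperty (ShortComplex D)}
    (S : ShortComplex (Pro κ E)) (hS : proConfl κ E S) :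
    Nonempty (IsColimit (CokernelCofork.ofπ S.g S.zero)) := by
  obtain ⟨⟨hl⟩, -⟩ := hS
  let J := IndRel.toLex κ (opConfl E) ⊤
  have key : ∀ {Z : Pro κ E} (k : S.X₂ ⟶ Z), S.f ≫ k = 0 → J.map k.unop ≫ J.map S.f.unop = 0 := by
    intro Z k hk
    rw [← J.map_comp, ← unop_comp, hk]
    rfl
  refine ⟨CokernelCofork.IsColimit.ofπ _ _
    (fun k hk => (J.preimage (KernelFork.IsLimit.lift' hl (J.map k.unop) (key k hk)).1).op)
    (fun k hk => ?_) (fun k hk m hm => ?_)⟩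
  · apply Quiver.Hom.unop_inj
    apply J.map_injective
    refine (J.map_comp _ _).trans ?_
    refine Eq.trans ?_ (KernelFork.IsLimit.lift' hl (J.map k.unop) (key k hk)).2
    exact congrArg (fun t => t ≫ J.map S.g.unop) (J.map_preimage _)
  · apply Quiver.Hom.unop_inj
    apply J.map_injective
    refine Eq.trans ?_ (J.map_preimage _).symm
    apply Fork.IsLimit.hom_ext hl
    refine Eq.trans ?_ (KernelFork.IsLimit.lift' hl (J.map k.unop) (key k hk)).2.symm
    exact (J.map_comp _ _).symm.trans (congrArg (fun t => J.map (Quiver.Hom.unop t)) hm)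

lemma toPro_isZero {κ : Cardinal.{w}} (hκ : Cardinal.aleph0 ≤ κ)
    {E : ObjectProperty (ShortComplex D)} (hE : IsExactStructure E) {Z : D} (hZ : IsZero Z) :
    IsZero ((toPro hκ hE).obj Z) := by
  rw [IsZero.iff_id_eq_zero]
  refine ((toPro hκ hE).map_id Z).symm.trans ?_
  rw [(IsZero.iff_id_eq_zero Z).1 hZ]
  apply Quiver.Hom.unop_inj
  apply ObjectProperty.hom_ext
  apply ObjectProperty.hom_ext
  ext X (f : X.unop ⟶ Opposite.op Z)
  exact (comp_zero : f ≫ (0 : Opposite.op Z ⟶ Opposite.op Z) = 0)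

lemma proConfl_id {κ : Cardinal.{w}} (hκ : Cardinal.aleph0 ≤ κ)
    {E : ObjectProperty (ShortComplex D)} (hE : IsExactStructure E) {C : ObjectProperty D}
    (hC : IsExtensionClosed E C) (V : Pro κ E) :
    monoCokerIn (proConfl κ E) (inPro hκ hE C) (𝟙 V) := by
  obtain ⟨Z, hZ, hCZ⟩ := hC.zero
  have hz := toPro_isZero hκ hE hZ
  refine ⟨(toPro hκ hE).obj Z, 0, comp_zero, ⟨Z, hCZ, ⟨Iso.refl _⟩⟩, ?_⟩
  let J := IndRel.toLex κ (opConfl E) ⊤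
  have hz' : IsZero (J.obj ((toPro hκ hE).obj Z).unop) := J.map_isZero hz.unop
  have hid : J.map (𝟙 V : V ⟶ V).unop = 𝟙 (J.obj V.unop) := J.map_id _
  constructor
  · refine ⟨KernelFork.IsLimit.ofι _ _ (fun k _ => 0) (fun k hk => ?_)
      (fun k hk m hm => hz'.eq_of_tgt _ _)⟩
    have hk' : k = 0 :=
      (Category.comp_id k).symm.trans ((congrArg (fun t => k ≫ t) hid).symm.trans hk)
    exact zero_comp.trans hk'.symm
  · refine ⟨CokernelCofork.IsColimit.ofπ _ _ (fun k _ => k) (fun k hk => ?_)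
      (fun k hk m hm => ?_)⟩
    · exact (congrArg (fun t => t ≫ k) hid).trans (Category.id_comp k)
    · exact (Category.id_comp m).symm.trans ((congrArg (fun t => t ≫ m) hid).symm.trans hm)

/-- The inclusion of `Pro(D)` into the category of relative elementary Tate objects. -/
def proToTate {κ : Cardinal.{w}} (hκ : Cardinal.aleph0 ≤ κ)
    {E : ObjectProperty (ShortComplex D)} (hE : IsExactStructure E) {C : ObjectProperty D}
    (hC : IsExtensionClosed E C) : Pro κ E ⥤ ElTate hκ hE C :=
  toInd hκ proConfl_cokernel (proConfl_id hκ hE hC)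

/-- The inclusion `C ⥤ Pro(D)` of a full subcategory `C` of `D`. -/
abbrev subToPro {κ : Cardinal.{w}} (hκ : Cardinal.aleph0 ≤ κ)
    {E : ObjectProperty (ShortComplex D)} (hE : IsExactStructure E) (C : ObjectProperty D) :
    C.FullSubcategory ⥤ Pro κ E :=
  C.ι ⋙ toPro hκ hE

/-- The quotient `Pro(D) / C`. -/
abbrev ProQuot {κ : Cardinal.{w}} (hκ : Cardinal.aleph0 ≤ κ)
    {E : ObjectProperty (ShortComplex D)} (hE : IsExactStructure E) (C : ObjectProperty D) :=
  Quot (proConfl κ E) (inPro hκ hE C)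

/-- The quotient of the category of relative elementary Tate objects by `Ind(C)`. -/
abbrev TateQuot {κ : Cardinal.{w}} (hκ : Cardinal.aleph0 ≤ κ)
    {E : ObjectProperty (ShortComplex D)} (hE : IsExactStructure E) (C : ObjectProperty D) :=
  Quot (tateConfl hκ hE C) (indInTate hκ hE C)

end Pro

end RelTate

/-! Put A = Pro(D) and P = C. An object V of Ind(A, P) is a directed union of subobjects X_i from A
with X_j / X_i in P, so all the X_i become canonically isomorphic in A / P; their common value is
the stalk of V. On the other hand V / X_i is the union of the X_j / X_i, an object of Ind(P), so V
becomes isomorphic to X_i in Ind(A, P) / Ind(P). Hence the functor induced by stalks is inverse to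
the one induced by the inclusion (`stalkFunctor`, `quotToIndQuot_map_indGerm`, `quotEquivalence`).

That stalks invert the weak isomorphisms and preserve short exact sequences is read off from
diagrams. A kernel-cokernel pair of left exact presheaves is a sequence that is left exact on
sections and locally surjective for covers by admissible epimorphisms
(`isKernelCokernelPair_lex_iff`). If U → V → W is such a sequence and U, W are Ind objects, then V
is a directed union of middle terms of conflations of A whose ends are stages of U and W
(`exists_straightening`). This also shows that Ind objects are closed under extensions and provides
pushouts, whence the exact structure on Ind(A, P) and, by duality, on Pro(D)
(`isExactStructure_indConfl`, `isExactStructure_proConfl`).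

The quotient A / P is exact if P is right s-filtering and its idempotents split
(`isExactStructure_quotConfl`). Filtering gives a right calculus of fractions for the admissible
monomorphisms with cokernel in P, and specialness shows that inverting them inverts the admissible
epimorphisms with kernel in P. The delicate axiom is composition, because two composable admissible
morphisms share their middle object only up to an isomorphism of the quotient. Split idempotents
allow a map Y → Y₁ that becomes invertible to be lifted to an admissible monomorphism Y → Y₁ ⊕ N
with N and the cokernel in P (`exists_lift_of_isIso`). All these properties of P pass from C in D to
C in Pro(D) (`isSplitRightSFiltering_inPro`).

The additive and exact structures of Ind(A, P) / Ind(P) are transported along the equivalence, so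
fractions are only ever computed in A. -/

namespace RelTate

/-! ### Elementary calculus of conflations -/

section Toolkit

variable {A : Type u} [Category.{v} A] [Preadditive A] {E : ObjectProperty (ShortComplex A)}

/-- Uniqueness is carried by `Mono` and `Epi`, so later verifications reduce to producing
factorizations. -/
lemma isKernelCokernelPair_iff (S : ShortComplex A) :
    IsKernelCokernelPair S ↔ (Mono S.f ∧ ∀ (T : A) (k : T ⟶ S.X₂), k ≫ S.g = 0 → ∃ l, l ≫ S.f = k) ∧
      (Epi S.g ∧ ∀ (T : A) (k : S.X₂ ⟶ T), S.f ≫ k = 0 → ∃ l, S.g ≫ l = k) := by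
  constructor
  · rintro ⟨⟨hl⟩, ⟨hc⟩⟩
    refine ⟨⟨⟨fun a b hab => Fork.IsLimit.hom_ext hl hab⟩, fun T k hk => ?_⟩,
      ⟨⟨fun a b hab => Cofork.IsColimit.hom_ext hc hab⟩, fun T k hk => ?_⟩⟩
    · exact ⟨_, (KernelFork.IsLimit.lift' hl k hk).2⟩
    · exact ⟨_, (CokernelCofork.IsColimit.desc' hc k hk).2⟩
  · rintro ⟨⟨h₁, h₂⟩, ⟨h₃, h₄⟩⟩
    choose l hl using h₂
    choose d hd using h₄
    exact ⟨⟨KernelFork.IsLimit.ofι _ _ (fun k hk => l _ k hk) (fun k hk => hl _ k hk)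
      (fun k hk m hm => by rw [← cancel_mono S.f, hm, hl])⟩,
      ⟨CokernelCofork.IsColimit.ofπ _ _ (fun k hk => d _ k hk) (fun k hk => hd _ k hk)
      (fun k hk m hm => by rw [← cancel_epi S.g, hm, hd])⟩⟩

namespace IsExactStructure

section

variable {X Y Z : A} {f : X ⟶ Y} {g : Y ⟶ Z} {h : f ≫ g = 0}

lemma mono (hE : IsExactStructure E) (hS : E (.mk f g h)) : Mono f :=
  ((isKernelCokernelPair_iff _).1 (hE.isKernelCokernelPair hS)).1.1

lemma epi (hE : IsExactStructure E) (hS : E (.mk f g h)) : Epi g :=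
  ((isKernelCokernelPair_iff _).1 (hE.isKernelCokernelPair hS)).2.1

lemma lift (hE : IsExactStructure E) (hS : E (.mk f g h)) {T : A} (k : T ⟶ Y) (hk : k ≫ g = 0) :
    ∃ l : T ⟶ X, l ≫ f = k :=
  ((isKernelCokernelPair_iff _).1 (hE.isKernelCokernelPair hS)).1.2 T k hk

lemma desc (hE : IsExactStructure E) (hS : E (.mk f g h)) {T : A} (k : Y ⟶ T) (hk : f ≫ k = 0) :
    ∃ l : Z ⟶ T, g ≫ l = k :=
  ((isKernelCokernelPair_iff _).1 (hE.isKernelCokernelPair hS)).2.2 T k hk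

lemma of_isos (hE : IsExactStructure E) (hS : E (.mk f g h)) {X' Y' Z' : A} {f' : X' ⟶ Y'}
    {g' : Y' ⟶ Z'} (e₁ : X ≅ X') (e₂ : Y ≅ Y') (e₃ : Z ≅ Z') (w₁ : e₁.hom ≫ f' = f ≫ e₂.hom)
    (w₂ : e₂.hom ≫ g' = g ≫ e₃.hom) : ∃ h' : f' ≫ g' = 0, E (.mk f' g' h') := by
  have h' : f' ≫ g' = 0 := by
    rw [← cancel_epi e₁.hom, ← Category.assoc, w₁, Category.assoc, w₂, ← Category.assoc, h]
    simp
  exact ⟨h', hE.of_iso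
    (ShortComplex.isoMk (S₁ := .mk f g h) (S₂ := .mk f' g' h') e₁ e₂ e₃ w₁ w₂) hS⟩

/-- Any other cokernel of an admissible monomorphism gives a conflation. -/
lemma of_cokernel (hE : IsExactStructure E) (hS : E (.mk f g h)) {Z' : A} {g' : Y ⟶ Z'}
    (h' : f ≫ g' = 0) [Epi g'] (hd : ∀ {T : A} (k : Y ⟶ T), f ≫ k = 0 → ∃ l : Z' ⟶ T, g' ≫ l = k) :
    E (.mk f g' h') := by
  have := hE.epi hS
  obtain ⟨a, ha⟩ := hE.desc hS g' h'
  obtain ⟨b, hb⟩ := hd g h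
  let e : Z ≅ Z' := ⟨a, b, by rw [← cancel_epi g, reassoc_of% ha, hb, Category.comp_id],
    by rw [← cancel_epi g', reassoc_of% hb, ha, Category.comp_id]⟩
  exact (hE.of_isos hS (Iso.refl _) (Iso.refl _) e (by simp) (by simp [e, ha])).2

/-- Any other kernel of an admissible epimorphism gives a conflation. -/
lemma of_kernel (hE : IsExactStructure E) (hS : E (.mk f g h)) {X' : A} {f' : X' ⟶ Y}
    (h' : f' ≫ g = 0) [Mono f'] (hd : ∀ {T : A} (k : T ⟶ Y), k ≫ g = 0 → ∃ l : T ⟶ X', l ≫ f' = k) :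
    E (.mk f' g h') := by
  have := hE.mono hS
  obtain ⟨a, ha⟩ := hE.lift hS f' h'
  obtain ⟨b, hb⟩ := hd f h
  let e : X ≅ X' := ⟨b, a, by rw [← cancel_mono f, Category.assoc, ha, hb, Category.id_comp],
    by rw [← cancel_mono f', Category.assoc, hb, ha, Category.id_comp]⟩
  exact (hE.of_isos hS e (Iso.refl _) (Iso.refl _) (by simp [e, hb]) (by simp)).2

end

lemma admEpi_of_confl {Q : ObjectProperty A} {X Y Z : A} {f : X ⟶ Y} {g : Y ⟶ Z}
    {h : f ≫ g = 0} (hS : E (.mk f g h)) (hQ : Q X) : epiKerIn E Q g := ⟨X, f, h, hQ, hS⟩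

lemma mono_of_monoCokerIn (hE : IsExactStructure E) {Q : ObjectProperty A} {X Y : A} {f : X ⟶ Y}
    (hf : monoCokerIn E Q f) : Mono f := by
  obtain ⟨_, _, _, _, hS⟩ := hf
  exact hE.mono hS

lemma monoCokerIn_mono {Q Q' : ObjectProperty A} (hQ : Q ≤ Q') {X Y : A} {f : X ⟶ Y}
    (hf : monoCokerIn E Q f) : monoCokerIn E Q' f := by
  obtain ⟨Z, g, h, hZ, hS⟩ := hf
  exact ⟨Z, g, h, hQ _ hZ, hS⟩

/-- The pushout of a conflation along a morphism from its first term. -/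
lemma pushout_confl (hE : IsExactStructure E) {X Y Z X' Y' : A} {i : X ⟶ Y} {p : Y ⟶ Z}
    {h : i ≫ p = 0} (hS : E (.mk i p h)) {f : X ⟶ X'} {f' : Y ⟶ Y'} {i' : X' ⟶ Y'}
    (sq : IsPushout i f f' i') :
    ∃ (p' : Y' ⟶ Z) (h' : i' ≫ p' = 0), f' ≫ p' = p ∧ E (.mk i' p' h') := by
  obtain ⟨Y₁, f₁, i₁, sq₁, ⟨Z₁, q₁, hq₁, -, hS₁⟩⟩ := hE.pushout_admMono i f ⟨Z, p, h, trivial, hS⟩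
  have hp := hE.epi hS
  let p' : Y' ⟶ Z := sq.desc p 0 (by simp [h])
  have e₁ : f' ≫ p' = p := sq.inl_desc _ _ _
  have e₂ : i' ≫ p' = 0 := sq.inr_desc _ _ _
  refine ⟨p', e₂, e₁, ?_⟩
  have : Epi p' := by
    have : Epi (f' ≫ p') := by rwa [e₁]
    exact epi_of_epi f' p'
  -- The axiom speaks of some pushout; its conflation is moved to the given one, and then its
  -- cokernel is exchanged for `p'`.
  let e := sq₁.isoIsPushout _ _ sq
  obtain ⟨h₂, hS₂⟩ := hE.of_isos (f' := i') (g' := e.inv ≫ q₁) hS₁ (Iso.refl _) e (Iso.refl _)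
    (by simp [e]) (by simp)
  refine hE.of_cokernel hS₂ e₂ (fun k hk => ?_)
  obtain ⟨l, hl⟩ := hE.desc hS (f' ≫ k) (by rw [sq.w_assoc, hk, comp_zero])
  refine ⟨l, sq.hom_ext ?_ ?_⟩
  · rw [reassoc_of% e₁, hl]
  · rw [reassoc_of% e₂, hk, zero_comp]

/-- The pullback of a conflation along a morphism to its last term. -/
lemma pullback_confl (hE : IsExactStructure E) {X Y Z Z' Y' : A} {i : X ⟶ Y} {p : Y ⟶ Z}
    {h : i ≫ p = 0} (hS : E (.mk i p h)) {f : Z' ⟶ Z} {f' : Y' ⟶ Y} {p' : Y' ⟶ Z'}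
    (sq : IsPullback f' p' p f) :
    ∃ (i' : X ⟶ Y') (h' : i' ≫ p' = 0), i' ≫ f' = i ∧ E (.mk i' p' h') := by
  obtain ⟨Y₁, f₁, p₁, sq₁, ⟨X₁, j₁, hj₁, -, hS₁⟩⟩ := hE.pullback_admEpi p f ⟨X, i, h, trivial, hS⟩
  have hp := hE.mono hS
  let i' : X ⟶ Y' := sq.lift i 0 (by simp [h])
  have e₁ : i' ≫ f' = i := sq.lift_fst _ _ _
  have e₂ : i' ≫ p' = 0 := sq.lift_snd _ _ _
  refine ⟨i', e₂, e₁, ?_⟩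
  have : Mono i' := by
    have : Mono (i' ≫ f') := by rwa [e₁]
    exact mono_of_mono i' f'
  let e := sq₁.isoIsPullback _ _ sq
  obtain ⟨h₂, hS₂⟩ := hE.of_isos (f' := j₁ ≫ e.hom) (g' := p') hS₁ (Iso.refl _) e (Iso.refl _)
    (by simp) (by simp [e])
  refine hE.of_kernel hS₂ e₂ (fun k hk => ?_)
  obtain ⟨l, hl⟩ := hE.lift hS (k ≫ f') (by rw [Category.assoc, sq.w, reassoc_of% hk, zero_comp])
  refine ⟨l, sq.hom_ext ?_ ?_⟩
  · rw [Category.assoc, e₁, hl]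
  · rw [Category.assoc, e₂, hk, comp_zero]

lemma exists_pushout (hE : IsExactStructure E) {X Y Z X' : A} {i : X ⟶ Y} {p : Y ⟶ Z}
    {h : i ≫ p = 0} (hS : E (.mk i p h)) (f : X ⟶ X') :
    ∃ (Y' : A) (f' : Y ⟶ Y') (i' : X' ⟶ Y') (p' : Y' ⟶ Z) (h' : i' ≫ p' = 0),
      IsPushout i f f' i' ∧ f' ≫ p' = p ∧ E (.mk i' p' h') := by
  obtain ⟨Y₁, f₁, i₁, sq₁, -⟩ := hE.pushout_admMono i f ⟨Z, p, h, trivial, hS⟩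
  obtain ⟨p', h', h₁, h₂⟩ := hE.pushout_confl hS sq₁
  exact ⟨Y₁, f₁, i₁, p', h', sq₁, h₁, h₂⟩

lemma exists_pullback (hE : IsExactStructure E) {X Y Z Z' : A} {i : X ⟶ Y} {p : Y ⟶ Z}
    {h : i ≫ p = 0} (hS : E (.mk i p h)) (f : Z' ⟶ Z) :
    ∃ (Y' : A) (f' : Y' ⟶ Y) (p' : Y' ⟶ Z') (i' : X ⟶ Y') (h' : i' ≫ p' = 0),
      IsPullback f' p' p f ∧ i' ≫ f' = i ∧ E (.mk i' p' h') := by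
  obtain ⟨Y₁, f₁, i₁, sq₁, -⟩ := hE.pullback_admEpi p f ⟨X, i, h, trivial, hS⟩
  obtain ⟨p', h', h₁, h₂⟩ := hE.pullback_confl hS sq₁
  exact ⟨Y₁, f₁, i₁, p', h', sq₁, h₁, h₂⟩

/-- An isomorphism followed by a map to a zero object is a conflation. -/
lemma confl_of_isIso (hE : IsExactStructure E) {X Y Z : A} (f : X ⟶ Y) [IsIso f] (hZ : IsZero Z) :
    E (.mk f (0 : Y ⟶ Z) comp_zero) := by
  obtain ⟨Z₁, g, hg, -, hS⟩ := hE.id_admMono X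
  have hZ₁ : IsZero Z₁ := by
    have := hE.epi hS
    rw [IsZero.iff_id_eq_zero, ← cancel_epi g]
    simpa using hg
  exact (hE.of_isos hS (Iso.refl X) (asIso f) (hZ₁.iso hZ) (by simp) (hZ.eq_of_tgt _ _)).2

/-- The biproduct is the pullback of `X → 0` along `Y → 0`, so this is a pullback of the conflation
`X = X → 0`. -/
lemma confl_inl_snd (hE : IsExactStructure E) [HasBinaryBiproducts A] (X Y : A) :
    E (.mk (biprod.inl : X ⟶ X ⊞ Y) biprod.snd biprod.inl_snd) := by
  obtain ⟨Z, hZ⟩ := hE.hasZeroObject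
  have sq : IsPullback (biprod.fst : X ⊞ Y ⟶ X) biprod.snd (0 : X ⟶ Z) (0 : Y ⟶ Z) :=
    { w := by simp
      isLimit' := ⟨PullbackCone.IsLimit.mk _ (fun s => biprod.lift s.fst s.snd) (by simp) (by simp)
        (fun s m h₁ h₂ => by
          ext
          · simpa using h₁
          · simpa using h₂)⟩ }
  obtain ⟨i', h', h₁, h₂⟩ := hE.pullback_confl (hE.confl_of_isIso (𝟙 X) hZ) sq
  obtain rfl : i' = biprod.inl := by
    ext
    · simpa using h₁
    · simpa using h'
  exact h₂

lemma confl_inr_fst (hE : IsExactStructure E) [HasBinaryBiproducts A] (X Y : A) :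
    E (.mk (biprod.inr : Y ⟶ X ⊞ Y) biprod.fst biprod.inr_fst) :=
  (hE.of_isos (hE.confl_inl_snd Y X) (Iso.refl _) (biprod.braiding _ _) (Iso.refl _)
    (by ext <;> simp) (by ext <;> simp)).2

/-- The direct sum of a conflation with the identity of an object. -/
lemma confl_biprod_map_id (hE : IsExactStructure E) [HasBinaryBiproducts A] {X Y Z : A} {i : X ⟶ Y}
    {p : Y ⟶ Z} {h : i ≫ p = 0} (hS : E (.mk i p h)) (N : A) :
    E (.mk (biprod.map i (𝟙 N)) (biprod.fst ≫ p) (by simp [h])) := by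
  have sq : IsPushout i (biprod.inl : X ⟶ X ⊞ N) (biprod.inl : Y ⟶ Y ⊞ N) (biprod.map i (𝟙 N)) :=
    { w := by simp
      isColimit' := ⟨PushoutCocone.IsColimit.mk _
        (fun s => biprod.desc s.inl (biprod.inr ≫ s.inr)) (by simp)
        (fun s => by
          apply biprod.hom_ext'
          · simpa using s.condition
          · simp)
        (fun s m h₁ h₂ => by
          apply biprod.hom_ext'
          · simpa using h₁
          · simp [← h₂])⟩ }
  obtain ⟨p', h', h₁, h₂⟩ := hE.pushout_confl hS sq
  obtain rfl : p' = biprod.fst ≫ p := by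
    apply biprod.hom_ext'
    · simpa using h₁
    · have := congrArg (fun t => biprod.inr ≫ t) h'
      simpa using this
  exact h₂

/-- A pushout square along an admissible monomorphism is a conflation. -/
lemma confl_of_isPushout (hE : IsExactStructure E) [HasBinaryBiproducts A] {X Y X' Y' : A}
    {i : X ⟶ Y} (hi : admMono E i) {f : X ⟶ X'} {f' : Y ⟶ Y'} {i' : X' ⟶ Y'}
    (sq : IsPushout i f f' i') :
    E (.mk (biprod.lift i (-f)) (biprod.desc f' i') (by simp [sq.w])) := by
  obtain ⟨Z, p, h, -, hS⟩ := hi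
  -- The map `(i, -f)` is the graph `(1, -f)` followed by `i ⊕ 1`. The graph is the inclusion of a
  -- summand moved by the shear automorphism `e`.
  have m₁ : admMono E (biprod.lift (𝟙 X) (-f)) := by
    let e : X ⊞ X' ≅ X ⊞ X' :=
      { hom := biprod.lift biprod.fst (biprod.snd - biprod.fst ≫ f)
        inv := biprod.lift biprod.fst (biprod.snd + biprod.fst ≫ f) }
    obtain ⟨h₁, h₂⟩ := hE.of_isos (f' := biprod.lift (𝟙 X) (-f)) (g' := e.inv ≫ biprod.snd)
      (hE.confl_inl_snd X X') (Iso.refl _) e (Iso.refl _) (by ext <;> simp [e]) (by simp)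
    exact ⟨_, _, _, trivial, h₂⟩
  have m₂ : admMono E (biprod.map i (𝟙 X')) := ⟨_, _, _, trivial, hE.confl_biprod_map_id hS X'⟩
  have m₃ := hE.comp_admMono _ _ m₁ m₂
  have e : biprod.lift (𝟙 X) (-f) ≫ biprod.map i (𝟙 X') = biprod.lift i (-f) := by
    ext <;> simp
  rw [e] at m₃
  obtain ⟨C, q, hq, -, hC⟩ := m₃
  have : Epi (biprod.desc f' i') := ⟨fun a b hab => sq.hom_ext
    (by simpa using congrArg (fun t => biprod.inl ≫ t) hab)
    (by simpa using congrArg (fun t => biprod.inr ≫ t) hab)⟩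
  refine hE.of_cokernel hC _ (fun k hk => ⟨sq.desc (biprod.inl ≫ k) (biprod.inr ≫ k) ?_, ?_⟩)
  · rw [biprod.lift_eq, Preadditive.add_comp] at hk
    simpa [← sub_eq_add_neg, sub_eq_zero] using hk
  · apply biprod.hom_ext' <;> simp

/-- A pullback square along an admissible epimorphism is a conflation. -/
lemma confl_of_isPullback (hE : IsExactStructure E) [HasBinaryBiproducts A] {Y Z Z' Y' : A}
    {p : Y ⟶ Z} (hp : admEpi E p) {f : Z' ⟶ Z} {f' : Y' ⟶ Y} {p' : Y' ⟶ Z'}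
    (sq : IsPullback f' p' p f) :
    E (.mk (biprod.lift f' p') (biprod.desc p (-f)) (by simp [sq.w])) := by
  obtain ⟨X, i, h, -, hS⟩ := hp
  -- Dually, `(p, -f)` is `p ⊕ 1` followed by `(1, -f)`, which is a sheared projection.
  have m₁ : admEpi E (biprod.desc (𝟙 Z) (-f)) := by
    let e : Z ⊞ Z' ≅ Z ⊞ Z' :=
      { hom := biprod.lift (biprod.fst + biprod.snd ≫ f) biprod.snd
        inv := biprod.lift (biprod.fst - biprod.snd ≫ f) biprod.snd }
    obtain ⟨h₁, h₂⟩ := hE.of_isos (f' := biprod.inr ≫ e.hom) (g' := biprod.desc (𝟙 Z) (-f))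
      (hE.confl_inr_fst Z Z') (Iso.refl _) e (Iso.refl _) (by simp) (by
        apply biprod.hom_ext' <;> simp [e, biprod.lift_desc])
    exact ⟨_, _, _, trivial, h₂⟩
  have m₂ : admEpi E (biprod.map p (𝟙 Z')) := by
    refine ⟨X, i ≫ biprod.inl, by simp [reassoc_of% h], trivial, ?_⟩
    have sq' : IsPullback (biprod.fst : Y ⊞ Z' ⟶ Y) (biprod.map p (𝟙 Z')) p biprod.fst :=
      { w := by simp
        isLimit' := ⟨PullbackCone.IsLimit.mk _ (fun s => biprod.lift s.fst (s.snd ≫ biprod.snd))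
          (by simp) (fun s => by
            ext
            · simpa using s.condition
            · simp)
          (fun s m h₁ h₂ => by
            ext
            · simpa using h₁
            · simp [← h₂])⟩ }
    obtain ⟨i', h', h₁, h₂⟩ := hE.pullback_confl hS sq'
    obtain rfl : i' = i ≫ biprod.inl := by
      ext
      · simpa using h₁
      · simpa using congrArg (fun t => t ≫ biprod.snd) h'
    exact h₂
  have m₃ := hE.comp_admEpi _ _ m₂ m₁
  have e : biprod.map p (𝟙 Z') ≫ biprod.desc (𝟙 Z) (-f) = biprod.desc p (-f) := by
    apply biprod.hom_ext' <;> simp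
  rw [e] at m₃
  obtain ⟨C, q, hq, -, hC⟩ := m₃
  have : Mono (biprod.lift f' p') := ⟨fun a b hab => sq.hom_ext
    (by simpa using congrArg (fun t => t ≫ biprod.fst) hab)
    (by simpa using congrArg (fun t => t ≫ biprod.snd) hab)⟩
  refine hE.of_kernel hC _ (fun k hk => ⟨sq.lift (k ≫ biprod.fst) (k ≫ biprod.snd) ?_, ?_⟩)
  · rw [biprod.desc_eq, Preadditive.comp_add] at hk
    simpa [← sub_eq_add_neg, sub_eq_zero] using hk
  · ext <;> simp

/-- A morphism of conflations that is the identity on both ends is an isomorphism. -/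
lemma isIso_of_confl (hE : IsExactStructure E) {X Y Y' Z : A} {i : X ⟶ Y} {p : Y ⟶ Z}
    {h : i ≫ p = 0} (hS : E (.mk i p h)) {i' : X ⟶ Y'} {p' : Y' ⟶ Z} {h' : i' ≫ p' = 0}
    (hS' : E (.mk i' p' h')) (t : Y ⟶ Y') (w₁ : i ≫ t = i') (w₂ : t ≫ p' = p) : IsIso t := by
  have mi' := hE.mono hS'
  -- On the fibre product `B` of `p` and `p'` the maps `a ≫ t` and `b` to `Y'` lie over the same map
  -- to `Z`, so they differ by some `r : B → X`. Then `a + r ≫ i` kills the kernel of `b`, and it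
  -- descends to the inverse `s` of `t`.
  obtain ⟨B, a, b, j, hj, sq, hja, hB⟩ := hE.exists_pullback hS p'
  have := hE.epi hB
  obtain ⟨r, hr⟩ := hE.lift hS' (b - a ≫ t) (by
    rw [Preadditive.sub_comp, Category.assoc, w₂, sq.w, sub_self])
  have hjr : j ≫ r = - 𝟙 X := by
    rw [← cancel_mono i', Category.assoc, hr, Preadditive.comp_sub, hj, reassoc_of% hja, w₁]
    simp
  obtain ⟨s, hs⟩ := hE.desc hB (a + r ≫ i) (by
    rw [Preadditive.comp_add, hja, reassoc_of% hjr]; simp)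
  let c : Y ⟶ B := sq.lift (𝟙 Y) t (by simp [w₂])
  have hca : c ≫ a = 𝟙 Y := sq.lift_fst _ _ _
  have hcb : c ≫ b = t := sq.lift_snd _ _ _
  have hcr : c ≫ r = 0 := by
    rw [← cancel_mono i', Category.assoc, hr, Preadditive.comp_sub, hcb, reassoc_of% hca]
    simp
  refine ⟨s, ?_, ?_⟩
  · rw [← hcb, Category.assoc, hs, Preadditive.comp_add, hca, reassoc_of% hcr]
    simp
  · rw [← cancel_epi b, reassoc_of% hs, Preadditive.add_comp, Category.assoc, w₁, hr]
    simp

/-- A morphism of conflations that is the identity on the last term is a pushout. -/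
lemma isPushout_of_confl (hE : IsExactStructure E) {X Y X' Y' Z : A} {i : X ⟶ Y} {p : Y ⟶ Z}
    {h : i ≫ p = 0} (hS : E (.mk i p h)) {i' : X' ⟶ Y'} {p' : Y' ⟶ Z} {h' : i' ≫ p' = 0}
    (hS' : E (.mk i' p' h')) (f : X ⟶ X') (f' : Y ⟶ Y') (w₁ : i ≫ f' = f ≫ i')
    (w₂ : f' ≫ p' = p) : IsPushout i f f' i' := by
  obtain ⟨Y₁, f₁, i₁, p₁, h₁, sq, hfp, hS₁⟩ := hE.exists_pushout hS f
  let t : Y₁ ⟶ Y' := sq.desc f' i' w₁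
  have ht : f₁ ≫ t = f' := sq.inl_desc _ _ _
  have ht' : i₁ ≫ t = i' := sq.inr_desc _ _ _
  have : IsIso t := hE.isIso_of_confl hS₁ hS' t ht' (sq.hom_ext (by rw [reassoc_of% ht, w₂, hfp])
    (by rw [reassoc_of% ht', h', h₁]))
  exact IsPushout.of_iso sq (Iso.refl _) (Iso.refl _) (Iso.refl _) (asIso t) (by simp) (by simp)
    (by simp [ht]) (by simp [ht'])

/-- A morphism of conflations that is the identity on the first term is a pullback. -/
lemma isPullback_of_confl (hE : IsExactStructure E) {X Y Y' Z Z' : A} {i : X ⟶ Y} {p : Y ⟶ Z}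
    {h : i ≫ p = 0} (hS : E (.mk i p h)) {i' : X ⟶ Y'} {p' : Y' ⟶ Z'} {h' : i' ≫ p' = 0}
    (hS' : E (.mk i' p' h')) (f : Z' ⟶ Z) (f' : Y' ⟶ Y) (w₁ : i' ≫ f' = i)
    (w₂ : f' ≫ p = p' ≫ f) : IsPullback f' p' p f := by
  obtain ⟨Y₁, f₁, p₁, i₁, h₁, sq, hfp, hS₁⟩ := hE.exists_pullback hS f
  let t : Y' ⟶ Y₁ := sq.lift f' p' w₂
  have ht : t ≫ f₁ = f' := sq.lift_fst _ _ _
  have ht' : t ≫ p₁ = p' := sq.lift_snd _ _ _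
  have : IsIso t := hE.isIso_of_confl hS' hS₁ t (sq.hom_ext (by rw [Category.assoc, ht, w₁, hfp])
    (by rw [Category.assoc, ht', h', h₁])) ht'
  exact IsPullback.of_iso sq (asIso t).symm (Iso.refl _) (Iso.refl _) (Iso.refl _) (by simp [← ht])
    (by simp [← ht']) (by simp) (by simp)

/-- The pullback of an admissible monomorphism along an admissible epimorphism. -/
lemma confl_of_isPullback_admMono (hE : IsExactStructure E) {Y Y' Z Z' W : A} {p : Y ⟶ Z}
    (hp : admEpi E p) {f : Z' ⟶ Z} {q : Z ⟶ W} {h : f ≫ q = 0} (hS : E (.mk f q h))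
    {f' : Y' ⟶ Y} {p' : Y' ⟶ Z'} (sq : IsPullback f' p' p f) :
    ∃ h' : f' ≫ (p ≫ q) = 0, E (.mk f' (p ≫ q) h') := by
  have h' : f' ≫ (p ≫ q) = 0 := by rw [sq.w_assoc, h, comp_zero]
  obtain ⟨K, k, hk, -, hK⟩ := hE.comp_admEpi p q hp ⟨_, f, h, trivial, hS⟩
  have := hE.mono hS
  have : Mono f' := ⟨fun a b hab => sq.hom_ext hab (by
    rw [← cancel_mono f, Category.assoc, Category.assoc, ← sq.w, reassoc_of% hab])⟩
  refine ⟨h', hE.of_kernel hK h' (fun k hk => ?_)⟩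
  obtain ⟨l, hl⟩ := hE.lift hS (k ≫ p) (by simpa using hk)
  exact ⟨sq.lift k l hl.symm, sq.lift_fst _ _ _⟩

/-- Noether isomorphism: the quotients in `X ↪ Y ↪ Z`. -/
lemma noether (hE : IsExactStructure E) {X Y Z U V W : A} {f : X ⟶ Y} {p : Y ⟶ U}
    {h₁ : f ≫ p = 0} (hf : E (.mk f p h₁)) {g : Y ⟶ Z} {q : Z ⟶ V} {h₂ : g ≫ q = 0}
    (hg : E (.mk g q h₂)) {r : Z ⟶ W} {h₃ : (f ≫ g) ≫ r = 0} (hr : E (.mk (f ≫ g) r h₃)) :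
    ∃ (a : U ⟶ W) (b : W ⟶ V) (h : a ≫ b = 0), p ≫ a = g ≫ r ∧ r ≫ b = q ∧ E (.mk a b h) := by
  have ep := hE.epi hf
  have er := hE.epi hr
  obtain ⟨a, ha⟩ := hE.desc hf (g ≫ r) (by simpa using h₃)
  have key : ∀ s : PushoutCocone g p, ∃ l, r ≫ l = s.inl := fun s => hE.desc hr s.inl (by
    rw [Category.assoc, s.condition, reassoc_of% h₁, zero_comp])
  choose l hl using key
  -- `W` is the pushout of `g` along `p`, so `a` has the same cokernel as `g`.
  have sq : IsPushout g p r a :=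
    { w := ha.symm
      isColimit' := ⟨PushoutCocone.IsColimit.mk _ l hl
        (fun s => by rw [← cancel_epi p, reassoc_of% ha, hl, s.condition])
        (fun s m h₁ h₂ => by rw [← cancel_epi r, h₁, hl])⟩ }
  obtain ⟨b, hb, h₄, h₅⟩ := hE.pushout_confl hg sq
  exact ⟨a, b, hb, ha, h₄, h₅⟩

lemma exists_comp_confl (hE : IsExactStructure E) {X Y Z U V : A} {f : X ⟶ Y} {p : Y ⟶ U}
    {h₁ : f ≫ p = 0} (hf : E (.mk f p h₁)) {g : Y ⟶ Z} {q : Z ⟶ V} {h₂ : g ≫ q = 0}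
    (hg : E (.mk g q h₂)) :
    ∃ (W : A) (r : Z ⟶ W) (h₃ : (f ≫ g) ≫ r = 0) (a : U ⟶ W) (b : W ⟶ V) (h : a ≫ b = 0),
      E (.mk (f ≫ g) r h₃) ∧ p ≫ a = g ≫ r ∧ r ≫ b = q ∧ E (.mk a b h) := by
  obtain ⟨W, r, h₃, -, hr⟩ := hE.comp_admMono f g ⟨_, _, _, trivial, hf⟩ ⟨_, _, _, trivial, hg⟩
  obtain ⟨a, b, h, h₄, h₅, h₆⟩ := hE.noether hf hg hr
  exact ⟨W, r, h₃, a, b, h, hr, h₄, h₅, h₆⟩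

end IsExactStructure

lemma IsExtensionClosed.monoCokerIn_comp (hE : IsExactStructure E) {Q : ObjectProperty A}
    (hQ : IsExtensionClosed E Q) {X Y Z : A} {f : X ⟶ Y} {g : Y ⟶ Z} (hf : monoCokerIn E Q f)
    (hg : monoCokerIn E Q g) : monoCokerIn E Q (f ≫ g) := by
  obtain ⟨U, p, h₁, hU, hS⟩ := hf
  obtain ⟨V, q, h₂, hV, hT⟩ := hg
  obtain ⟨W, r, h₃, a, b, h, h₄, -, -, h₅⟩ := hE.exists_comp_confl hS hT
  exact ⟨W, r, h₃, hQ.ext _ h₅ hU hV, h₄⟩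

lemma IsExtensionClosed.monoCokerIn_of_isIso (hE : IsExactStructure E) {Q : ObjectProperty A}
    (hQ : IsExtensionClosed E Q) {X Y : A} (f : X ⟶ Y) [IsIso f] : monoCokerIn E Q f := by
  obtain ⟨Z, hZ, hQZ⟩ := hQ.zero
  exact ⟨Z, 0, comp_zero, hQZ, hE.confl_of_isIso f hZ⟩

lemma isExtensionClosed_top (hE : IsExactStructure E) : IsExtensionClosed E ⊤ := by
  obtain ⟨Z, hZ⟩ := hE.hasZeroObject
  exact ⟨⟨Z, hZ, trivial⟩, fun _ _ _ _ => trivial⟩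

/-- In a morphism of conflations, if the outer maps are admissible monomorphisms with cokernels
in `Q`, so is the middle one. -/
lemma IsExtensionClosed.monoCokerIn_middle (hE : IsExactStructure E) {Q : ObjectProperty A}
    (hQ : IsExtensionClosed E Q) {X Y Z X' Y' Z' : A} {i : X ⟶ Y} {p : Y ⟶ Z}
    {h : i ≫ p = 0} (hS : E (.mk i p h)) {i' : X' ⟶ Y'} {p' : Y' ⟶ Z'} {h' : i' ≫ p' = 0}
    (hS' : E (.mk i' p' h')) {a : X ⟶ X'} {b : Y ⟶ Y'} {c : Z ⟶ Z'} (w₁ : i ≫ b = a ≫ i')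
    (w₂ : b ≫ p' = p ≫ c) (ha : monoCokerIn E Q a) (hc : monoCokerIn E Q c) :
    monoCokerIn E Q b := by
  obtain ⟨Z₁, r, hr, hZ₁, hcr⟩ := hc
  obtain ⟨X₁, s, hs, hX₁, has⟩ := ha
  -- `b` factors through the pullback `B` of the second conflation along `c`: the map `Y → B` is a
  -- pushout of `a` and `B → Y'` is a pullback of `c`, so their cokernels are those of `a` and `c`.
  obtain ⟨B, f, q, j, hj, sq, hjf, hB⟩ := hE.exists_pullback hS' c
  obtain ⟨hf, hfS⟩ := hE.confl_of_isPullback_admMono ⟨_, _, _, trivial, hS'⟩ hcr sq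
  let t : Y ⟶ B := sq.lift b p w₂
  have ht : t ≫ f = b := sq.lift_fst _ _ _
  have ht' : t ≫ q = p := sq.lift_snd _ _ _
  have sq' : IsPushout i a t j := hE.isPushout_of_confl hS hB a t (sq.hom_ext
    (by rw [Category.assoc, ht, w₁, Category.assoc, hjf])
    (by rw [Category.assoc, Category.assoc, ht', hj, h, comp_zero])) ht'
  obtain ⟨s', hs', -, hts⟩ := hE.pushout_confl has sq'.flip
  rw [← ht]
  exact hQ.monoCokerIn_comp hE ⟨_, s', hs', hX₁, hts⟩ ⟨_, _, hf, hZ₁, hfS⟩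

end Toolkit

end RelTate

namespace RelTate

/-! ### The opposite exact structure -/

section Opposite

variable {A : Type u} [Category.{v} A] [Preadditive A] {E : ObjectProperty (ShortComplex A)}

lemma admMono_opConfl_iff {X Y : Aᵒᵖ} (f : X ⟶ Y) :
    admMono (opConfl E) f ↔ admEpi E f.unop := by
  constructor
  · rintro ⟨Z, g, h, -, hS⟩
    exact ⟨Z.unop, g.unop, by rw [← unop_comp, h, unop_zero], trivial, hS⟩
  · rintro ⟨Z, g, h, -, hS⟩
    exact ⟨.op Z, g.op, Quiver.Hom.unop_inj h, trivial, hS⟩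

lemma admEpi_opConfl_iff {X Y : Aᵒᵖ} (f : X ⟶ Y) :
    admEpi (opConfl E) f ↔ admMono E f.unop := by
  constructor
  · rintro ⟨Z, g, h, -, hS⟩
    exact ⟨Z.unop, g.unop, by rw [← unop_comp, h, unop_zero], trivial, hS⟩
  · rintro ⟨Z, g, h, -, hS⟩
    exact ⟨.op Z, g.op, Quiver.Hom.unop_inj h, trivial, hS⟩

/-- The opposite of an exact category is exact. -/
lemma IsExactStructure.op (hE : IsExactStructure E) : IsExactStructure (opConfl E) where
  hasZeroObject := by
    have := hE.hasZeroObject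
    infer_instance
  hasBinaryBiproducts := by
    have := hE.hasBinaryBiproducts
    have : HasBinaryProducts Aᵒᵖ := inferInstance
    exact HasBinaryBiproducts.of_hasBinaryProducts
  of_iso := fun {S T} e hS => hE.of_iso (ShortComplex.opEquiv A |>.inverse.mapIso e).unop.symm hS
  isKernelCokernelPair := fun {S} hS => by
    have h := (isKernelCokernelPair_iff _).1 (hE.isKernelCokernelPair hS)
    obtain ⟨⟨h₁, h₂⟩, ⟨h₃, h₄⟩⟩ := h
    rw [isKernelCokernelPair_iff]
    refine ⟨⟨⟨fun a b hab => ?_⟩, fun T k hk => ?_⟩, ⟨⟨fun a b hab => ?_⟩, fun T k hk => ?_⟩⟩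
    · apply Quiver.Hom.unop_inj
      have := congrArg Quiver.Hom.unop hab
      exact h₃.1 _ _ this
    · obtain ⟨l, hl⟩ := h₄ _ k.unop (congrArg Quiver.Hom.unop hk)
      exact ⟨l.op, Quiver.Hom.unop_inj hl⟩
    · apply Quiver.Hom.unop_inj
      have := congrArg Quiver.Hom.unop hab
      exact h₁.1 _ _ this
    · obtain ⟨l, hl⟩ := h₂ _ k.unop (congrArg Quiver.Hom.unop hk)
      exact ⟨l.op, Quiver.Hom.unop_inj hl⟩
  id_admMono := fun X => (admMono_opConfl_iff _).2 (hE.id_admEpi X.unop)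
  id_admEpi := fun X => (admEpi_opConfl_iff _).2 (hE.id_admMono X.unop)
  comp_admMono := fun f g hf hg => by
    rw [admMono_opConfl_iff] at *
    exact hE.comp_admEpi _ _ hg hf
  comp_admEpi := fun f g hf hg => by
    rw [admEpi_opConfl_iff] at *
    exact hE.comp_admMono _ _ hg hf
  pushout_admMono := fun i f hi => by
    obtain ⟨Y', f', p', sq, h⟩ := hE.pullback_admEpi i.unop f.unop ((admMono_opConfl_iff _).1 hi)
    exact ⟨.op Y', f'.op, p'.op, sq.op.flip, (admMono_opConfl_iff _).2 h⟩
  pullback_admEpi := fun i f hi => by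
    obtain ⟨Y', f', p', sq, h⟩ := hE.pushout_admMono i.unop f.unop ((admEpi_opConfl_iff _).1 hi)
    exact ⟨.op Y', f'.op, p'.op, sq.op.flip, (admEpi_opConfl_iff _).2 h⟩

end Opposite

/-! ### Sections of presheaves and of representables -/

section Presheaves

open Opposite

variable {A : Type u} [Category.{v} A]

/-- Restriction of sections of a presheaf. -/
def res (F : Aᵒᵖ ⥤ AddCommGrpCat.{v}) {X Y : A} (f : X ⟶ Y) (y : F.obj (op Y)) : F.obj (op X) :=
  F.map f.op y

/-- The action of a morphism of presheaves on sections. -/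
def ap {F G : Aᵒᵖ ⥤ AddCommGrpCat.{v}} (φ : F ⟶ G) {X : A} (x : F.obj (op X)) : G.obj (op X) :=
  φ.app (op X) x

section

variable (F : Aᵒᵖ ⥤ AddCommGrpCat.{v}) {X Y Z : A}

@[simp] lemma res_id (x : F.obj (op X)) : res F (𝟙 X) x = x := by simp [res]

lemma res_comp (f : X ⟶ Y) (g : Y ⟶ Z) (z : F.obj (op Z)) :
    res F (f ≫ g) z = res F f (res F g z) := by simp [res]

@[simp] lemma res_add (f : X ⟶ Y) (y y' : F.obj (op Y)) :
    res F f (y + y') = res F f y + res F f y' := map_add _ _ _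

@[simp] lemma res_sub (f : X ⟶ Y) (y y' : F.obj (op Y)) :
    res F f (y - y') = res F f y - res F f y' := map_sub _ _ _

@[simp] lemma res_neg (f : X ⟶ Y) (y : F.obj (op Y)) :
    res F f (-y) = -res F f y := map_neg _ _

@[simp] lemma res_zero (f : X ⟶ Y) : res F f 0 = 0 := map_zero _

end

section

variable {F G H : Aᵒᵖ ⥤ AddCommGrpCat.{v}} {X Y Z : A}

@[simp] lemma ap_id (x : F.obj (op X)) : ap (𝟙 F) x = x := rfl

@[simp] lemma ap_comp (φ : F ⟶ G) (ψ : G ⟶ H) (x : F.obj (op X)) :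
    ap (φ ≫ ψ) x = ap ψ (ap φ x) := by simp [ap]

@[simp] lemma ap_add (φ : F ⟶ G) (x x' : F.obj (op X)) : ap φ (x + x') = ap φ x + ap φ x' :=
  map_add _ _ _

@[simp] lemma ap_sub (φ : F ⟶ G) (x x' : F.obj (op X)) : ap φ (x - x') = ap φ x - ap φ x' :=
  map_sub _ _ _

@[simp] lemma ap_neg (φ : F ⟶ G) (x : F.obj (op X)) : ap φ (-x) = -ap φ x := map_neg _ _

@[simp] lemma ap_zero (φ : F ⟶ G) : ap φ (0 : F.obj (op X)) = 0 := map_zero _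

lemma ap_res (φ : F ⟶ G) (f : X ⟶ Y) (y : F.obj (op Y)) :
    ap φ (res F f y) = res G f (ap φ y) := by
  have := ConcreteCategory.congr_hom (φ.naturality f.op) y
  exact this

lemma psh_hom_ext {φ ψ : F ⟶ G} (h : ∀ (X : A) (x : F.obj (op X)), ap φ x = ap ψ x) : φ = ψ := by
  ext X x
  exact h X.unop x

@[simp] lemma ap_add_hom (φ ψ : F ⟶ G) (x : F.obj (op X)) : ap (φ + ψ) x = ap φ x + ap ψ x := rfl

@[simp] lemma ap_zero_hom (x : F.obj (op X)) : ap (0 : F ⟶ G) x = 0 := rfl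

end

/-- Build a morphism of presheaves from additive maps compatible with restriction. -/
def mkHom {F G : Aᵒᵖ ⥤ AddCommGrpCat.{v}} (φ : ∀ X : A, F.obj (op X) → G.obj (op X))
    (hadd : ∀ X x y, φ X (x + y) = φ X x + φ X y)
    (hres : ∀ {X Y : A} (f : X ⟶ Y) y, φ X (res F f y) = res G f (φ Y y)) : F ⟶ G where
  app X := AddCommGrpCat.ofHom (AddMonoidHom.mk' (φ X.unop) (hadd X.unop))
  naturality X Y f := by
    ext x
    exact hres f.unop x

@[simp] lemma ap_mkHom {F G : Aᵒᵖ ⥤ AddCommGrpCat.{v}}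
    (φ : ∀ X : A, F.obj (op X) → G.obj (op X)) (hadd) (hres) {X : A} (x : F.obj (op X)) :
    ap (mkHom φ hadd hres) x = φ X x := rfl

variable [Preadditive A]

@[simp] lemma add_res (F : Aᵒᵖ ⥤ AddCommGrpCat.{v}) [F.Additive] {X Y : A} (f g : X ⟶ Y)
    (y : F.obj (op Y)) : res F (f + g) y = res F f y + res F g y := by
  simp [res, Functor.map_add]

@[simp] lemma neg_res (F : Aᵒᵖ ⥤ AddCommGrpCat.{v}) [F.Additive] {X Y : A} (f : X ⟶ Y)
    (y : F.obj (op Y)) : res F (-f) y = -res F f y := by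
  simp [res, Functor.map_neg]

@[simp] lemma sub_res (F : Aᵒᵖ ⥤ AddCommGrpCat.{v}) [F.Additive] {X Y : A} (f g : X ⟶ Y)
    (y : F.obj (op Y)) : res F (f - g) y = res F f y - res F g y := by
  simp [res, Functor.map_sub]

@[simp] lemma zero_res (F : Aᵒᵖ ⥤ AddCommGrpCat.{v}) [F.Additive] {X Y : A}
    (y : F.obj (op Y)) : res F (0 : X ⟶ Y) y = 0 := by
  simp [res, Functor.map_zero]

/-- A morphism, seen as a section of a representable presheaf. -/
def sec {X Y : A} (f : X ⟶ Y) : (preadditiveYoneda.obj Y).obj (op X) := f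

/-- A section of a representable presheaf, seen as a morphism. -/
def unsec {X Y : A} (f : (preadditiveYoneda.obj Y).obj (op X)) : X ⟶ Y := f

@[simp] lemma sec_unsec {X Y : A} (f : (preadditiveYoneda.obj Y).obj (op X)) :
    sec (unsec f) = f := rfl

@[simp] lemma res_sec {X Y Z : A} (f : X ⟶ Y) (g : Y ⟶ Z) : res _ f (sec g) = sec (f ≫ g) := rfl

@[simp] lemma ap_yoneda_sec {X Y Z : A} (f : X ⟶ Y) (g : Y ⟶ Z) :
    ap (preadditiveYoneda.map g) (sec f) = sec (f ≫ g) := rfl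

lemma sec_add {X Y : A} (f g : X ⟶ Y) : sec (f + g) = sec f + sec g := rfl

@[simp] lemma sec_zero {X Y : A} : sec (0 : X ⟶ Y) = 0 := rfl

/-- The morphism from a representable presheaf defined by a section. -/
def elt (F : Aᵒᵖ ⥤ AddCommGrpCat.{v}) [F.Additive] {X : A} (x : F.obj (op X)) :
    preadditiveYoneda.obj X ⟶ F :=
  mkHom (fun _ f => res F (unsec f) x) (fun _ f g => add_res F (unsec f) (unsec g) x)
    (fun f y => res_comp F f (unsec y) x)

@[simp] lemma ap_elt_sec (F : Aᵒᵖ ⥤ AddCommGrpCat.{v}) [F.Additive] {X Y : A} (x : F.obj (op X))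
    (f : Y ⟶ X) : ap (elt F x) (sec f) = res F f x := rfl

lemma yoneda_hom_ext {F : Aᵒᵖ ⥤ AddCommGrpCat.{v}} {X : A} {φ ψ : preadditiveYoneda.obj X ⟶ F}
    (h : ap φ (sec (𝟙 X)) = ap ψ (sec (𝟙 X))) : φ = ψ := by
  refine psh_hom_ext (fun Y f => ?_)
  have e : f = res _ (unsec f) (sec (𝟙 X)) := by rw [res_sec, Category.comp_id, sec_unsec]
  rw [e, ap_res, ap_res, h]

end Presheaves

/-! ### Short exact sequences of left exact presheaves as locally exact sequences -/

section LeftExact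

open Opposite

variable {A : Type u} [Category.{v} A] [Preadditive A] {E : ObjectProperty (ShortComplex A)}

lemma Lex.additive (F : Lex E) : F.obj.Additive := F.property.1

attribute [instance] Lex.additive

lemma Lex.eq_of_res (F : Lex E) {X Y Z : A} {f : X ⟶ Y} {g : Y ⟶ Z} {h : f ≫ g = 0}
    (hS : E (.mk f g h)) {z z' : F.obj.obj (op Z)} (hz : res F.obj g z = res F.obj g z') : z = z' :=
  (F.property.2 _ hS).1 hz

lemma Lex.exists_res (F : Lex E) {X Y Z : A} {f : X ⟶ Y} {g : Y ⟶ Z} {h : f ≫ g = 0}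
    (hS : E (.mk f g h)) (y : F.obj.obj (op Y)) (hy : res F.obj f y = 0) :
    ∃ z, res F.obj g z = y :=
  ((F.property.2 _ hS).2 y).1 hy

lemma Lex.eq_of_res_admEpi (F : Lex E) {Y Z : A} {g : Y ⟶ Z}
    (hg : admEpi E g) {z z' : F.obj.obj (op Z)} (hz : res F.obj g z = res F.obj g z') : z = z' := by
  obtain ⟨_, _, _, _, hS⟩ := hg
  exact F.eq_of_res hS hz

/-- Sections over a pushout along an admissible monomorphism. -/
lemma Lex.exists_res_pushout (hE : IsExactStructure E) (F : Lex E) {X Y X' Y' : A}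
    {i : X ⟶ Y} (hi : admMono E i) {f : X ⟶ X'} {f' : Y ⟶ Y'} {i' : X' ⟶ Y'}
    (sq : IsPushout i f f' i') (y : F.obj.obj (op Y)) (x : F.obj.obj (op X'))
    (hxy : res F.obj i y = res F.obj f x) :
    ∃ y' : F.obj.obj (op Y'), res F.obj f' y' = y ∧ res F.obj i' y' = x := by
  have := hE.hasBinaryBiproducts
  -- A pair of sections that agree on `X` is a section over `Y ⊞ X'` that vanishes along `(i, -f)`;
  -- by left exactness it descends to `Y'`.
  obtain ⟨z, hz⟩ := F.exists_res (hE.confl_of_isPushout hi sq)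
    (res F.obj biprod.fst y + res F.obj biprod.snd x) (by
      rw [res_add, ← res_comp, ← res_comp]; simp [hxy])
  refine ⟨z, ?_, ?_⟩
  · have := congrArg (res F.obj biprod.inl) hz
    simpa [← res_comp] using this
  · have := congrArg (res F.obj biprod.inr) hz
    simpa [← res_comp] using this

lemma Lex.eq_of_res_pushout (hE : IsExactStructure E) (F : Lex E) {X Y X' Y' : A}
    {i : X ⟶ Y} (hi : admMono E i) {f : X ⟶ X'} {f' : Y ⟶ Y'} {i' : X' ⟶ Y'}
    (sq : IsPushout i f f' i') {y y' : F.obj.obj (op Y')} (h₁ : res F.obj f' y = res F.obj f' y')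
    (h₂ : res F.obj i' y = res F.obj i' y') : y = y' := by
  have := hE.hasBinaryBiproducts
  refine F.eq_of_res (hE.confl_of_isPushout hi sq) ?_
  rw [biprod.desc_eq, add_res, add_res, res_comp, res_comp, res_comp, res_comp, h₁, h₂]

/-- Exactness of a sequence of presheaves: left exact pointwise, and locally surjective. -/
structure IsLocExact (E : ObjectProperty (ShortComplex A)) {F G H : Aᵒᵖ ⥤ AddCommGrpCat.{v}}
    (f : F ⟶ G) (g : G ⟶ H) : Prop where
  inj : ∀ {X : A} (x : F.obj (op X)), ap f x = 0 → x = 0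
  zero : ∀ {X : A} (x : F.obj (op X)), ap g (ap f x) = 0
  mid : ∀ {X : A} (y : G.obj (op X)), ap g y = 0 → ∃ x, ap f x = y
  surj : ∀ {X : A} (z : H.obj (op X)), ∃ (X' : A) (p : X' ⟶ X) (y : G.obj (op X')),
    admEpi E p ∧ ap g y = res H p z

lemma IsLocExact.eq_of_ap_eq {F G H : Aᵒᵖ ⥤ AddCommGrpCat.{v}}
    {f : F ⟶ G} {g : G ⟶ H} (h : IsLocExact E f g) {X : A} {x x' : F.obj (op X)}
    (hx : ap f x = ap f x') : x = x' := by
  rw [← sub_eq_zero]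
  exact h.inj _ (by rw [ap_sub, hx, sub_self])

/-- The subgroup of the sections that lift locally along `φ`. -/
def locImage (hE : IsExactStructure E) {G H : Aᵒᵖ ⥤ AddCommGrpCat.{v}} (φ : G ⟶ H) (X : A) :
    AddSubgroup (H.obj (op X)) where
  carrier := {z | ∃ (X' : A) (p : X' ⟶ X) (y : G.obj (op X')), admEpi E p ∧ ap φ y = res H p z}
  zero_mem' := ⟨X, 𝟙 X, 0, hE.id_admEpi X, by simp⟩
  neg_mem' := by
    rintro z ⟨X', p, y, hp, hy⟩
    exact ⟨X', p, -y, hp, by simp [hy]⟩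
  add_mem' := by
    rintro z z' ⟨X', p, y, hp, hy⟩ ⟨X₁, p₁, y₁, hp₁, hy₁⟩
    -- The two local lifts are added on the fibre product of their covers.
    obtain ⟨X₂, a, b, sq, hb⟩ := hE.pullback_admEpi p p₁ hp
    refine ⟨X₂, b ≫ p₁, res G a y + res G b y₁, hE.comp_admEpi _ _ hb hp₁, ?_⟩
    rw [ap_add, ap_res, ap_res, hy, hy₁, res_add, ← res_comp, ← res_comp, sq.w]

lemma res_mem_locImage (hE : IsExactStructure E) {G H : Aᵒᵖ ⥤ AddCommGrpCat.{v}} (φ : G ⟶ H)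
    {X Y : A} (f : X ⟶ Y) (z : H.obj (op Y)) (hz : z ∈ locImage hE φ Y) :
    res H f z ∈ locImage hE φ X := by
  obtain ⟨X', p, y, hp, hy⟩ := hz
  obtain ⟨X₂, a, b, sq, hb⟩ := hE.pullback_admEpi p f hp
  exact ⟨X₂, b, res G a y, hb, by rw [ap_res, hy, ← res_comp, ← res_comp, sq.w]⟩

/-- The presheaf of the sections that lift locally along `φ`. -/
def locImagePsh (hE : IsExactStructure E) {G H : Aᵒᵖ ⥤ AddCommGrpCat.{v}} (φ : G ⟶ H) :
    Aᵒᵖ ⥤ AddCommGrpCat.{v} where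
  obj X := AddCommGrpCat.of (locImage hE φ X.unop)
  map {X Y} f := AddCommGrpCat.ofHom
    (((H.map f).hom.comp (locImage hE φ X.unop).subtype).codRestrict (locImage hE φ Y.unop)
      (fun z => res_mem_locImage hE φ f.unop z.1 z.2))
  map_id X := by ext x; exact res_id H x.1
  map_comp f g := by ext x; exact res_comp H g.unop f.unop x.1

/-- Local liftability descends along an admissible epimorphism, because the composite of two covers
is a cover; everything else is inherited from `H`. -/
lemma locImagePsh_isLeftExact (hE : IsExactStructure E) {G : Aᵒᵖ ⥤ AddCommGrpCat.{v}} (H : Lex E)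
    (φ : G ⟶ H.obj) : isLeftExact E (locImagePsh hE φ) := by
  refine ⟨⟨fun {X Y f g} => ?_⟩, fun S hS => ⟨fun a b hab => ?_, fun y => ⟨fun hy => ?_, ?_⟩⟩⟩
  · ext x
    exact Subtype.ext (add_res H.obj f.unop g.unop x.1)
  · exact Subtype.ext (H.eq_of_res hS (congrArg Subtype.val hab))
  · obtain ⟨z, hz⟩ := H.exists_res hS y.1 (congrArg Subtype.val hy)
    obtain ⟨X', p, y', hp, hy'⟩ := y.2
    have hm : z ∈ locImage hE φ S.X₃ := ⟨X', p ≫ S.g, y', hE.comp_admEpi _ _ hp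
      ⟨_, _, _, trivial, hS⟩, by rw [hy', res_comp, hz]⟩
    exact ⟨⟨z, hm⟩, Subtype.ext hz⟩
  · rintro ⟨z, rfl⟩
    refine Subtype.ext ?_
    change res H.obj S.f (res H.obj S.g z.1) = 0
    rw [← res_comp, S.zero, zero_res]

/-- The representable left exact presheaf. -/
def lexYoneda (hE : IsExactStructure E) : A ⥤ Lex E :=
  ObjectProperty.lift _ preadditiveYoneda
    (yoneda_isLeftExact (fun _ hS => (hE.isKernelCokernelPair hS).2))

@[simp] lemma Lex.ap_comp {F G H : Lex E} (f : F ⟶ G) (g : G ⟶ H) {X : A} (x : F.obj.obj (op X)) :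
    ap (f ≫ g).hom x = ap g.hom (ap f.hom x) := rfl

@[simp] lemma Lex.ap_id (F : Lex E) {X : A} (x : F.obj.obj (op X)) :
    ap (InducedCategory.Hom.hom (𝟙 F)) x = x := rfl

@[simp] lemma Lex.ap_zero_hom (F G : Lex E) {X : A} (x : F.obj.obj (op X)) :
    ap (InducedCategory.Hom.hom (0 : F ⟶ G)) x = 0 := rfl

@[simp] lemma Lex.ap_add_hom {F G : Lex E} (f g : F ⟶ G) {X : A} (x : F.obj.obj (op X)) :
    ap (f + g).hom x = ap f.hom x + ap g.hom x := rfl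

lemma Lex.congr_ap {F G : Lex E} {f g : F ⟶ G} (h : f = g) {X : A} (x : F.obj.obj (op X)) :
    ap f.hom x = ap g.hom x := by rw [h]

lemma Lex.hom_ext {F G : Lex E} {f g : F ⟶ G}
    (h : ∀ {X : A} (x : F.obj.obj (op X)), ap f.hom x = ap g.hom x) : f = g :=
  ObjectProperty.hom_ext _ (psh_hom_ext (fun _ x => h x))

/-- A morphism, seen as a section of a representable left exact presheaf. -/
def lsec (hE : IsExactStructure E) {X Y : A} (f : X ⟶ Y) :
    ((lexYoneda hE).obj Y).obj.obj (op X) := f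

/-- A section of a representable left exact presheaf, seen as a morphism. -/
def lunsec (hE : IsExactStructure E) {X Y : A} (f : ((lexYoneda hE).obj Y).obj.obj (op X)) :
    X ⟶ Y := f

@[simp] lemma lsec_lunsec (hE : IsExactStructure E) {X Y : A}
    (f : ((lexYoneda hE).obj Y).obj.obj (op X)) : lsec hE (lunsec hE f) = f := rfl

lemma lsec_injective (hE : IsExactStructure E) {X Y : A} {f g : X ⟶ Y}
    (h : lsec hE f = lsec hE g) : f = g := h

@[simp] lemma res_lsec (hE : IsExactStructure E) {X Y Z : A} (f : X ⟶ Y) (g : Y ⟶ Z) :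
    res _ f (lsec hE g) = lsec hE (f ≫ g) := rfl

@[simp] lemma ap_yoneda_lsec (hE : IsExactStructure E) {X Y Z : A} (f : X ⟶ Y)
    (g : Y ⟶ Z) : ap ((lexYoneda hE).map g).hom (lsec hE f) = lsec hE (f ≫ g) := rfl

/-- A section of a left exact presheaf as a morphism from a representable presheaf. -/
def Lex.elt (hE : IsExactStructure E) (F : Lex E) {X : A} (x : F.obj.obj (op X)) :
    (lexYoneda hE).obj X ⟶ F :=
  ObjectProperty.homMk (RelTate.elt F.obj x)

@[simp] lemma Lex.ap_elt_lsec (hE : IsExactStructure E) (F : Lex E) {X Y : A}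
    (x : F.obj.obj (op X)) (f : Y ⟶ X) : ap (F.elt hE x).hom (lsec hE f) = res F.obj f x := rfl

lemma Lex.yoneda_hom_ext (hE : IsExactStructure E) {F : Lex E} {X : A}
    {φ ψ : (lexYoneda hE).obj X ⟶ F}
    (h : ap φ.hom (lsec hE (𝟙 X)) = ap ψ.hom (lsec hE (𝟙 X))) : φ = ψ :=
  ObjectProperty.hom_ext _ (RelTate.yoneda_hom_ext h)

lemma Lex.elt_comp (hE : IsExactStructure E) {F G : Lex E} {X : A} (x : F.obj.obj (op X))
    (φ : F ⟶ G) : F.elt hE x ≫ φ = G.elt hE (ap φ.hom x) := by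
  refine Lex.yoneda_hom_ext hE ?_
  rw [Lex.ap_comp, Lex.ap_elt_lsec, Lex.ap_elt_lsec, res_id, res_id]

lemma Lex.elt_lsec_id (hE : IsExactStructure E) {F : Lex E} {X : A}
    (φ : (lexYoneda hE).obj X ⟶ F) : F.elt hE (ap φ.hom (lsec hE (𝟙 X))) = φ := by
  refine Lex.yoneda_hom_ext hE ?_
  rw [Lex.ap_elt_lsec, res_id]

lemma Lex.elt_zero (hE : IsExactStructure E) (F : Lex E) {X : A} :
    F.elt hE (0 : F.obj.obj (op X)) = 0 := by
  refine Lex.yoneda_hom_ext hE ?_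
  rw [Lex.ap_elt_lsec, res_zero]
  rfl

lemma Lex.elt_injective (hE : IsExactStructure E) {F : Lex E} {X : A} {x y : F.obj.obj (op X)}
    (h : F.elt hE x = F.elt hE y) : x = y := by
  have := Lex.congr_ap h (lsec hE (𝟙 X))
  rwa [Lex.ap_elt_lsec, Lex.ap_elt_lsec, res_id, res_id] at this

lemma Lex.yoneda_map_elt (hE : IsExactStructure E) {F : Lex E} {X Y : A} (f : X ⟶ Y)
    (y : F.obj.obj (op Y)) : (lexYoneda hE).map f ≫ F.elt hE y = F.elt hE (res F.obj f y) := by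
  refine Lex.yoneda_hom_ext hE ?_
  rw [Lex.ap_comp, ap_yoneda_lsec, Lex.ap_elt_lsec, Lex.ap_elt_lsec, res_id, Category.id_comp]

/-- Left exactness on sections is the kernel property tested on representables. For local
surjectivity, `S.g` factors through the left exact presheaf `I` of locally liftable sections, so the
cokernel property splits the inclusion of `I` into `S.X₃`, and `I` is everything. -/
lemma isLocExact_of_isKernelCokernelPair (hE : IsExactStructure E) {S : ShortComplex (Lex E)}
    (hS : IsKernelCokernelPair S) : IsLocExact E S.f.hom S.g.hom := by
  obtain ⟨⟨h₁, h₂⟩, ⟨h₃, h₄⟩⟩ := (isKernelCokernelPair_iff S).1 hS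
  refine ⟨fun {X} x hx => ?_, fun {X} x => ?_, fun {X} y hy => ?_, fun {X} z => ?_⟩
  · apply Lex.elt_injective hE
    rw [Lex.elt_zero, ← cancel_mono S.f, zero_comp, Lex.elt_comp, hx, Lex.elt_zero]
  · exact Lex.congr_ap S.zero x
  · obtain ⟨l, hl⟩ := h₂ _ (S.X₂.elt hE y) (by rw [Lex.elt_comp, hy, Lex.elt_zero])
    refine ⟨ap l.hom (lsec hE (𝟙 X)), Lex.elt_injective hE ?_⟩
    rw [← Lex.elt_comp, Lex.elt_lsec_id, hl]
  · let I : Lex E := ⟨locImagePsh hE S.g.hom, locImagePsh_isLeftExact hE S.X₃ S.g.hom⟩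
    let ι : I ⟶ S.X₃ := ObjectProperty.homMk
      { app := fun X => AddCommGrpCat.ofHom (locImage hE S.g.hom X.unop).subtype }
    let π : S.X₂ ⟶ I := ObjectProperty.homMk
      (mkHom (fun X y => ⟨ap S.g.hom y, X, 𝟙 X, y, hE.id_admEpi X, by simp⟩)
        (fun X x y => Subtype.ext (ap_add _ _ _)) (fun f y => Subtype.ext (ap_res _ _ _)))
    have hπι : π ≫ ι = S.g := rfl
    obtain ⟨l, hl⟩ := h₄ I π (by
      exact Lex.hom_ext (fun y => Subtype.ext (Lex.congr_ap S.zero y)))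
    have hlι : l ≫ ι = 𝟙 _ := by rw [← cancel_epi S.g, reassoc_of% hl, hπι, Category.comp_id]
    have e : (ap l.hom z).1 = z :=
      Lex.congr_ap hlι z
    have := (ap l.hom z).2
    rw [e] at this
    exact this

/-- The cokernel property is descent: a section of `S.X₃` lifts over a cover, two lifts differ by a
section of `S.X₁`, which `k` kills, and so the image of a lift under `k` descends to a section of
`T`. -/
lemma isKernelCokernelPair_of_isLocExact (hE : IsExactStructure E) {S : ShortComplex (Lex E)}
    (hS : IsLocExact E S.f.hom S.g.hom) : IsKernelCokernelPair S := by
  rw [isKernelCokernelPair_iff]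
  refine ⟨⟨⟨fun a b hab => ?_⟩, fun T k hk => ?_⟩, ⟨⟨fun a b hab => ?_⟩, fun T k hk => ?_⟩⟩
  · apply ObjectProperty.hom_ext
    refine psh_hom_ext (fun X x => hS.eq_of_ap_eq ?_)
    have := Lex.congr_ap hab x
    simpa using this
  · have key : ∀ (X : A) (x : T.obj.obj (op X)), ∃ y, ap S.f.hom y = ap k.hom x := fun X x =>
      hS.mid _ (by
        have := Lex.congr_ap hk x
        simpa using this)
    choose l hl using key
    refine ⟨ObjectProperty.homMk (mkHom l (fun X x y => hS.eq_of_ap_eq (by simp [hl]))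
      (fun f y => hS.eq_of_ap_eq (by simp [hl, ap_res]))), ?_⟩
    apply ObjectProperty.hom_ext
    exact psh_hom_ext (fun X x => hl X x)
  · apply ObjectProperty.hom_ext
    refine psh_hom_ext (fun X z => ?_)
    obtain ⟨X', p, y, hp, hy⟩ := hS.surj z
    refine Lex.eq_of_res_admEpi _ hp ?_
    have := Lex.congr_ap hab y
    simpa [ap_res, hy] using this
  · have hk0 : ∀ {X : A} (y y' : S.X₂.obj.obj (op X)), ap S.g.hom y = ap S.g.hom y' →
        ap k.hom y = ap k.hom y' := by
      intro X y y' h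
      obtain ⟨x, hx⟩ := hS.mid (y - y') (by rw [ap_sub, h, sub_self])
      have := Lex.congr_ap hk x
      have h2 : ap k.hom (y - y') = 0 := by rw [← hx]; simpa using this
      rwa [ap_sub, sub_eq_zero] at h2
    -- The value `t` is required to be compatible with all lifts over all `X'`, not only with a
    -- chosen one. This determines it, so that additivity and naturality follow from uniqueness.
    have key : ∀ (X : A) (z : S.X₃.obj.obj (op X)), ∃ t : T.obj.obj (op X),
        ∀ (X' : A) (p : X' ⟶ X) (y : S.X₂.obj.obj (op X')), ap S.g.hom y = res _ p z →
          ap k.hom y = res _ p t := by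
      intro X z
      obtain ⟨X', p, y, ⟨K, i, hi, -, hp⟩, hy⟩ := hS.surj z
      obtain ⟨t, ht⟩ := T.exists_res hp (ap k.hom y) (by
        rw [← ap_res, hk0 _ 0 (by rw [ap_res, hy, ← res_comp, hi, zero_res, ap_zero]), ap_zero])
      refine ⟨t, fun X₁ p₁ y₁ h₁ => ?_⟩
      obtain ⟨X₂, a, b, sq, hb⟩ := hE.pullback_admEpi p p₁ ⟨_, _, _, trivial, hp⟩
      refine Lex.eq_of_res_admEpi _ hb ?_
      rw [← ap_res, ← res_comp, ← sq.w, res_comp, ht, ← ap_res]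
      exact hk0 _ _ (by rw [ap_res, ap_res, h₁, hy, ← res_comp, ← res_comp, sq.w])
    choose l hl using key
    have huniq : ∀ {X : A} (z : S.X₃.obj.obj (op X)) (t : T.obj.obj (op X)),
        (∀ (X' : A) (p : X' ⟶ X) (y : S.X₂.obj.obj (op X')), ap S.g.hom y = res _ p z →
          ap k.hom y = res _ p t) → l X z = t := by
      intro X z t ht
      obtain ⟨X', p, y, hp, hy⟩ := hS.surj z
      refine Lex.eq_of_res_admEpi _ hp ?_
      rw [← hl X z X' p y hy, ← ht X' p y hy]
    refine ⟨ObjectProperty.homMk (mkHom l (fun X z z' => ?_) (fun {X Y} f z => ?_)), ?_⟩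
    · obtain ⟨X', p, y, hp, hy⟩ := hS.surj z
      obtain ⟨X₁, p₁, y₁, hp₁, hy₁⟩ := hS.surj z'
      obtain ⟨X₂, a, b, sq, hb⟩ := hE.pullback_admEpi p p₁ hp
      refine Lex.eq_of_res_admEpi _ (hE.comp_admEpi _ _ hb hp₁) ?_
      have e₁ := hl X z X₂ (b ≫ p₁) (res _ a y) (by rw [ap_res, hy, ← res_comp, sq.w])
      have e₂ := hl X z' X₂ (b ≫ p₁) (res _ b y₁) (by rw [ap_res, hy₁, ← res_comp])
      rw [← hl X (z + z') X₂ (b ≫ p₁) (res _ a y + res _ b y₁)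
        (by rw [ap_add, ap_res, ap_res, hy, hy₁, ← res_comp, ← res_comp, sq.w, res_add]), ap_add,
        e₁, e₂, res_add]
    · refine huniq _ _ (fun X' p y hy => ?_)
      rw [← res_comp]
      exact hl Y z X' (p ≫ f) y (by rw [hy, res_comp])
    · apply ObjectProperty.hom_ext
      refine psh_hom_ext (fun X y => ?_)
      have := hl X (ap S.g.hom y) X (𝟙 X) y (by simp)
      simpa using this.symm

lemma isKernelCokernelPair_lex_iff (hE : IsExactStructure E) {S : ShortComplex (Lex E)} :
    IsKernelCokernelPair S ↔ IsLocExact E S.f.hom S.g.hom :=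
  ⟨isLocExact_of_isKernelCokernelPair hE, isKernelCokernelPair_of_isLocExact hE⟩

end LeftExact

end RelTate

namespace RelTate

/-! ### Presentations of Ind objects by sections -/

section Presentations

open Opposite

variable {A : Type u} [Category.{v} A] [Preadditive A] {E : ObjectProperty (ShortComplex A)}

/-- The sections `x j` exhibit `F` as the directed union of the representable presheaves of the
`X j`, with admissible monomorphisms with cokernels in `Q` as transition maps. -/
structure IsPres (E : ObjectProperty (ShortComplex A)) (Q : ObjectProperty A) (F : Lex E)
    {J : Type w} [Preorder J] (X : J → A) (x : ∀ j, F.obj.obj (op (X j))) : Prop where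
  inj : ∀ {j : J} {Y : A} (f : Y ⟶ X j), res F.obj f (x j) = 0 → f = 0
  surj : ∀ {Y : A} (y : F.obj.obj (op Y)), ∃ (j : J) (f : Y ⟶ X j), res F.obj f (x j) = y
  le : ∀ {i j : J}, i ≤ j → ∃ g : X i ⟶ X j, monoCokerIn E Q g ∧ res F.obj g (x j) = x i

namespace IsPres

variable {Q : ObjectProperty A} {F : Lex E} {J : Type w} [Preorder J] {X : J → A}
  {x : ∀ j, F.obj.obj (op (X j))}

lemma eq_of_res (h : IsPres E Q F X x) {j : J} {Y : A} {f g : Y ⟶ X j}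
    (hfg : res F.obj f (x j) = res F.obj g (x j)) : f = g := by
  rw [← sub_eq_zero]
  exact h.inj _ (by rw [sub_res, hfg, sub_self])

lemma surj_le [IsDirected J (· ≤ ·)] (h : IsPres E Q F X x) (i : J) {Y : A}
    (y : F.obj.obj (op Y)) : ∃ j, i ≤ j ∧ ∃ f : Y ⟶ X j, res F.obj f (x j) = y := by
  obtain ⟨j, f, rfl⟩ := h.surj y
  obtain ⟨k, hi, hj⟩ := exists_ge_ge i j
  obtain ⟨g, -, e⟩ := h.le hj
  exact ⟨k, hi, f ≫ g, by rw [res_comp, e]⟩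

/-- Two expressions of one section become the same morphism at a common larger index, since there
the section determines the morphism. This makes the descent in `exists_desc` well defined. -/
lemma ap_eq_ap [IsDirected J (· ≤ ·)] (h : IsPres E Q F X x) {G : Aᵒᵖ ⥤ AddCommGrpCat.{v}}
    (ψ : ∀ j, preadditiveYoneda.obj (X j) ⟶ G)
    (hψ : ∀ {i j : J} (g : X i ⟶ X j), i ≤ j → res F.obj g (x j) = x i →
      preadditiveYoneda.map g ≫ ψ j = ψ i) {i j : J} {Y : A} (f : Y ⟶ X i) (g : Y ⟶ X j)
    (hfg : res F.obj f (x i) = res F.obj g (x j)) : ap (ψ i) (sec f) = ap (ψ j) (sec g) := by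
  obtain ⟨k, hi, hj⟩ := exists_ge_ge i j
  obtain ⟨a, -, ha⟩ := h.le hi
  obtain ⟨b, -, hb⟩ := h.le hj
  have e : f ≫ a = g ≫ b := h.eq_of_res (by rw [res_comp, res_comp, ha, hb, hfg])
  rw [← hψ a hi ha, ← hψ b hj hb, ap_comp, ap_comp, ap_yoneda_sec, ap_yoneda_sec, e]

lemma exists_desc [IsDirected J (· ≤ ·)] [Nonempty J] (h : IsPres E Q F X x)
    {G : Aᵒᵖ ⥤ AddCommGrpCat.{v}}
    (ψ : ∀ j, preadditiveYoneda.obj (X j) ⟶ G)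
    (hψ : ∀ {i j : J} (g : X i ⟶ X j), i ≤ j → res F.obj g (x j) = x i →
      preadditiveYoneda.map g ≫ ψ j = ψ i) :
    ∃ φ : F.obj ⟶ G, ∀ {j : J} {Y : A} (f : Y ⟶ X j),
      ap φ (res F.obj f (x j)) = ap (ψ j) (sec f) := by
  have key : ∀ (Y : A) (y : F.obj.obj (op Y)), ∃ t : G.obj (op Y), ∀ (j : J) (f : Y ⟶ X j),
      res F.obj f (x j) = y → t = ap (ψ j) (sec f) := by
    intro Y y
    obtain ⟨j, f, hf⟩ := h.surj y
    exact ⟨ap (ψ j) (sec f), fun i g hg => h.ap_eq_ap ψ hψ f g (hf.trans hg.symm)⟩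
  choose t ht using key
  refine ⟨mkHom t (fun Y y y' => ?_) (fun {Y Y'} f y => ?_), fun f => ht _ _ _ _ rfl⟩
  · obtain ⟨i, -⟩ := h.surj y
    obtain ⟨j, hij, f, hf⟩ := h.surj_le i y
    obtain ⟨k, hk, g, hg⟩ := h.surj_le j y'
    obtain ⟨a, -, ha⟩ := h.le hk
    rw [ht Y y k (f ≫ a) (by rw [res_comp, ha, hf]), ht Y y' k g hg,
      ht Y (y + y') k (f ≫ a + g) (by rw [add_res, res_comp, ha, hf, hg]), sec_add, ap_add]
  · obtain ⟨j, g, hg⟩ := h.surj y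
    rw [ht Y' y j g hg, ht Y (res F.obj f y) j (f ≫ g) (by rw [res_comp, hg]), ← ap_res, res_sec]

/-- Reindexing along a cofinal monotone map. -/
lemma reindex (h : IsPres E Q F X x) {M : Type*} [Preorder M] (σ : M → J) (hσ : Monotone σ)
    (hc : ∀ j, ∃ m, j ≤ σ m) : IsPres E Q F (fun m => X (σ m)) (fun m => x (σ m)) where
  inj f hf := h.inj f hf
  surj y := by
    obtain ⟨j, f, rfl⟩ := h.surj y
    obtain ⟨m, hm⟩ := hc j
    obtain ⟨g, -, e⟩ := h.le hm
    exact ⟨m, f ≫ g, by rw [res_comp, e]⟩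
  le hij := h.le (hσ hij)

lemma psh_hom_ext (h : IsPres E Q F X x) {G : Aᵒᵖ ⥤ AddCommGrpCat.{v}} {φ φ' : F.obj ⟶ G}
    (hφ : ∀ j, ap φ (x j) = ap φ' (x j)) : φ = φ' := by
  refine RelTate.psh_hom_ext (fun Y y => ?_)
  obtain ⟨j, f, rfl⟩ := h.surj y
  rw [ap_res, ap_res, hφ]

lemma hom_ext (h : IsPres E Q F X x) {G : Lex E} {φ φ' : F ⟶ G}
    (hφ : ∀ j, ap φ.hom (x j) = ap φ'.hom (x j)) : φ = φ' :=
  ObjectProperty.hom_ext _ (h.psh_hom_ext hφ)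

lemma exists_hom [IsDirected J (· ≤ ·)] [Nonempty J] (h : IsPres E Q F X x) {G : Lex E}
    (y : ∀ j, G.obj.obj (op (X j)))
    (hy : ∀ {i j : J} (g : X i ⟶ X j), i ≤ j → res F.obj g (x j) = x i →
      res G.obj g (y j) = y i) :
    ∃ φ : F ⟶ G, ∀ j, ap φ.hom (x j) = y j := by
  obtain ⟨φ, hφ⟩ := h.exists_desc (fun j => elt G.obj (y j)) (fun g hij hg =>
    yoneda_hom_ext (by
      rw [ap_comp, ap_yoneda_sec, ap_elt_sec, ap_elt_sec, res_id, Category.id_comp, hy g hij hg]))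
  refine ⟨ObjectProperty.homMk φ, fun j => ?_⟩
  have := hφ (𝟙 (X j))
  rwa [res_id, ap_elt_sec, res_id] at this

lemma indPresented {I : Type w} [PartialOrder I] [IsDirected I (· ≤ ·)] [Nonempty I]
    {X : I → A} {x : ∀ i, F.obj.obj (op (X i))} (h : IsPres E Q F X x)
    {P : ObjectProperty A} (hP : ∀ i, P (X i)) {κ : Cardinal.{w}} (hκ : Cardinal.mk I ≤ κ) :
    indPresented κ E P Q F := by
  choose g hg hgx using fun (i j : I) (hij : i ≤ j) => h.le hij
  -- The transition maps chosen one by one form a functor, because a map into `X j` is determined by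
  -- the section to which it restricts `x j`.
  let R : I ⥤ A :=
    { obj := X
      map := fun f => g _ _ (leOfHom f)
      map_id := fun i => h.eq_of_res (by rw [hgx, res_id])
      map_comp := fun a b => h.eq_of_res (by rw [res_comp, hgx, hgx, hgx]) }
  have hR : ∀ {i j : I} (f : i ⟶ j), res F.obj (R.map f) (x j) = x i := fun f => hgx _ _ _
  refine ⟨I, inferInstance, inferInstance, inferInstance, R,
    { app := fun i => elt F.obj (x i)
      naturality := fun i j f => ?_ }, hκ, hP, fun f => hg _ _ _, ⟨?_⟩⟩
  · refine yoneda_hom_ext (F := F.obj) ?_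
    have : ap (elt F.obj (x j)) (sec (R.map f)) = x i := by rw [ap_elt_sec, hR f]
    simpa using this
  · have key : ∀ s : Cocone (R ⋙ preadditiveYoneda), ∃ φ : F.obj ⟶ s.pt,
        ∀ {j : I} {Y : A} (f : Y ⟶ X j), ap φ (res F.obj f (x j)) = ap (s.ι.app j) (sec f) := by
      intro s
      refine h.exists_desc (fun j => s.ι.app j) (fun {i j} a hij ha => ?_)
      have : a = R.map (homOfLE hij) := h.eq_of_res (by rw [ha, hR])
      rw [this]
      exact s.w (homOfLE hij)
    choose d hd using key
    exact
      { desc := d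
        fac := fun s j => yoneda_hom_ext (F := s.pt) (hd s (𝟙 (X j)))
        uniq := fun s m hm => h.psh_hom_ext (fun j => by
          have e₁ := hd s (𝟙 (X j))
          have e₂ : ap m (res F.obj (𝟙 (X j)) (x j)) = ap (s.ι.app j) (sec (𝟙 (X j))) := by
            rw [← hm j]
            rfl
          rw [res_id] at e₁ e₂
          rw [e₁, e₂]) }

end IsPres

/-- Colimits of presheaves are computed objectwise, and filtered colimits of abelian groups on
underlying sets. `UnivLE.{w, v}` ensures that the index `J` is small enough for this. -/
lemma exists_rep_of_isColimit [UnivLE.{w, v}] {J : Type w} [Preorder J] [Nonempty J]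
    [IsDirected J (· ≤ ·)] (R : J ⥤ A) {c : Cocone (R ⋙ preadditiveYoneda)} (hc : IsColimit c)
    {Y : A} (y : c.pt.obj (op Y)) :
    ∃ (j : J) (f : Y ⟶ R.obj j), ap (c.ι.app j) (sec f) = y := by
  have := preservesFilteredColimitsOfSize_of_univLE.{v, v, w, w} (forget AddCommGrpCat.{v})
  have hc' := isColimitOfPreserves ((evaluation Aᵒᵖ AddCommGrpCat.{v}).obj (op Y)) hc
  obtain ⟨j, f, hf⟩ := Concrete.isColimit_exists_rep _ hc' y
  exact ⟨j, f, hf⟩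

/-- A section that vanishes in a filtered colimit vanishes at a later stage, and the transition maps
are monomorphisms. -/
lemma eq_zero_of_isColimit [UnivLE.{w, v}] {J : Type w} [Preorder J] [Nonempty J]
    [IsDirected J (· ≤ ·)] (R : J ⥤ A) (hR : ∀ {i j : J} (f : i ⟶ j), Mono (R.map f))
    {c : Cocone (R ⋙ preadditiveYoneda)} (hc : IsColimit c) {Y : A} {j : J} (f : Y ⟶ R.obj j)
    (hf : ap (c.ι.app j) (sec f) = 0) : f = 0 := by
  have := preservesFilteredColimitsOfSize_of_univLE.{v, v, w, w} (forget AddCommGrpCat.{v})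
  have hc' := isColimitOfPreserves ((evaluation Aᵒᵖ AddCommGrpCat.{v}).obj (op Y)) hc
  have h0 : ap (c.ι.app j) (sec f) = ap (c.ι.app j) (sec (0 : Y ⟶ R.obj j)) := by
    rw [hf, sec_zero, ap_zero]
  obtain ⟨k, a, b, e⟩ := Concrete.isColimit_exists_of_rep_eq _ hc' _ _ h0
  have e' : f ≫ R.map a = 0 ≫ R.map b := e
  have := hR a
  rwa [zero_comp, ← cancel_mono (R.map a), zero_comp] at *

lemma exists_isPres_of_indPresented [UnivLE.{w, v}] (hE : IsExactStructure E) {κ : Cardinal.{w}}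
    {P Q : ObjectProperty A} {F : Lex E} (h : indPresented κ E P Q F) :
    ∃ (I : Type w) (_ : PartialOrder I) (_ : Nonempty I) (_ : IsDirected I (· ≤ ·)) (X : I → A)
      (x : ∀ i, F.obj.obj (op (X i))), Cardinal.mk I ≤ κ ∧ (∀ i, P (X i)) ∧ IsPres E Q F X x := by
  obtain ⟨I, _, _, _, R, c, hκ, hP, hR, ⟨hc⟩⟩ := h
  have hx : ∀ {i : I} {Y : A} (f : Y ⟶ R.obj i),
      res F.obj f (ap (c.app i) (sec (𝟙 (R.obj i)))) = ap (c.app i) (sec f) := fun f => by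
    rw [← ap_res]
    simp
  refine ⟨I, inferInstance, inferInstance, inferInstance, R.obj,
    fun i => ap (c.app i) (sec (𝟙 (R.obj i))), hκ, hP, ?_, ?_, ?_⟩
  · intro j Y f hf
    rw [hx] at hf
    exact eq_zero_of_isColimit R (fun f => hE.mono_of_monoCokerIn (hR f)) hc f hf
  · intro Y y
    obtain ⟨j, f, hf⟩ := exists_rep_of_isColimit R hc y
    exact ⟨j, f, by rw [hx]; exact hf⟩
  · intro i j hij
    refine ⟨R.map (homOfLE hij), hR _, ?_⟩
    rw [hx]
    have := congrArg (fun t => ap t (sec (𝟙 (R.obj i)))) (c.naturality (homOfLE hij))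
    simpa using this

/-- A directed diagram of monomorphisms has a colimit in the category of left exact presheaves. -/
lemma exists_lex_of_diagram [UnivLE.{w, v}] (hE : IsExactStructure E) {J : Type w} [Preorder J]
    [Nonempty J] [IsDirected J (· ≤ ·)] (R : J ⥤ A) {Q : ObjectProperty A}
    (hR : ∀ {i j : J} (f : i ⟶ j), monoCokerIn E Q (R.map f)) :
    ∃ (F : Lex E) (x : ∀ j, F.obj.obj (op (R.obj j))), IsPres E Q F R.obj x ∧
      ∀ {i j : J} (f : i ⟶ j), res F.obj (R.map f) (x j) = x i := by
  let c := colimit.cocone (R ⋙ preadditiveYoneda)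
  have hc : IsColimit c := colimit.isColimit _
  let x : ∀ j, c.pt.obj (op (R.obj j)) := fun j => ap (c.ι.app j) (sec (𝟙 (R.obj j)))
  have hx : ∀ {j : J} {Y : A} (f : Y ⟶ R.obj j), res c.pt f (x j) = ap (c.ι.app j) (sec f) :=
    fun f => by
      rw [← ap_res]
      simp
  have hm : ∀ {i j : J} (f : i ⟶ j), Mono (R.map f) := fun f => hE.mono_of_monoCokerIn (hR f)
  have hinj : ∀ {j : J} {Y : A} (f : Y ⟶ R.obj j), res c.pt f (x j) = 0 → f = 0 := fun f hf =>
    eq_zero_of_isColimit R hm hc f (by rwa [hx] at hf)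
  have hsurj : ∀ {Y : A} (y : c.pt.obj (op Y)), ∃ (j : J) (f : Y ⟶ R.obj j),
      res c.pt f (x j) = y := fun y => by
    obtain ⟨j, f, hf⟩ := exists_rep_of_isColimit R hc y
    exact ⟨j, f, by rw [hx, hf]⟩
  have hle : ∀ {i j : J} (f : i ⟶ j), res c.pt (R.map f) (x j) = x i := fun {i j} f => by
    rw [hx]
    have := congrArg (fun t => ap t (sec (𝟙 (R.obj i)))) (c.w f)
    simpa using this
  have hadd : c.pt.Additive := ⟨fun {X Y f g} => by
    ext y
    obtain ⟨j, a, ha⟩ := hsurj (Y := X.unop) y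
    change res c.pt (f.unop + g.unop) y = res c.pt f.unop y + res c.pt g.unop y
    rw [← ha, ← res_comp, ← res_comp, ← res_comp, hx, hx, hx, Preadditive.add_comp, sec_add,
      ap_add]⟩
  -- The colimit of presheaves is already left exact: each section lives at some stage, where the
  -- left exactness of a representable applies, and nothing is lost in the colimit by `hinj`.
  refine ⟨⟨c.pt, hadd, fun S hS => ⟨fun a b hab => ?_, fun y => ⟨fun hy => ?_, ?_⟩⟩⟩, x,
    ⟨hinj, hsurj, fun hij => ⟨R.map (homOfLE hij), hR _, hle _⟩⟩, hle⟩
  · have := hE.epi hS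
    rw [← sub_eq_zero]
    obtain ⟨j, f, hf⟩ := hsurj (a - b)
    have h0 : res c.pt S.g (a - b) = 0 := by
      rw [res_sub, sub_eq_zero]
      exact hab
    rw [← hf, ← res_comp] at h0
    have h1 := hinj _ h0
    have : f = 0 := by rwa [← cancel_epi S.g, comp_zero]
    rw [← hf, this, zero_res]
  · obtain ⟨j, f, hf⟩ := hsurj (Y := S.X₂) y
    have h0 : res c.pt S.f y = 0 := hy
    rw [← hf, ← res_comp] at h0
    obtain ⟨l, hl⟩ := hE.desc hS f (hinj _ h0)
    refine ⟨res c.pt l (x j), ?_⟩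
    change res c.pt S.g _ = y
    rw [← res_comp, hl, hf]
  · rintro ⟨z, rfl⟩
    change res c.pt S.f (res c.pt S.g z) = 0
    rw [← res_comp, S.zero, zero_res]

/-- A family of compatible conflations that exhausts the terms of a sequence of left exact
presheaves makes that sequence exact. -/
lemma isLocExact_of_family (hE : IsExactStructure E) {U V W : Lex E} (f : U ⟶ V) (g : V ⟶ W)
    {J : Type w} {X Y Z : J → A} {i : ∀ j, X j ⟶ Y j} {p : ∀ j, Y j ⟶ Z j}
    {h : ∀ j, i j ≫ p j = 0} (hS : ∀ j, E (.mk (i j) (p j) (h j)))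
    (x : ∀ j, U.obj.obj (op (X j))) (y : ∀ j, V.obj.obj (op (Y j)))
    (z : ∀ j, W.obj.obj (op (Z j)))
    (hx : ∀ {T : A} (t : U.obj.obj (op T)), ∃ (j : J) (a : T ⟶ X j), res U.obj a (x j) = t)
    (hy : ∀ {T : A} (t : V.obj.obj (op T)), ∃ (j : J) (a : T ⟶ Y j), res V.obj a (y j) = t)
    (hy' : ∀ {j : J} {T : A} (a : T ⟶ Y j), res V.obj a (y j) = 0 → a = 0)
    (hz : ∀ {T : A} (t : W.obj.obj (op T)), ∃ (j : J) (a : T ⟶ Z j), res W.obj a (z j) = t)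
    (hz' : ∀ {j : J} {T : A} (a : T ⟶ Z j), res W.obj a (z j) = 0 → a = 0)
    (hf : ∀ j, ap f.hom (x j) = res V.obj (i j) (y j))
    (hg : ∀ j, ap g.hom (y j) = res W.obj (p j) (z j)) :
    IsLocExact E f.hom g.hom where
  inj t ht := by
    obtain ⟨j, a, rfl⟩ := hx t
    rw [ap_res, hf, ← res_comp] at ht
    have := hE.mono (hS j)
    have h0 : a = 0 := by rw [← cancel_mono (i j), hy' _ ht, zero_comp]
    rw [h0, zero_res]
  zero t := by
    obtain ⟨j, a, rfl⟩ := hx t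
    rw [ap_res, hf, ← res_comp, ap_res, hg, ← res_comp, Category.assoc, h, comp_zero, zero_res]
  mid t ht := by
    obtain ⟨j, a, rfl⟩ := hy t
    rw [ap_res, hg, ← res_comp] at ht
    obtain ⟨l, hl⟩ := hE.lift (hS j) a (hz' _ ht)
    exact ⟨res U.obj l (x j), by rw [ap_res, hf, ← res_comp, hl]⟩
  surj t := by
    obtain ⟨j, a, rfl⟩ := hz t
    obtain ⟨T', b, q, sq, hq⟩ := hE.pullback_admEpi (p j) a ⟨_, _, _, trivial, hS j⟩
    exact ⟨T', q, res V.obj b (y j), hq, by rw [ap_res, hg, ← res_comp, ← res_comp, sq.w]⟩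

end Presentations

end RelTate

namespace RelTate

/-! ### Straightening exact sequences of Ind objects -/

section Straightening

open Opposite

variable {A : Type u} [Category.{v} A] [Preadditive A] {E : ObjectProperty (ShortComplex A)}

/-- A conflation `X ↪ P ↠ Z` over the sequence `U ⟶ V ⟶ W` of left exact presheaves. -/
structure IsChart {U V W : Lex E} (f : U ⟶ V) (g : V ⟶ W) {X P Z : A} (u : U.obj.obj (op X))
    (w : W.obj.obj (op Z)) (i : X ⟶ P) (q : P ⟶ Z) (p : V.obj.obj (op P)) : Prop where
  zero : i ≫ q = 0
  confl : E (.mk i q zero)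
  res_eq : res V.obj i p = ap f.hom u
  ap_eq : ap g.hom p = res W.obj q w

variable {U V W : Lex E} {f : U ⟶ V} {g : V ⟶ W}

/-- This enlarges the subobject of `U` while keeping that of `W`: in the pushout of the conflation,
`p` and the image of `u'` agree on `X` and therefore glue to a section of `V`. -/
lemma IsChart.pushout (hE : IsExactStructure E) (hx : IsLocExact E f.hom g.hom) {X P Z : A}
    {u : U.obj.obj (op X)} {w : W.obj.obj (op Z)} {i : X ⟶ P} {q : P ⟶ Z} {p : V.obj.obj (op P)}
    (hp : IsChart f g u w i q p) {X' : A} (a : X ⟶ X') (u' : U.obj.obj (op X'))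
    (hu : res U.obj a u' = u) :
    ∃ (P' : A) (i' : X' ⟶ P') (q' : P' ⟶ Z) (p' : V.obj.obj (op P')) (m : P ⟶ P'),
      IsChart f g u' w i' q' p' ∧ res V.obj m p' = p := by
  obtain ⟨P', m, i', q', h', sq, e, hS⟩ := hE.exists_pushout hp.confl a
  have hi : admMono E i := ⟨_, _, _, trivial, hp.confl⟩
  obtain ⟨p', h₁, h₂⟩ := V.exists_res_pushout hE hi sq p (ap f.hom u')
    (by rw [hp.res_eq, ← ap_res, hu])
  refine ⟨P', i', q', p', m, ⟨h', hS, h₂, W.eq_of_res_pushout hE hi sq ?_ ?_⟩, h₁⟩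
  · rw [← ap_res, h₁, hp.ap_eq, ← res_comp, e]
  · rw [← ap_res, h₂, hx.zero, ← res_comp, h', zero_res]

lemma IsChart.inj (hE : IsExactStructure E) (hx : IsLocExact E f.hom g.hom) {X P Z : A}
    {u : U.obj.obj (op X)} {w : W.obj.obj (op Z)} {i : X ⟶ P} {q : P ⟶ Z} {p : V.obj.obj (op P)}
    (hp : IsChart f g u w i q p) (hu : ∀ {T : A} (t : T ⟶ X), res U.obj t u = 0 → t = 0)
    (hw : ∀ {T : A} (t : T ⟶ Z), res W.obj t w = 0 → t = 0) {T : A} (t : T ⟶ P)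
    (ht : res V.obj t p = 0) : t = 0 := by
  obtain ⟨l, rfl⟩ := hE.lift hp.confl t (hw _ (by rw [res_comp, ← hp.ap_eq, ← ap_res, ht, ap_zero]))
  rw [res_comp, hp.res_eq, ← ap_res] at ht
  rw [hu l (hx.inj _ ht), zero_comp]

lemma IsChart.eq_of_res (hE : IsExactStructure E) (hx : IsLocExact E f.hom g.hom) {X P Z : A}
    {u : U.obj.obj (op X)} {w : W.obj.obj (op Z)} {i : X ⟶ P} {q : P ⟶ Z} {p : V.obj.obj (op P)}
    (hp : IsChart f g u w i q p) (hu : ∀ {T : A} (t : T ⟶ X), res U.obj t u = 0 → t = 0)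
    (hw : ∀ {T : A} (t : T ⟶ Z), res W.obj t w = 0 → t = 0) {T : A} {t t' : T ⟶ P}
    (ht : res V.obj t p = res V.obj t' p) : t = t' := by
  rw [← sub_eq_zero]
  exact hp.inj hE hx hu hw _ (by rw [sub_res, ht, sub_self])

section

variable {Q : ObjectProperty A} {I : Type w} [Preorder I] {X : I → A}
  {u : ∀ b, U.obj.obj (op (X b))}

/-- Lift `w` to a section `y` of `V` over a cover of `Z` with kernel `N`. On `N` the section `y`
comes from `U`, hence from a stage `X b`; the pushout of the kernel conflation along `N → X b` is
the chart. -/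
lemma exists_chart (hE : IsExactStructure E) (hx : IsLocExact E f.hom g.hom)
    (hU : IsPres E Q U X u) {Z : A} (w : W.obj.obj (op Z)) :
    ∃ (b : I) (P : A) (i : X b ⟶ P) (q : P ⟶ Z) (p : V.obj.obj (op P)),
      IsChart f g (u b) w i q p := by
  obtain ⟨X', p, y, ⟨N, j, hj, -, hS⟩, hy⟩ := hx.surj w
  obtain ⟨t, ht⟩ := hx.mid (res V.obj j y) (by rw [ap_res, hy, ← res_comp, hj, zero_res])
  obtain ⟨b, a, rfl⟩ := hU.surj t
  obtain ⟨P, m, i, q, h', sq, e, hP⟩ := hE.exists_pushout hS a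
  have hj : admMono E j := ⟨_, _, _, trivial, hS⟩
  obtain ⟨p', h₁, h₂⟩ := V.exists_res_pushout hE hj sq y (ap f.hom (u b)) (by rw [← ht, ap_res])
  refine ⟨b, P, i, q, p', h', hP, h₂, W.eq_of_res_pushout hE hj sq ?_ ?_⟩
  · rw [← ap_res, h₁, hy, ← res_comp, e]
  · rw [← ap_res, h₂, hx.zero, ← res_comp, h', zero_res]

/-- A section of `V` over a section of `W` is absorbed by the charts that are large enough. -/
lemma IsChart.absorb [IsDirected I (· ≤ ·)] (hE : IsExactStructure E)
    (hx : IsLocExact E f.hom g.hom)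
    (hU : IsPres E Q U X u) {b : I} {P Z : A} {w : W.obj.obj (op Z)}
    (hw : ∀ {T : A} (t : T ⟶ Z), res W.obj t w = 0 → t = 0) {i : X b ⟶ P} {q : P ⟶ Z}
    {p : V.obj.obj (op P)} (hp : IsChart f g (u b) w i q p) {Y : A} (y : V.obj.obj (op Y))
    (c : Y ⟶ Z) (hy : ap g.hom y = res W.obj c w) :
    ∃ b₁, b ≤ b₁ ∧ ∀ b', b₁ ≤ b' → ∀ {P' : A} {i' : X b' ⟶ P'} {q' : P' ⟶ Z}
      {p' : V.obj.obj (op P')} (_ : IsChart f g (u b') w i' q' p') (m : P ⟶ P'),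
      res V.obj m p' = p → ∃ h : Y ⟶ P', res V.obj h p' = y := by
  -- On the pullback `Y'` of the chart along `c`, the sections `y` and `p` have the same image in
  -- `W`, so they differ by a section of `U`, which lives on a stage `X b₁`. Corrected by it, the
  -- map from `Y'` to a chart above `b₁` kills the kernel of `Y' → Y` and descends to `Y`.
  obtain ⟨Y', c', r, j, hj, sq, hjc, hS⟩ := hE.exists_pullback hp.confl c
  obtain ⟨t, ht⟩ := hx.mid (res V.obj r y - res V.obj c' p) (by
    rw [ap_sub, ap_res, hy, ap_res, hp.ap_eq, ← res_comp, ← res_comp, sq.w, sub_self])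
  obtain ⟨b₁, hb₁, d, rfl⟩ := hU.surj_le b t
  refine ⟨b₁, hb₁, fun b' hb' P' i' q' p' hp' m hm => ?_⟩
  obtain ⟨e, -, he⟩ := hU.le hb'
  have hn : res V.obj (c' ≫ m + d ≫ e ≫ i') p' = res V.obj r y := by
    rw [add_res, res_comp, hm, res_comp, res_comp, hp'.res_eq, ← ap_res, he, ← ap_res, ht]
    abel
  obtain ⟨h, hh⟩ := hE.desc hS (c' ≫ m + d ≫ e ≫ i') (hp'.inj hE hx hU.inj hw _ (by
    rw [res_comp, hn, ← res_comp, hj, zero_res]))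
  exact ⟨h, V.eq_of_res hS (by rw [← res_comp, hh, hn])⟩

variable {K : Type w} [Preorder K] {Z : K → A}
  {w : ∀ k, W.obj.obj (op (Z k))}

/-- One base chart is fixed over each `k`, and the other charts over `k` are its pushouts. So there
is a single chart for each admitted pair `(b, k)`, and any section of `V` over `Z k₀` is absorbed
once `b` is large. -/
lemma exists_chart_family [IsDirected I (· ≤ ·)] (hE : IsExactStructure E)
    (hx : IsLocExact E f.hom g.hom)
    (hU : IsPres E Q U X u) (hW : IsPres E Q W Z w) :
    ∃ (J : Type w) (a : J → I) (k : J → K) (P : J → A) (i : ∀ j, X (a j) ⟶ P j)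
      (q : ∀ j, P j ⟶ Z (k j)) (p : ∀ j, V.obj.obj (op (P j))),
      Function.Injective (fun j => (a j, k j)) ∧
      (∀ j, IsChart f g (u (a j)) (w (k j)) (i j) (q j) (p j)) ∧
      ∀ (k₀ : K) {Y : A} (y : V.obj.obj (op Y)) (c : Y ⟶ Z k₀),
        ap g.hom y = res W.obj c (w k₀) →
        ∃ b₁, ∀ b, b₁ ≤ b → ∃ j, k j = k₀ ∧ a j = b ∧ ∃ h : Y ⟶ P j, res V.obj h (p j) = y := by
  choose b₀ P₀ i₀ q₀ p₀ hp₀ using fun k => exists_chart hE hx hU (w k)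
  let J := { x : I × K // b₀ x.2 ≤ x.1 }
  have key : ∀ j : J, ∃ (P : A) (i : X j.1.1 ⟶ P) (q : P ⟶ Z j.1.2) (p : V.obj.obj (op P))
      (m : P₀ j.1.2 ⟶ P), IsChart f g (u j.1.1) (w j.1.2) i q p ∧ res V.obj m p = p₀ j.1.2 := by
    intro j
    obtain ⟨e, -, he⟩ := hU.le j.2
    exact (hp₀ j.1.2).pushout hE hx e (u j.1.1) he
  choose P i q p m hp hm using key
  refine ⟨J, fun j => j.1.1, fun j => j.1.2, P, i, q, p, fun j j' h => Subtype.ext h, hp,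
    fun k₀ Y y c hy => ?_⟩
  obtain ⟨b₁, hb₁, H⟩ := (hp₀ k₀).absorb hE hx hU hW.inj y c hy
  refine ⟨b₁, fun b hb => ?_⟩
  let j : J := ⟨(b, k₀), hb₁.trans hb⟩
  exact ⟨j, rfl, rfl, H b hb (hp j) (m j) (hm j)⟩

end

/-- Straightening of an exact sequence whose outer terms are admissible Ind objects. -/
theorem exists_straightening {Q : ObjectProperty A} {I : Type w} [PartialOrder I]
    [IsDirected I (· ≤ ·)] [Nonempty I] {X : I → A} {u : ∀ b, U.obj.obj (op (X b))}
    {K : Type w} [PartialOrder K] [IsDirected K (· ≤ ·)] [Nonempty K] {Z : K → A}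
    {w : ∀ k, W.obj.obj (op (Z k))}
    (hE : IsExactStructure E) (hQ : IsExtensionClosed E Q) (hx : IsLocExact E f.hom g.hom)
    (hU : IsPres E Q U X u) (hW : IsPres E Q W Z w) :
    ∃ (J : Type w) (_ : PartialOrder J) (_ : Nonempty J) (_ : IsDirected J (· ≤ ·))
      (a : J → I) (k : J → K) (P : J → A) (i : ∀ j, X (a j) ⟶ P j)
      (q : ∀ j, P j ⟶ Z (k j)) (p : ∀ j, V.obj.obj (op (P j))),
      Cardinal.mk J ≤ Cardinal.mk I * Cardinal.mk K ∧ Monotone a ∧ Monotone k ∧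
      (∀ b, ∃ j, b ≤ a j) ∧ (∀ k₀, ∃ j, k₀ ≤ k j) ∧
      (∀ j, IsChart f g (u (a j)) (w (k j)) (i j) (q j) (p j)) ∧ IsPres E Q V P p := by
  obtain ⟨J, a, k, P, i, q, p, hinj, hp, habs⟩ := exists_chart_family hE hx hU hW
  have hpi : ∀ (j : J) {T : A} {t t' : T ⟶ P j}, res V.obj t (p j) = res V.obj t' (p j) → t = t' :=
    fun j _ _ _ h => (hp j).eq_of_res hE hx hU.inj hW.inj h
  -- The order is that of the two indices together with inclusion of charts as subobjects of `V`. It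
  -- is antisymmetric because a chart is determined by its pair of indices.
  let inst : PartialOrder J :=
    { le := fun j j' => a j ≤ a j' ∧ k j ≤ k j' ∧ ∃ h : P j ⟶ P j', res V.obj h (p j') = p j
      le_refl := fun j => ⟨le_rfl, le_rfl, 𝟙 _, res_id _ _⟩
      le_trans := by
        rintro j j' j'' ⟨h₁, h₂, h, e⟩ ⟨h₁', h₂', h', e'⟩
        exact ⟨h₁.trans h₁', h₂.trans h₂', h ≫ h', by rw [res_comp, e', e]⟩
      le_antisymm := by
        rintro j j' ⟨h₁, h₂, -⟩ ⟨h₁', h₂', -⟩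
        exact hinj (Prod.ext (h₁.antisymm h₁') (h₂.antisymm h₂')) }
  have hle : ∀ {j j' : J}, j ≤ j' → ∃ h : P j ⟶ P j', res V.obj h (p j') = p j := fun h => h.2.2
  -- Absorption is applied to the section `p j` of the chart itself.
  have hover : ∀ (j : J) (k₀ : K), k j ≤ k₀ →
      ∃ b₁, ∀ b, b₁ ≤ b → a j ≤ b → ∃ j', k j' = k₀ ∧ a j' = b ∧ j ≤ j' := by
    intro j k₀ hk
    obtain ⟨e, -, he⟩ := hW.le hk
    obtain ⟨b₁, hb₁⟩ := habs k₀ (p j) (q j ≫ e) (by rw [(hp j).ap_eq, res_comp, he])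
    refine ⟨b₁, fun b hb hab => ?_⟩
    obtain ⟨j', rfl, rfl, h⟩ := hb₁ b hb
    exact ⟨j', rfl, rfl, hab, hk, h⟩
  -- Absorbing the zero section over a zero object yields charts over `k₀` with all large indices
  -- `b`.
  have hcof : ∀ (b : I) (k₀ : K), ∃ j, b ≤ a j ∧ k₀ ≤ k j := by
    intro b k₀
    obtain ⟨N, hN⟩ := hE.hasZeroObject
    obtain ⟨b₁, hb₁⟩ := habs k₀ (0 : V.obj.obj (op N)) 0 (by rw [ap_zero, zero_res])
    obtain ⟨b₂, h₁, h₂⟩ := exists_ge_ge b b₁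
    obtain ⟨j, rfl, rfl, -⟩ := hb₁ b₂ h₂
    exact ⟨j, h₁, le_rfl⟩
  refine ⟨J, inst, ?_, ⟨fun j j' => ?_⟩, a, k, P, i, q, p, ?_, fun _ _ h => h.1, fun _ _ h => h.2.1,
    fun b => ?_, fun k₀ => ?_, hp, ?_, ?_, ?_⟩
  · obtain ⟨j, -⟩ := hcof (Classical.arbitrary I) (Classical.arbitrary K)
    exact ⟨j⟩
  · obtain ⟨k₀, hk, hk'⟩ := exists_ge_ge (k j) (k j')
    obtain ⟨b₁, h₁⟩ := hover j k₀ hk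
    obtain ⟨b₂, h₂⟩ := hover j' k₀ hk'
    obtain ⟨b, hb₁, hb₂⟩ := exists_ge_ge b₁ b₂
    obtain ⟨c, hc, hc'⟩ := exists_ge_ge (a j) (a j')
    obtain ⟨d, hd, hd'⟩ := exists_ge_ge b c
    obtain ⟨l, hl, hl', h⟩ := h₁ d (hb₁.trans hd) (hc.trans hd')
    obtain ⟨m, hm, hm', h'⟩ := h₂ d (hb₂.trans hd) (hc'.trans hd')
    obtain rfl : l = m := hinj (Prod.ext (hl'.trans hm'.symm) (hl.trans hm.symm))
    exact ⟨l, h, h'⟩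
  · have := Cardinal.mk_le_of_injective hinj
    rwa [Cardinal.mk_prod, Cardinal.lift_id, Cardinal.lift_id] at this
  · obtain ⟨j, h, -⟩ := hcof b (Classical.arbitrary K)
    exact ⟨j, h⟩
  · obtain ⟨j, -, h⟩ := hcof (Classical.arbitrary I) k₀
    exact ⟨j, h⟩
  · intro j T t ht
    exact (hp j).inj hE hx hU.inj hW.inj t ht
  · intro T y
    obtain ⟨k₀, c, hc⟩ := hW.surj (ap g.hom y)
    obtain ⟨b₁, hb₁⟩ := habs k₀ y c hc.symm
    obtain ⟨j, -, -, h⟩ := hb₁ b₁ le_rfl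
    exact ⟨j, h⟩
  · intro j j' hjj
    obtain ⟨h, hh⟩ := hle hjj
    obtain ⟨e, he, he'⟩ := hU.le hjj.1
    obtain ⟨c, hc, hc'⟩ := hW.le hjj.2.1
    -- A transition map of charts lies between transition maps of `U` and of `W`, so its cokernel is
    -- an extension of objects of `Q`.
    refine ⟨h, hQ.monoCokerIn_middle hE (hp j).confl (hp j').confl (hpi j' ?_) (hW.eq_of_res ?_)
      he hc, hh⟩
    · rw [res_comp, hh, res_comp, (hp j').res_eq, (hp j).res_eq, ← ap_res, he']
    · rw [res_comp, ← (hp j').ap_eq, ← ap_res, hh, res_comp, hc', (hp j).ap_eq]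

end Straightening

end RelTate

namespace RelTate

section Subcategories

variable {B : Type u} [Category.{v} B] [Preadditive B]

lemma hasBinaryBiproducts_fullSubcategory [HasBinaryBiproducts B] (P : ObjectProperty B)
    (hP : ∀ X Y, P X → P Y → P (X ⊞ Y)) : HasBinaryBiproducts P.FullSubcategory where
  has_binary_biproduct X Y := by
    let b : BinaryBicone X Y :=
      { pt := ⟨X.obj ⊞ Y.obj, hP _ _ X.property Y.property⟩
        fst := ObjectProperty.homMk biprod.fst
        snd := ObjectProperty.homMk biprod.snd
        inl := ObjectProperty.homMk biprod.inl
        inr := ObjectProperty.homMk biprod.inr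
        inl_fst := ObjectProperty.hom_ext _ biprod.inl_fst
        inl_snd := ObjectProperty.hom_ext _ biprod.inl_snd
        inr_fst := ObjectProperty.hom_ext _ biprod.inr_fst
        inr_snd := ObjectProperty.hom_ext _ biprod.inr_snd }
    exact hasBinaryBiproduct_of_total b (ObjectProperty.hom_ext _ biprod.total)

end Subcategories

/-! ### Extensions, quotients and pushouts of Ind objects -/

section IndObjects

open Opposite

variable {A : Type u} [Category.{v} A] [Preadditive A] {E : ObjectProperty (ShortComplex A)}

/-- A directed family of objects, with transition maps that are determined by a property, has a
union in the category of left exact presheaves. -/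
lemma exists_lex_of_family [UnivLE.{w, v}] (hE : IsExactStructure E) {Q : ObjectProperty A}
    {J : Type w} [Preorder J] [Nonempty J] [IsDirected J (· ≤ ·)]
    (X : J → A) (r : ∀ i j, (X i ⟶ X j) → Prop)
    (hr : ∀ {i j}, i ≤ j → ∃ g, r i j g ∧ monoCokerIn E Q g)
    (hu : ∀ {i j} (g g' : X i ⟶ X j), r i j g → r i j g' → g = g') (hid : ∀ i, r i i (𝟙 _))
    (hcomp : ∀ {i j k} (g : X i ⟶ X j) (h : X j ⟶ X k), r i j g → r j k h → r i k (g ≫ h)) :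
    ∃ (F : Lex E) (x : ∀ j, F.obj.obj (op (X j))), IsPres E Q F X x ∧
      ∀ {i j : J} (g : X i ⟶ X j), i ≤ j → r i j g → res F.obj g (x j) = x i := by
  choose t ht htm using fun (i j : J) (h : i ≤ j) => hr h
  let R : J ⥤ A :=
    { obj := X
      map := fun f => t _ _ (leOfHom f)
      map_id := fun i => hu _ _ (ht _ _ _) (hid i)
      map_comp := fun f g => hu _ _ (ht _ _ _) (hcomp _ _ (ht _ _ _) (ht _ _ _)) }
  obtain ⟨F, x, hF, hx⟩ := exists_lex_of_diagram hE R (Q := Q) (fun f => htm _ _ _)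
  refine ⟨F, x, hF, fun g hij hg => ?_⟩
  rw [hu g _ hg (ht _ _ hij)]
  exact hx (homOfLE hij)

/-- The subpresheaf of the sections killed by `φ`. -/
def kerPsh {G H : Aᵒᵖ ⥤ AddCommGrpCat.{v}} (φ : G ⟶ H) : Aᵒᵖ ⥤ AddCommGrpCat.{v} where
  obj X := AddCommGrpCat.of (φ.app X).hom.ker
  map {X Y} f := AddCommGrpCat.ofHom
    (((G.map f).hom.comp (φ.app X).hom.ker.subtype).codRestrict (φ.app Y).hom.ker
      (fun z => (ap_res φ f.unop z.1).trans ((congrArg (res H f.unop) z.2).trans (res_zero H _))))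
  map_id X := by ext x; exact res_id G x.1
  map_comp f g := by ext x; exact res_comp G g.unop f.unop x.1

lemma kerPsh_isLeftExact {G H : Lex E} (φ : G ⟶ H) : isLeftExact E (kerPsh φ.hom) := by
  refine ⟨⟨fun {X Y f g} => ?_⟩, fun S hS => ⟨fun a b hab => ?_, fun y => ⟨fun hy => ?_, ?_⟩⟩⟩
  · ext x
    exact Subtype.ext (add_res G.obj f.unop g.unop x.1)
  · exact Subtype.ext (G.eq_of_res hS (congrArg Subtype.val hab))
  · obtain ⟨z, hz⟩ := G.exists_res hS y.1 (congrArg Subtype.val hy)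
    have hm : ap φ.hom z = 0 := by
      apply H.eq_of_res hS
      rw [← ap_res, hz, res_zero]
      exact y.2
    exact ⟨⟨z, hm⟩, Subtype.ext hz⟩
  · rintro ⟨z, rfl⟩
    refine Subtype.ext ?_
    change res G.obj S.f (res G.obj S.g z.1) = 0
    rw [← res_comp, S.zero, zero_res]

lemma Lex.exists_kernel {G H : Lex E} (φ : G ⟶ H) :
    ∃ (N : Lex E) (ι : N ⟶ G), (∀ {X : A} (x : N.obj.obj (op X)), ap ι.hom x = 0 → x = 0) ∧
      ∀ {X : A} (y : G.obj.obj (op X)), ap φ.hom y = 0 ↔ ∃ x, ap ι.hom x = y := by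
  refine ⟨⟨kerPsh φ.hom, kerPsh_isLeftExact φ⟩, ObjectProperty.homMk
    { app := fun X => AddCommGrpCat.ofHom (φ.hom.app X).hom.ker.subtype },
    fun x hx => Subtype.ext hx, fun y => ⟨fun hy => ⟨⟨y, hy⟩, rfl⟩, ?_⟩⟩
  rintro ⟨x, rfl⟩
  exact x.2

/-- Factorization through a morphism that is injective on sections. -/
lemma Lex.exists_lift {N G T : Lex E} (ι : N ⟶ G)
    (hι : ∀ {X : A} (x : N.obj.obj (op X)), ap ι.hom x = 0 → x = 0) (t : T ⟶ G)
    (ht : ∀ {X : A} (x : T.obj.obj (op X)), ∃ n, ap ι.hom n = ap t.hom x) : ∃ l, l ≫ ι = t := by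
  have hi : ∀ {X : A} {x y : N.obj.obj (op X)}, ap ι.hom x = ap ι.hom y → x = y := fun h => by
    rw [← sub_eq_zero]
    exact hι _ (by rw [ap_sub, h, sub_self])
  choose l hl using fun (X : A) (x : T.obj.obj (op X)) => ht x
  exact ⟨ObjectProperty.homMk (mkHom l (fun X x y => hi (by simp [hl]))
    (fun f y => hi (by simp [hl, ap_res]))), Lex.hom_ext (fun x => hl _ x)⟩

lemma isLeftExact_biprod {F G : Aᵒᵖ ⥤ AddCommGrpCat.{v}} (hF : isLeftExact E F)
    (hG : isLeftExact E G) : isLeftExact E (F ⊞ G) := by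
  have := hF.1
  have := hG.1
  have ext' : ∀ {X : A} {x y : (F ⊞ G).obj (op X)},
      ap (biprod.fst : F ⊞ G ⟶ F) x = ap (biprod.fst : F ⊞ G ⟶ F) y →
      ap (biprod.snd : F ⊞ G ⟶ G) x = ap (biprod.snd : F ⊞ G ⟶ G) y → x = y := by
    intro X x y h₁ h₂
    have e : ∀ z : (F ⊞ G).obj (op X), z = ap (biprod.inl : F ⟶ F ⊞ G) (ap biprod.fst z) +
        ap (biprod.inr : G ⟶ F ⊞ G) (ap biprod.snd z) := fun z => by
      rw [← ap_comp, ← ap_comp, ← ap_add_hom, biprod.total, ap_id]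
    rw [e x, e y, h₁, h₂]
  refine ⟨⟨fun {X Y f g} => ?_⟩, fun S hS => ⟨fun a b hab => ?_, fun y => ⟨fun hy => ?_, ?_⟩⟩⟩
  · ext x
    change res (F ⊞ G) (f.unop + g.unop) x = res (F ⊞ G) f.unop x + res (F ⊞ G) g.unop x
    apply ext'
    · rw [ap_res, add_res, ap_add, ap_res, ap_res]
    · rw [ap_res, add_res, ap_add, ap_res, ap_res]
  · have h : res (F ⊞ G) S.g a = res (F ⊞ G) S.g b := hab
    refine ext' ((hF.2 S hS).1 ?_) ((hG.2 S hS).1 ?_)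
    · change res F S.g _ = res F S.g _
      rw [← ap_res, ← ap_res, h]
    · change res G S.g _ = res G S.g _
      rw [← ap_res, ← ap_res, h]
  · have h : res (F ⊞ G) S.f y = 0 := hy
    obtain ⟨z, hz⟩ := ((hF.2 S hS).2 (ap biprod.fst y)).1 (by
      change res F S.f _ = 0
      rw [← ap_res, h, ap_zero])
    obtain ⟨t, ht⟩ := ((hG.2 S hS).2 (ap biprod.snd y)).1 (by
      change res G S.f _ = 0
      rw [← ap_res, h, ap_zero])
    change res F S.g z = _ at hz
    change res G S.g t = _ at ht
    refine ⟨ap (biprod.inl : F ⟶ F ⊞ G) z + ap (biprod.inr : G ⟶ F ⊞ G) t, ?_⟩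
    change res (F ⊞ G) S.g _ = y
    apply ext'
    · rw [ap_res, ap_add, ← ap_comp, ← ap_comp, biprod.inl_fst, biprod.inr_fst, ap_id,
        ap_zero_hom, add_zero, hz]
    · rw [ap_res, ap_add, ← ap_comp, ← ap_comp, biprod.inl_snd, biprod.inr_snd, ap_id,
        ap_zero_hom, zero_add, ht]
  · rintro ⟨z, rfl⟩
    change res (F ⊞ G) S.f (res (F ⊞ G) S.g z) = 0
    apply ext'
    · rw [ap_res, ap_res, ← res_comp, S.zero, zero_res, ap_zero]
    · rw [ap_res, ap_res, ← res_comp, S.zero, zero_res, ap_zero]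

instance Lex.hasBinaryBiproducts : HasBinaryBiproducts (Lex E) :=
  hasBinaryBiproducts_fullSubcategory _ (fun _ _ hF hG => isLeftExact_biprod hF hG)

lemma lexYoneda_isZero (hE : IsExactStructure E) {Z : A} (hZ : IsZero Z) :
    IsZero ((lexYoneda hE).obj Z) := by
  rw [IsZero.iff_id_eq_zero]
  exact Lex.yoneda_hom_ext hE (lsec_injective hE (hZ.eq_of_tgt _ _))

section

variable [UnivLE.{w, v}] {κ : Cardinal.{w}} {Q : ObjectProperty A}

/-- Admissible Ind objects are closed under extensions of left exact presheaves. -/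
theorem indPresented_of_isLocExact (hκ : Cardinal.aleph0 ≤ κ) (hE : IsExactStructure E)
    (hQ : IsExtensionClosed E Q) {U V W : Lex E} {f : U ⟶ V} {g : V ⟶ W}
    (hx : IsLocExact E f.hom g.hom) (hU : indPresented κ E ⊤ Q U) (hW : indPresented κ E ⊤ Q W) :
    indPresented κ E ⊤ Q V := by
  obtain ⟨I, _, _, _, X, u, hI, -, hU⟩ := exists_isPres_of_indPresented hE hU
  obtain ⟨K, _, _, _, Z, w, hK, -, hW⟩ := exists_isPres_of_indPresented hE hW
  obtain ⟨J, _, _, _, a, k, P, i, q, p, hJ, -, -, -, -, -, hV⟩ :=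
    exists_straightening hE hQ hx hU hW
  exact hV.indPresented (fun _ => trivial) (hJ.trans (Cardinal.mul_le_of_le hκ hI hK))

/-- The quotient of an admissible Ind object by a member of its diagram. -/
theorem IsPres.exists_quotient (hE : IsExactStructure E) {V : Lex E} {I : Type w} [PartialOrder I]
    [IsDirected I (· ≤ ·)] [Nonempty I] {X : I → A} {x : ∀ i, V.obj.obj (op (X i))}
    (hV : IsPres E Q V X x) (hκ : Cardinal.mk I ≤ κ) (i₀ : I) :
    ∃ (W : Lex E) (g : V ⟶ W), RelTate.indPresented κ E Q Q W ∧
      IsLocExact E (V.elt hE (x i₀)).hom g.hom := by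
  let J := { i : I // i₀ ≤ i }
  have hJ₀ : Nonempty J := ⟨⟨i₀, le_rfl⟩⟩
  have hdir : ∀ i : I, ∃ j : J, i ≤ j.1 := fun i => by
    obtain ⟨k, h, h'⟩ := exists_ge_ge i₀ i
    exact ⟨⟨k, h⟩, h'⟩
  have hJd : IsDirected J (· ≤ ·) := ⟨fun a b => by
    obtain ⟨k, h, h'⟩ := exists_ge_ge a.1 b.1
    exact ⟨⟨k, a.2.trans h⟩, h, h'⟩⟩
  have hV' : IsPres E Q V (fun j : J => X j.1) (fun j => x j.1) :=
    hV.reindex Subtype.val (fun _ _ h => h) hdir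
  choose t ht hxt using fun j : J => hV.le j.2
  choose R c hc hR hS using ht
  -- Here `R j` is `X j / X i₀`, and the quotient `W` is the union of the `R j` for `j ≥ i₀`. The
  -- relation says that `a` is induced by the inclusion of `X j` into `X j'`, which determines `a`.
  let r : ∀ j j' : J, (R j ⟶ R j') → Prop := fun j j' a =>
    ∃ e : X j.1 ⟶ X j'.1, res V.obj e (x j'.1) = x j.1 ∧ c j ≫ a = e ≫ c j'
  have hr : ∀ {j j' : J}, j ≤ j' → ∃ a, r j j' a ∧ monoCokerIn E Q a := by
    intro j j' hjj
    obtain ⟨e, ⟨T, q, hq, hT, hqS⟩, he⟩ := hV.le hjj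
    have hte : t j' = t j ≫ e := hV.eq_of_res (by rw [hxt, res_comp, he, hxt])
    have hS' : E (.mk (t j ≫ e) (c j') (by rw [← hte, hc])) := by
      simpa only [hte] using hS j'
    -- The cokernel of `R j → R j'` is `X j' / X j`, an object of `Q`.
    obtain ⟨a, b, hab, h₁, -, h₂⟩ := hE.noether (hS j) hqS hS'
    exact ⟨a, ⟨e, he, h₁⟩, _, _, _, hT, h₂⟩
  have hu : ∀ {j j' : J} (a a' : R j ⟶ R j'), r j j' a → r j j' a' → a = a' := by
    rintro j j' a a' ⟨e, he, h⟩ ⟨e', he', h'⟩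
    have := hE.epi (hS j)
    obtain rfl : e = e' := hV.eq_of_res (by rw [he, he'])
    rw [← cancel_epi (c j), h, h']
  obtain ⟨W, y, hW, hy⟩ := exists_lex_of_family hE R r hr hu
    (fun j => ⟨𝟙 _, res_id _ _, by simp⟩)
    (fun {i j k} a b => by
      rintro ⟨e, he, h⟩ ⟨e', he', h'⟩
      exact ⟨e ≫ e', by rw [res_comp, he', he], by rw [reassoc_of% h, h', Category.assoc]⟩)
  obtain ⟨g, hg⟩ := hV'.exists_hom (G := W) (fun j => res W.obj (c j) (y j))
      (fun {i j} e hij he => by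
    obtain ⟨a, ha, -⟩ := hr hij
    have hya := hy a hij ha
    obtain ⟨e', he', h⟩ := ha
    obtain rfl : e = e' := hV.eq_of_res (by rw [he, he'])
    rw [← res_comp, ← h, res_comp, hya])
  refine ⟨W, g, hW.indPresented (fun j => hR j) ((Cardinal.mk_subtype_le _).trans hκ),
    isLocExact_of_family hE (V.elt hE (x i₀)) g hS (fun _ => lsec hE (𝟙 (X i₀))) (fun j => x j.1) y
      (fun t => ⟨Classical.arbitrary J, lunsec hE t, by
      rw [res_lsec, Category.comp_id, lsec_lunsec]⟩)
      hV'.surj hV'.inj hW.surj hW.inj (fun j => ?_) hg⟩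
  rw [Lex.ap_elt_lsec, res_id, hxt]

/-- Pushouts of exact sequences of left exact presheaves with admissible Ind objects as outer
terms. -/
theorem exists_pushout_lex (hκ : Cardinal.aleph0 ≤ κ) (hE : IsExactStructure E)
    (hQ : IsExtensionClosed E Q) {U V W : Lex E} {f : U ⟶ V} {g : V ⟶ W}
    (hx : IsLocExact E f.hom g.hom) (hU : indPresented κ E ⊤ Q U) (hW : indPresented κ E ⊤ Q W)
    {U' : Lex E} (φ : U ⟶ U') (hU' : indPresented κ E ⊤ Q U') :
    ∃ (V' : Lex E) (f' : U' ⟶ V') (φ' : V ⟶ V') (g' : V' ⟶ W), indPresented κ E ⊤ Q V' ∧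
      IsLocExact E f'.hom g'.hom ∧ f ≫ φ' = φ ≫ f' ∧ φ' ≫ g' = g := by
  obtain ⟨I, _, _, _, X, u, hI, -, hU⟩ := exists_isPres_of_indPresented hE hU
  obtain ⟨K, _, _, _, Z, w, hK, -, hW⟩ := exists_isPres_of_indPresented hE hW
  obtain ⟨I', _, _, _, X', u', hI', -, hU'⟩ := exists_isPres_of_indPresented hE hU'
  obtain ⟨J, _, _, _, a, k, P, i, q, p, hJ, ha, hk, hac, hkc, hp, hV⟩ :=
    exists_straightening hE hQ hx hU hW
  -- An index is a chart of `V` together with a stage of `U'` that receives the `U`-part of the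
  -- chart. `V'` is the union of the pushouts of the charts along these maps.
  let M := { m : J × I' // ∃ s : X (a m.1) ⟶ X' m.2, res U'.obj s (u' m.2) = ap φ.hom (u (a m.1)) }
  have hMc : ∀ (j : J) (c : I'), ∃ m : M, m.1.1 = j ∧ c ≤ m.1.2 := fun j c => by
    obtain ⟨c', hc, s, hs⟩ := hU'.surj_le c (ap φ.hom (u (a j)))
    exact ⟨⟨(j, c'), s, hs⟩, rfl, hc⟩
  have hM₀ : Nonempty M := by
    obtain ⟨m, -⟩ := hMc (Classical.arbitrary J) (Classical.arbitrary I')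
    exact ⟨m⟩
  have hMd : IsDirected M (· ≤ ·) := ⟨fun m m' => by
    obtain ⟨j, h, h'⟩ := exists_ge_ge m.1.1 m'.1.1
    obtain ⟨c, h₁, h₁'⟩ := exists_ge_ge m.1.2 m'.1.2
    obtain ⟨n, rfl, hn⟩ := hMc j c
    exact ⟨n, ⟨h, h₁.trans hn⟩, ⟨h', h₁'.trans hn⟩⟩⟩
  choose s hs using fun m : M => m.2
  choose R f' i' q' hiq sq hfq hS using fun m : M => hE.exists_pushout (hp m.1.1).confl (s m)
  let r : ∀ m n : M, (R m ⟶ R n) → Prop := fun m n t =>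
    ∃ (e : P m.1.1 ⟶ P n.1.1) (e' : X' m.1.2 ⟶ X' n.1.2), res V.obj e (p n.1.1) = p m.1.1 ∧
      res U'.obj e' (u' n.1.2) = u' m.1.2 ∧ f' m ≫ t = e ≫ f' n ∧ i' m ≫ t = e' ≫ i' n
  have hr : ∀ {m n : M}, m ≤ n → ∃ t, r m n t ∧ monoCokerIn E Q t := by
    intro m n hmn
    obtain ⟨e, -, he⟩ := hV.le hmn.1
    obtain ⟨e', he', hu'⟩ := hU'.le hmn.2
    obtain ⟨d, -, hd⟩ := hU.le (ha hmn.1)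
    obtain ⟨b, hb, hwb⟩ := hW.le (hk hmn.1)
    have hie : i m.1.1 ≫ e = d ≫ i n.1.1 := hV.eq_of_res (by
      rw [res_comp, he, res_comp, (hp _).res_eq, (hp _).res_eq, ← ap_res, hd])
    have hqe : e ≫ q n.1.1 = q m.1.1 ≫ b := hW.eq_of_res (by
      rw [res_comp, ← (hp _).ap_eq, ← ap_res, he, res_comp, hwb, (hp _).ap_eq])
    have hse : s m ≫ e' = d ≫ s n := hU'.eq_of_res (by
      rw [res_comp, res_comp, hu', hs, hs, ← ap_res, hd])
    let t : R m ⟶ R n := (sq m).desc (e ≫ f' n) (e' ≫ i' n) (by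
      rw [reassoc_of% hie, (sq n).w, reassoc_of% hse])
    have h₁ : f' m ≫ t = e ≫ f' n := (sq m).inl_desc _ _ _
    have h₂ : i' m ≫ t = e' ≫ i' n := (sq m).inr_desc _ _ _
    -- The pushed out charts are conflations whose ends are stages of `U'` and of `W`, so the
    -- transition maps are controlled by those of the ends.
    refine ⟨t, ⟨e, e', he, hu', h₁, h₂⟩, hQ.monoCokerIn_middle hE (hS m) (hS n) h₂
      ((sq m).hom_ext ?_ ?_) he' hb⟩
    · rw [reassoc_of% h₁, hfq, hqe, reassoc_of% (hfq m)]
    · rw [reassoc_of% h₂, hiq, comp_zero, reassoc_of% (hiq m), zero_comp]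
  have huniq : ∀ {m n : M} (t t' : R m ⟶ R n), r m n t → r m n t' → t = t' := by
    rintro m n t t' ⟨e, d, h₁, h₂, h₃, h₄⟩ ⟨e', d', h₁', h₂', h₃', h₄'⟩
    obtain rfl : e = e' := hV.eq_of_res (by rw [h₁, h₁'])
    obtain rfl : d = d' := hU'.eq_of_res (by rw [h₂, h₂'])
    exact (sq m).hom_ext (by rw [h₃, h₃']) (by rw [h₄, h₄'])
  obtain ⟨V', y, hV', hy⟩ := exists_lex_of_family hE R r hr huniq
    (fun j => ⟨𝟙 _, 𝟙 _, res_id _ _, res_id _ _, by simp, by simp⟩)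
    (fun {l m n} t t' => by
      rintro ⟨e, d, h₁, h₂, h₃, h₄⟩ ⟨e', d', h₁', h₂', h₃', h₄'⟩
      exact ⟨e ≫ e', d ≫ d', by rw [res_comp, h₁', h₁], by rw [res_comp, h₂', h₂],
        by rw [reassoc_of% h₃, h₃', Category.assoc], by rw [reassoc_of% h₄, h₄', Category.assoc]⟩)
  have hVM : IsPres E Q V (fun m : M => P m.1.1) (fun m => p m.1.1) :=
    hV.reindex (fun m : M => m.1.1) (fun _ _ h => h.1) (fun j => by
      obtain ⟨m, rfl, -⟩ := hMc j (Classical.arbitrary I')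
      exact ⟨m, le_rfl⟩)
  have hUM' : IsPres E Q U' (fun m : M => X' m.1.2) (fun m => u' m.1.2) :=
    hU'.reindex (fun m : M => m.1.2) (fun _ _ h => h.2) (fun c => by
      obtain ⟨m, -, h⟩ := hMc (Classical.arbitrary J) c
      exact ⟨m, h⟩)
  have hUM : IsPres E Q U (fun m : M => X (a m.1.1)) (fun m => u (a m.1.1)) :=
    hU.reindex (fun m : M => a m.1.1) (fun _ _ h => ha h.1) (fun b => by
      obtain ⟨j, hj⟩ := hac b
      obtain ⟨m, rfl, -⟩ := hMc j (Classical.arbitrary I')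
      exact ⟨m, hj⟩)
  have hWM : IsPres E Q W (fun m : M => Z (k m.1.1)) (fun m => w (k m.1.1)) :=
    hW.reindex (fun m : M => k m.1.1) (fun _ _ h => hk h.1) (fun b => by
      obtain ⟨j, hj⟩ := hkc b
      obtain ⟨m, rfl, -⟩ := hMc j (Classical.arbitrary I')
      exact ⟨m, hj⟩)
  obtain ⟨φ', hφ'⟩ := hVM.exists_hom (G := V') (fun m => res V'.obj (f' m) (y m))
    (fun {m n} e hmn he => by
      obtain ⟨t, ht, -⟩ := hr hmn
      have hyt := hy t hmn ht
      obtain ⟨e', d, h₁, h₂, h₃, h₄⟩ := ht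
      obtain rfl : e = e' := hV.eq_of_res (by rw [he, h₁])
      rw [← res_comp, ← h₃, res_comp, hyt])
  obtain ⟨ψ, hψ⟩ := hUM'.exists_hom (G := V') (fun m => res V'.obj (i' m) (y m))
    (fun {m n} d hmn hd => by
      obtain ⟨t, ht, -⟩ := hr hmn
      have hyt := hy t hmn ht
      obtain ⟨e', d', h₁, h₂, h₃, h₄⟩ := ht
      obtain rfl : d = d' := hU'.eq_of_res (by rw [hd, h₂])
      rw [← res_comp, ← h₄, res_comp, hyt])
  obtain ⟨γ, hγ⟩ := hV'.exists_hom (G := W) (fun m => res W.obj (q' m) (w (k m.1.1)))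
    (fun {m n} t hmn ht => by
      obtain ⟨t', ht', -⟩ := hr hmn
      obtain rfl : t = t' := hV'.eq_of_res (by rw [ht, hy t' hmn ht'])
      obtain ⟨e, d, h₁, h₂, h₃, h₄⟩ := ht'
      refine W.eq_of_res_pushout hE ⟨_, _, _, trivial, (hp m.1.1).confl⟩ (sq m) ?_ ?_
      · rw [← res_comp, ← res_comp, ← res_comp, h₃, Category.assoc, hfq, hfq, res_comp,
          ← (hp _).ap_eq, ← ap_res, h₁, (hp _).ap_eq]
      · rw [← res_comp, ← res_comp, ← res_comp, h₄, Category.assoc, hiq, hiq, comp_zero, zero_res,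
          zero_res])
  refine ⟨V', ψ, φ', γ, hV'.indPresented (fun _ => trivial) ?_,
    isLocExact_of_family hE ψ γ hS (fun m => u' m.1.2) y (fun m => w (k m.1.1)) hUM'.surj
      hV'.surj hV'.inj hWM.surj hWM.inj hψ hγ, hUM.hom_ext (fun m => ?_), hVM.hom_ext (fun m => ?_)⟩
  · refine (Cardinal.mk_subtype_le _).trans ?_
    rw [Cardinal.mk_prod, Cardinal.lift_id, Cardinal.lift_id]
    exact Cardinal.mul_le_of_le hκ (hJ.trans (Cardinal.mul_le_of_le hκ hI hK)) hI'
  · rw [Lex.ap_comp, Lex.ap_comp, ← (hp _).res_eq, ap_res, hφ', ← res_comp, (sq m).w, res_comp,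
      ← hψ, ← ap_res, hs]
  · rw [Lex.ap_comp, hφ', ap_res, hγ, ← res_comp, hfq, (hp _).ap_eq]

end

end IndObjects

end RelTate

namespace RelTate

/-! ### Kernel-cokernel pairs under isomorphisms and fully faithful functors -/

section KernelCokernelPairs

variable {A : Type u} [Category.{v} A] [Preadditive A]

lemma IsKernelCokernelPair.of_iso {S T : ShortComplex A} (e : S ≅ T)
    (hS : IsKernelCokernelPair S) : IsKernelCokernelPair T := by
  rw [isKernelCokernelPair_iff] at *
  obtain ⟨⟨h₁, h₂⟩, ⟨h₃, h₄⟩⟩ := hS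
  have ef : e.inv.τ₁ ≫ S.f = T.f ≫ e.inv.τ₂ := e.inv.comm₁₂
  have eg : e.hom.τ₂ ≫ T.g = S.g ≫ e.hom.τ₃ := e.hom.comm₂₃
  have eg' : e.inv.τ₂ ≫ S.g = T.g ≫ e.inv.τ₃ := e.inv.comm₂₃
  have ef' : e.hom.τ₁ ≫ T.f = S.f ≫ e.hom.τ₂ := e.hom.comm₁₂
  have i₂ : e.inv.τ₂ ≫ e.hom.τ₂ = 𝟙 _ := by rw [← ShortComplex.comp_τ₂, e.inv_hom_id]; rfl
  refine ⟨⟨?_, fun X k hk => ?_⟩, ⟨?_, fun X k hk => ?_⟩⟩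
  · have : Mono (T.f ≫ e.inv.τ₂) := by rw [← ef]; infer_instance
    exact mono_of_mono T.f e.inv.τ₂
  · obtain ⟨l, hl⟩ := h₂ X (k ≫ e.inv.τ₂) (by rw [Category.assoc, eg', reassoc_of% hk, zero_comp])
    exact ⟨l ≫ e.hom.τ₁, by rw [Category.assoc, ef', reassoc_of% hl, i₂, Category.comp_id]⟩
  · have : Epi (e.hom.τ₂ ≫ T.g) := by rw [eg]; infer_instance
    exact epi_of_epi e.hom.τ₂ T.g
  · obtain ⟨l, hl⟩ := h₄ X (e.hom.τ₂ ≫ k) (by rw [← reassoc_of% ef', hk, comp_zero])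
    exact ⟨e.inv.τ₃ ≫ l, by rw [← reassoc_of% eg', hl, reassoc_of% i₂]⟩

lemma IsKernelCokernelPair.of_map {B : Type u'} [Category.{v'} B] [Preadditive B] (F : A ⥤ B)
    [F.Full] [F.Faithful] [F.PreservesZeroMorphisms] {S : ShortComplex A}
    (hS : IsKernelCokernelPair (S.map F)) : IsKernelCokernelPair S := by
  rw [isKernelCokernelPair_iff] at *
  obtain ⟨⟨h₁, h₂⟩, ⟨h₃, h₄⟩⟩ := hS
  refine ⟨⟨F.mono_of_mono_map h₁, fun X k hk => ?_⟩, ⟨F.epi_of_epi_map h₃, fun X k hk => ?_⟩⟩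
  · obtain ⟨l, hl⟩ : ∃ l : F.obj X ⟶ F.obj S.X₁, l ≫ F.map S.f = F.map k := h₂ _ (F.map k) (by
      refine (F.map_comp k S.g).symm.trans ?_
      rw [hk, F.map_zero]
      rfl)
    exact ⟨F.preimage l, F.map_injective (by rw [F.map_comp, F.map_preimage]; exact hl)⟩
  · obtain ⟨l, hl⟩ : ∃ l : F.obj S.X₃ ⟶ F.obj X, F.map S.g ≫ l = F.map k := h₄ _ (F.map k) (by
      refine (F.map_comp S.f k).symm.trans ?_
      rw [hk, F.map_zero]
      rfl)
    exact ⟨F.preimage l, F.map_injective (by rw [F.map_comp, F.map_preimage]; exact hl)⟩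

end KernelCokernelPairs

/-! ### Pushouts and pullbacks of left exact presheaves -/

section LocExact

open Opposite

variable {A : Type u} [Category.{v} A] [Preadditive A] {E : ObjectProperty (ShortComplex A)}

lemma indConfl_iff (hE : IsExactStructure E) {κ : Cardinal.{w}} {Q : ObjectProperty A}
    {S : ShortComplex (IndRel κ E Q)} :
    indConfl κ E Q S ↔ IsLocExact E S.f.hom.hom S.g.hom.hom :=
  isKernelCokernelPair_lex_iff hE

lemma indConfl_of_isLocExact (hE : IsExactStructure E) {κ : Cardinal.{w}} {Q : ObjectProperty A}
    {X Y Z : IndRel κ E Q} {f : X ⟶ Y} {g : Y ⟶ Z} (h : IsLocExact E f.hom.hom g.hom.hom) :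
    ∃ h' : f ≫ g = 0, indConfl κ E Q (.mk f g h') :=
  ⟨ObjectProperty.hom_ext _ (Lex.hom_ext h.zero), (indConfl_iff hE).2 h⟩

lemma isLocExact_id_zero (hE : IsExactStructure E) {F Z : Lex E} (hZ : IsZero Z) :
    IsLocExact E (InducedCategory.Hom.hom (𝟙 F)) (InducedCategory.Hom.hom (0 : F ⟶ Z)) where
  inj x hx := hx
  zero x := rfl
  mid y _ := ⟨y, rfl⟩
  surj {X} z := ⟨X, 𝟙 X, 0, hE.id_admEpi X, by
    have e := Lex.congr_ap (hZ.eq_of_src (𝟙 Z) 0) z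
    rw [Lex.ap_id, Lex.ap_zero_hom] at e
    rw [e, res_zero, ap_zero]⟩

lemma isLocExact_zero_id (hE : IsExactStructure E) {F Z : Lex E} (hZ : IsZero Z) :
    IsLocExact E (InducedCategory.Hom.hom (0 : Z ⟶ F)) (InducedCategory.Hom.hom (𝟙 F)) where
  inj x _ := by
    have e := Lex.congr_ap (hZ.eq_of_src (𝟙 Z) 0) x
    rwa [Lex.ap_id, Lex.ap_zero_hom] at e
  zero x := rfl
  mid y hy := ⟨0, by rw [ap_zero]; exact hy.symm⟩
  surj {X} z := ⟨X, 𝟙 X, z, hE.id_admEpi X, by rw [res_id, Lex.ap_id]⟩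

lemma isLocExact_inl_snd (hE : IsExactStructure E) (F G : Lex E) :
    IsLocExact E (InducedCategory.Hom.hom (biprod.inl : F ⟶ F ⊞ G))
      (InducedCategory.Hom.hom (biprod.snd : F ⊞ G ⟶ G)) := by
  have e₁ : ∀ {X : A} (x : F.obj.obj (op X)), ap (biprod.fst : F ⊞ G ⟶ F).hom
      (ap (biprod.inl : F ⟶ F ⊞ G).hom x) = x := fun x => by
    rw [← Lex.ap_comp, biprod.inl_fst, Lex.ap_id]
  have e₂ : ∀ {X : A} (x : G.obj.obj (op X)), ap (biprod.snd : F ⊞ G ⟶ G).hom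
      (ap (biprod.inr : G ⟶ F ⊞ G).hom x) = x := fun x => by
    rw [← Lex.ap_comp, biprod.inr_snd, Lex.ap_id]
  have e : ∀ {X : A} (z : (F ⊞ G : Lex E).obj.obj (op X)),
      z = ap (biprod.inl : F ⟶ F ⊞ G).hom (ap (biprod.fst : F ⊞ G ⟶ F).hom z) +
        ap (biprod.inr : G ⟶ F ⊞ G).hom (ap (biprod.snd : F ⊞ G ⟶ G).hom z) := fun z => by
    rw [← Lex.ap_comp, ← Lex.ap_comp, ← Lex.ap_add_hom, biprod.total, Lex.ap_id]
  refine ⟨fun x hx => ?_, fun x => ?_, fun y hy => ?_, fun {X} z => ?_⟩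
  · rw [← e₁ x, hx, ap_zero]
  · rw [← Lex.ap_comp, biprod.inl_snd, Lex.ap_zero_hom]
  · refine ⟨ap (biprod.fst : F ⊞ G ⟶ F).hom y, ?_⟩
    conv_rhs => rw [e y]
    rw [hy, ap_zero, add_zero]
  · exact ⟨X, 𝟙 X, ap (biprod.inr : G ⟶ F ⊞ G).hom z, hE.id_admEpi X, by rw [e₂, res_id]⟩

/-- Composition of monomorphisms, given the pushout of the second one. -/
lemma IsLocExact.comp_mono (hE : IsExactStructure E) {U V W V₂ W₂ V' : Lex E} {f : U ⟶ V}
    {φ : V ⟶ W} (h₁ : IsLocExact E f.hom φ.hom) {g : V ⟶ V₂} {p : V₂ ⟶ W₂}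
    (h₂ : IsLocExact E g.hom p.hom) {f' : W ⟶ V'} {g' : V' ⟶ W₂}
    (h₃ : IsLocExact E f'.hom g'.hom) {φ' : V₂ ⟶ V'} (w₁ : g ≫ φ' = φ ≫ f') (w₂ : φ' ≫ g' = p) :
    IsLocExact E (f ≫ g).hom φ'.hom := by
  have c₁ : ∀ {X : A} (x : V.obj.obj (op X)), ap φ'.hom (ap g.hom x) = ap f'.hom (ap φ.hom x) :=
    fun x => Lex.congr_ap w₁ x
  have c₂ : ∀ {X : A} (x : V₂.obj.obj (op X)), ap g'.hom (ap φ'.hom x) = ap p.hom x :=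
    fun x => Lex.congr_ap w₂ x
  refine ⟨fun x hx => h₁.inj _ (h₂.inj _ hx), fun x => ?_, fun y hy => ?_, fun {X} z => ?_⟩
  · rw [Lex.ap_comp, c₁, h₁.zero, ap_zero]
  · obtain ⟨y, rfl⟩ := h₂.mid y (by rw [← c₂, hy, ap_zero])
    rw [c₁] at hy
    obtain ⟨x, rfl⟩ := h₁.mid y (h₃.inj _ hy)
    exact ⟨x, rfl⟩
  · obtain ⟨X₁, q, y, hq, hy⟩ := h₂.surj (ap g'.hom z)
    obtain ⟨x, hx⟩ := h₃.mid (res _ q z - ap φ'.hom y) (by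
      rw [ap_sub, c₂, hy, ap_res, sub_self])
    obtain ⟨X₂, r, t, hr, ht⟩ := h₁.surj x
    refine ⟨X₂, r ≫ q, ap g.hom t + res _ r y, hE.comp_admEpi _ _ hr hq, ?_⟩
    rw [ap_add, c₁, ht, ap_res, hx, ap_res, res_sub, res_comp]
    abel

/-- A morphism of exact sequences that is the identity on the last terms gives an exact
sequence. -/
lemma IsLocExact.pushout (hE : IsExactStructure E) {U V W U' V' : Lex E} {f : U ⟶ V}
    {g : V ⟶ W} (h : IsLocExact E f.hom g.hom) {f' : U' ⟶ V'} {g' : V' ⟶ W}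
    (h' : IsLocExact E f'.hom g'.hom) {φ : U ⟶ U'} {φ' : V ⟶ V'} (w₁ : f ≫ φ' = φ ≫ f')
    (w₂ : φ' ≫ g' = g) : IsPushout f φ φ' f' := by
  have c₁ : ∀ {X : A} (x : U.obj.obj (op X)), ap φ'.hom (ap f.hom x) = ap f'.hom (ap φ.hom x) :=
    fun x => Lex.congr_ap w₁ x
  have c₂ : ∀ {X : A} (x : V.obj.obj (op X)), ap g'.hom (ap φ'.hom x) = ap g.hom x :=
    fun x => Lex.congr_ap w₂ x
  -- The square is a pushout as soon as `V'` is the cokernel of `U → V ⊞ U'`, and this follows from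
  -- local exactness.
  let S : ShortComplex (Lex E) := .mk (biprod.lift f (-φ)) (biprod.desc φ' f') (by simp [w₁])
  have hi : ∀ {X : A} (x : (V ⊞ U' : Lex E).obj.obj (op X)), ap (biprod.desc φ' f').hom x =
      ap φ'.hom (ap (biprod.fst : V ⊞ U' ⟶ V).hom x) +
        ap f'.hom (ap (biprod.snd : V ⊞ U' ⟶ U').hom x) := fun x => by
    rw [biprod.desc_eq, Lex.ap_add_hom, Lex.ap_comp, Lex.ap_comp]
  have hb : ∀ {X : A} (x : (V ⊞ U' : Lex E).obj.obj (op X)),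
      x = ap (biprod.inl : V ⟶ V ⊞ U').hom (ap (biprod.fst : V ⊞ U' ⟶ V).hom x) +
        ap (biprod.inr : U' ⟶ V ⊞ U').hom (ap (biprod.snd : V ⊞ U' ⟶ U').hom x) := fun x => by
    rw [← Lex.ap_comp, ← Lex.ap_comp, ← Lex.ap_add_hom, biprod.total, Lex.ap_id]
  have hl : ∀ {X : A} (x : U.obj.obj (op X)), ap (biprod.lift f (-φ)).hom x =
      ap (biprod.inl : V ⟶ V ⊞ U').hom (ap f.hom x) +
        ap (biprod.inr : U' ⟶ V ⊞ U').hom (-(ap φ.hom x)) := fun x => by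
    rw [biprod.lift_eq, Lex.ap_add_hom, Lex.ap_comp, Lex.ap_comp]
    rfl
  have hS : IsKernelCokernelPair S := isKernelCokernelPair_of_isLocExact hE (by
    refine ⟨fun x hx => ?_, fun x => Lex.congr_ap S.zero x, fun x hx => ?_, fun {X} z => ?_⟩
    · have e : biprod.lift f (-φ) ≫ biprod.fst = f := by simp
      have := Lex.congr_ap e x
      rw [Lex.ap_comp] at this
      exact h.inj _ (by rw [← this]; exact (congrArg _ hx).trans (ap_zero _))
    · change ap (biprod.desc φ' f').hom x = 0 at hx
      rw [hi] at hx
      obtain ⟨u, hu⟩ := h.mid (ap (biprod.fst : V ⊞ U' ⟶ V).hom x) (by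
        have := congrArg (ap g'.hom) hx
        rwa [ap_add, c₂, h'.zero, add_zero, ap_zero] at this)
      refine ⟨u, ?_⟩
      change ap (biprod.lift f (-φ)).hom u = x
      have e : -(ap φ.hom u) = ap (biprod.snd : V ⊞ U' ⟶ U').hom x := by
        apply h'.eq_of_ap_eq
        rw [ap_neg, ← c₁, hu]
        exact neg_eq_of_add_eq_zero_right hx
      rw [hl, hu, e, ← hb]
    · obtain ⟨Y, p, y, hp, hy⟩ := h.surj (ap g'.hom z)
      obtain ⟨u, hu⟩ := h'.mid (res _ p z - ap φ'.hom y) (by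
        rw [ap_sub, c₂, hy, ap_res, sub_self])
      refine ⟨Y, p, ap (biprod.inl : V ⟶ V ⊞ U').hom y + ap (biprod.inr : U' ⟶ V ⊞ U').hom u,
        hp, ?_⟩
      change ap (biprod.desc φ' f').hom _ = _
      rw [ap_add, ← Lex.ap_comp, ← Lex.ap_comp, biprod.inl_desc, biprod.inr_desc, hu]
      abel)
  obtain ⟨-, ⟨hepi, hd⟩⟩ := (isKernelCokernelPair_iff S).1 hS
  have key : ∀ s : PushoutCocone f φ, ∃ l : V' ⟶ s.pt, biprod.desc φ' f' ≫ l =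
      biprod.desc s.inl s.inr := fun s => hd _ (biprod.desc s.inl s.inr) (by
    change biprod.lift f (-φ) ≫ _ = 0
    rw [biprod.lift_desc, s.condition, Preadditive.neg_comp, add_neg_cancel])
  choose l hl' using key
  exact
    { w := w₁
      isColimit' := ⟨PushoutCocone.IsColimit.mk _ l
        (fun s => by simpa using congrArg (fun t => biprod.inl ≫ t) (hl' s))
        (fun s => by simpa using congrArg (fun t => biprod.inr ≫ t) (hl' s))
        (fun s m h₁ h₂ => by
          have : Epi (biprod.desc φ' f') := hepi
          rw [← cancel_epi (biprod.desc φ' f'), hl']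
          apply biprod.hom_ext' <;> simp [h₁, h₂])⟩ }

/-- `N` is the kernel of `V ⊞ T → W`. Its sections are described besides the universal property,
since local exactness is checked on sections. -/
lemma Lex.exists_pullback {V W T : Lex E} (g : V ⟶ W) (c : T ⟶ W) :
    ∃ (N : Lex E) (a : N ⟶ V) (b : N ⟶ T), IsPullback a b g c ∧
      (∀ {X : A} (x : N.obj.obj (op X)), ap a.hom x = 0 → ap b.hom x = 0 → x = 0) ∧
      ∀ {X : A} (y : V.obj.obj (op X)) (t : T.obj.obj (op X)), ap g.hom y = ap c.hom t →
        ∃ n, ap a.hom n = y ∧ ap b.hom n = t := by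
  obtain ⟨N, ι, h₁, h₂⟩ := Lex.exists_kernel (biprod.desc g (-c))
  have hm : Mono ι := ⟨fun s t hst => Lex.hom_ext (fun x => by
    rw [← sub_eq_zero]
    refine h₁ _ ?_
    rw [ap_sub, sub_eq_zero]
    exact Lex.congr_ap hst x)⟩
  have hw : (ι ≫ biprod.fst) ≫ g = (ι ≫ biprod.snd) ≫ c := by
    have : ι ≫ biprod.desc g (-c) = 0 := Lex.hom_ext (fun x => (h₂ _).2 ⟨x, rfl⟩)
    rw [biprod.desc_eq, Preadditive.comp_add] at this
    simpa [← sub_eq_add_neg, sub_eq_zero] using this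
  have key : ∀ s : PullbackCone g c, ∃ l : s.pt ⟶ N, l ≫ ι = biprod.lift s.fst s.snd := fun s =>
    Lex.exists_lift ι h₁ _ (fun x => (h₂ _).1 (by
      rw [← Lex.ap_comp, biprod.lift_desc, s.condition, Preadditive.comp_neg, add_neg_cancel,
        Lex.ap_zero_hom]))
  choose l hl using key
  refine ⟨N, ι ≫ biprod.fst, ι ≫ biprod.snd,
    { w := hw
      isLimit' := ⟨PullbackCone.IsLimit.mk _ l (fun s => by rw [reassoc_of% hl, biprod.lift_fst])
        (fun s => by rw [reassoc_of% hl, biprod.lift_snd])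
        (fun s m e₁ e₂ => by
          rw [← cancel_mono ι, hl]
          exact biprod.hom_ext _ _ (by rw [Category.assoc, e₁, biprod.lift_fst])
            (by rw [Category.assoc, e₂, biprod.lift_snd]))⟩ },
    fun x hx hx' => h₁ _ ?_, fun y t hyt => ?_⟩
  · have e : ap ι.hom x = ap (biprod.inl : V ⟶ V ⊞ T).hom (ap (biprod.fst : V ⊞ T ⟶ V).hom
        (ap ι.hom x)) + ap (biprod.inr : T ⟶ V ⊞ T).hom (ap (biprod.snd : V ⊞ T ⟶ T).hom
        (ap ι.hom x)) := by
      rw [← Lex.ap_comp biprod.fst, ← Lex.ap_comp biprod.snd, ← Lex.ap_add_hom, biprod.total,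
        Lex.ap_id]
    rw [Lex.ap_comp] at hx hx'
    rw [e, hx, hx', ap_zero, ap_zero, add_zero]
  · obtain ⟨n, hn⟩ := (h₂ (ap (biprod.inl : V ⟶ V ⊞ T).hom y +
        ap (biprod.inr : T ⟶ V ⊞ T).hom t)).1 (by
      rw [ap_add, ← Lex.ap_comp, ← Lex.ap_comp, biprod.inl_desc, biprod.inr_desc, hyt]
      exact add_neg_cancel _)
    refine ⟨n, ?_, ?_⟩
    · rw [Lex.ap_comp, hn, ap_add, ← Lex.ap_comp, ← Lex.ap_comp, biprod.inl_fst, biprod.inr_fst,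
        Lex.ap_id, Lex.ap_zero_hom, add_zero]
    · rw [Lex.ap_comp, hn, ap_add, ← Lex.ap_comp, ← Lex.ap_comp, biprod.inl_snd, biprod.inr_snd,
        Lex.ap_id, Lex.ap_zero_hom, zero_add]

end LocExact

/-! ### The exact structure on Ind objects -/

section IndExact

open Opposite

variable {A : Type u} [Category.{v} A] [Preadditive A] {E : ObjectProperty (ShortComplex A)}
  {κ : Cardinal.{w}} {Q : ObjectProperty A}

lemma lexYoneda_indPresented (hκ : Cardinal.aleph0 ≤ κ) (hE : IsExactStructure E)
    (hQ : IsExtensionClosed E Q) (X : A) : indPresented κ E ⊤ Q ((lexYoneda hE).obj X) :=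
  yoneda_indPresented hκ (fun _ hS => (hE.isKernelCokernelPair hS).2)
    (fun _ => hQ.monoCokerIn_of_isIso hE _) X trivial

variable [UnivLE.{w, v}]

/-- Admissible Ind objects form an exact category. -/
theorem isExactStructure_indConfl (hκ : Cardinal.aleph0 ≤ κ) (hE : IsExactStructure E)
    (hQ : IsExtensionClosed E Q) : IsExactStructure (indConfl κ E Q) := by
  obtain ⟨Z₀, hZ₀⟩ := hE.hasZeroObject
  let Z : IndRel κ E Q := ⟨(lexYoneda hE).obj Z₀, lexYoneda_indPresented hκ hE hQ Z₀⟩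
  have hZ' : IsZero Z.obj := lexYoneda_isZero hE hZ₀
  have hZ : IsZero Z := by
    rw [IsZero.iff_id_eq_zero]
    exact ObjectProperty.hom_ext _ (hZ'.eq_of_src _ _)
  -- Pushouts made from charts serve both the pushout axiom and the composition of admissible
  -- monomorphisms.
  have pushout_aux : ∀ {X Y X' : IndRel κ E Q} (i : X ⟶ Y) (f : X ⟶ X'),
      admMono (indConfl κ E Q) i → ∃ (W Y' : IndRel κ E Q) (g : Y ⟶ W) (f' : Y ⟶ Y')
        (i' : X' ⟶ Y') (g' : Y' ⟶ W), i ≫ f' = f ≫ i' ∧ f' ≫ g' = g ∧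
          IsLocExact E i.hom.hom g.hom.hom ∧ IsLocExact E i'.hom.hom g'.hom.hom := by
    rintro X Y X' i f ⟨W, g, h, -, hS⟩
    have hx := (indConfl_iff hE).1 hS
    obtain ⟨V', i', f', g', hV', hx', w₁, w₂⟩ :=
      exists_pushout_lex hκ hE hQ hx X.property W.property f.hom X'.property
    exact ⟨W, ⟨V', hV'⟩, g, ObjectProperty.homMk f', ObjectProperty.homMk i',
      ObjectProperty.homMk g', ObjectProperty.hom_ext _ w₁, ObjectProperty.hom_ext _ w₂, hx, hx'⟩
  refine
  { hasZeroObject := ⟨Z, hZ⟩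
    hasBinaryBiproducts := hasBinaryBiproducts_fullSubcategory _ (fun F G hF hG =>
      indPresented_of_isLocExact hκ hE hQ (isLocExact_inl_snd hE F G) hF hG)
    of_iso := fun e hS => hS.of_iso ((IndRel.toLex κ E Q).mapShortComplex.mapIso e)
    isKernelCokernelPair := fun hS => IsKernelCokernelPair.of_map (IndRel.toLex κ E Q) hS
    id_admMono := fun X => ?_
    id_admEpi := fun X => ?_
    comp_admMono := ?_
    comp_admEpi := ?_
    pushout_admMono := ?_
    pullback_admEpi := ?_ }
  · obtain ⟨h, hS⟩ := indConfl_of_isLocExact hE (f := 𝟙 X) (g := (0 : X ⟶ Z))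
      (isLocExact_id_zero hE hZ')
    exact ⟨_, _, h, trivial, hS⟩
  · obtain ⟨h, hS⟩ := indConfl_of_isLocExact hE (f := (0 : Z ⟶ X)) (g := 𝟙 X)
      (isLocExact_zero_id hE hZ')
    exact ⟨_, _, h, trivial, hS⟩
  -- The cokernel of `f ≫ g` is the pushout of `V` along the cokernel `p : Y → W` of `f`.
  · rintro X Y V f g ⟨W, p, hp, -, hS⟩ hg
    obtain ⟨W₂, V', q, φ', i', g', w₁, w₂, hx, hx'⟩ := pushout_aux g p hg
    obtain ⟨h, hS'⟩ := indConfl_of_isLocExact hE (f := f ≫ g) (g := φ')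
      (((indConfl_iff hE).1 hS).comp_mono hE hx hx' (congrArg InducedCategory.Hom.hom w₁)
        (congrArg InducedCategory.Hom.hom w₂))
    exact ⟨_, _, h, trivial, hS'⟩
  -- The kernel of `f ≫ g` is the preimage `N` of the kernel `U₂` of `g`. It is an extension of `U₂`
  -- by `U`, hence an Ind object.
  · rintro V W T f g ⟨U, i, hi, -, hS⟩ ⟨U₂, j, hj, -, hT⟩
    rw [indConfl_iff hE] at hS hT
    obtain ⟨N, a, b, sq, h₁, h₂⟩ := Lex.exists_pullback f.hom j.hom
    have haj : ∀ {X : A} (x : N.obj.obj (op X)), ap f.hom.hom (ap a.hom x) =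
        ap j.hom.hom (ap b.hom x) := fun x => Lex.congr_ap sq.w x
    let k : U.obj ⟶ N := sq.lift i.hom 0 (by
      rw [zero_comp]
      exact Lex.hom_ext hS.zero)
    have hka : ∀ {X : A} (x : U.obj.obj.obj (op X)), ap a.hom (ap k.hom x) = ap i.hom.hom x :=
      fun x => Lex.congr_ap (sq.lift_fst _ _ _) x
    have hkb : ∀ {X : A} (x : U.obj.obj.obj (op X)), ap b.hom (ap k.hom x) = 0 :=
      fun x => Lex.congr_ap (sq.lift_snd _ _ _) x
    have hN : IsLocExact E k.hom b.hom := by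
      refine ⟨fun x hx => hS.inj _ (by rw [← hka, hx, ap_zero]), hkb, fun y hy => ?_,
        fun {X} z => ?_⟩
      · obtain ⟨x, hx⟩ := hS.mid (ap a.hom y) (by
          change ap f.hom.hom _ = 0
          rw [haj, hy, ap_zero])
        refine ⟨x, ?_⟩
        rw [← sub_eq_zero]
        exact h₁ _ (by rw [ap_sub, hka, sub_eq_zero]; exact hx) (by rw [ap_sub, hkb, hy, sub_self])
      · obtain ⟨X', p, y, hp, hy⟩ := hS.surj (ap j.hom.hom z)
        obtain ⟨n, -, hn⟩ := h₂ y (res _ p z) (by rw [ap_res]; exact hy)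
        exact ⟨X', p, n, hp, hn⟩
    have hNi := indPresented_of_isLocExact hκ hE hQ hN U.property U₂.property
    let N' : IndRel κ E Q := ⟨N, hNi⟩
    obtain ⟨h, hS'⟩ := indConfl_of_isLocExact hE (X := N') (f := ObjectProperty.homMk a)
      (g := f ≫ g) (by
        refine ⟨fun x hx => h₁ _ hx (hT.inj _ ?_), fun x => ?_, fun y hy => ?_, fun {X} z => ?_⟩
        · change ap j.hom.hom _ = 0
          rw [← haj]
          exact (congrArg _ hx).trans (ap_zero _)
        · change ap g.hom.hom (ap f.hom.hom (ap a.hom x)) = 0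
          rw [haj]
          exact hT.zero _
        · obtain ⟨t, ht⟩ := hT.mid (ap f.hom.hom y) hy
          obtain ⟨n, hn, -⟩ := h₂ y t ht.symm
          exact ⟨n, hn⟩
        · obtain ⟨X', p, y, hp, hy⟩ := hT.surj z
          obtain ⟨X₂, q, x, hq, hx⟩ := hS.surj y
          refine ⟨X₂, q ≫ p, x, hE.comp_admEpi _ _ hq hp, ?_⟩
          change ap g.hom.hom (ap f.hom.hom x) = _
          refine (congrArg _ hx).trans ?_
          rw [ap_res, res_comp]
          exact congrArg _ hy)
    exact ⟨_, _, h, trivial, hS'⟩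
  · intro X Y X' i f hi
    obtain ⟨W, Y', g, f', i', g', w₁, w₂, hx, hx'⟩ := pushout_aux i f hi
    have sq := IsLocExact.pushout hE hx hx' (congrArg InducedCategory.Hom.hom w₁)
      (congrArg InducedCategory.Hom.hom w₂)
    obtain ⟨h, hS'⟩ := indConfl_of_isLocExact hE hx'
    exact ⟨Y', f', i', IsPushout.of_map (IndRel.toLex κ E Q) w₁ sq, _, _, h, trivial, hS'⟩
  -- The pullback taken in left exact presheaves is an extension of `T` by `U`, hence an Ind object.
  · rintro V W T g c ⟨U, i, hi, -, hS⟩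
    rw [indConfl_iff hE] at hS
    obtain ⟨N, a, b, sq, h₁, h₂⟩ := Lex.exists_pullback g.hom c.hom
    have haj : ∀ {X : A} (x : N.obj.obj (op X)), ap g.hom.hom (ap a.hom x) =
        ap c.hom.hom (ap b.hom x) := fun x => Lex.congr_ap sq.w x
    let k : U.obj ⟶ N := sq.lift i.hom 0 (by
      rw [zero_comp]
      exact Lex.hom_ext hS.zero)
    have hka : ∀ {X : A} (x : U.obj.obj.obj (op X)), ap a.hom (ap k.hom x) = ap i.hom.hom x :=
      fun x => Lex.congr_ap (sq.lift_fst _ _ _) x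
    have hkb : ∀ {X : A} (x : U.obj.obj.obj (op X)), ap b.hom (ap k.hom x) = 0 :=
      fun x => Lex.congr_ap (sq.lift_snd _ _ _) x
    have hN : IsLocExact E k.hom b.hom := by
      refine ⟨fun x hx => hS.inj _ (by rw [← hka, hx, ap_zero]), hkb, fun y hy => ?_,
        fun {X} z => ?_⟩
      · obtain ⟨x, hx⟩ := hS.mid (ap a.hom y) (by
          change ap g.hom.hom _ = 0
          rw [haj, hy, ap_zero])
        refine ⟨x, ?_⟩
        rw [← sub_eq_zero]
        exact h₁ _ (by rw [ap_sub, hka, sub_eq_zero]; exact hx) (by rw [ap_sub, hkb, hy, sub_self])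
      · obtain ⟨X', p, y, hp, hy⟩ := hS.surj (ap c.hom.hom z)
        obtain ⟨n, -, hn⟩ := h₂ y (res _ p z) (by rw [ap_res]; exact hy)
        exact ⟨X', p, n, hp, hn⟩
    have hNi := indPresented_of_isLocExact hκ hE hQ hN U.property T.property
    let N' : IndRel κ E Q := ⟨N, hNi⟩
    obtain ⟨h, hS'⟩ := indConfl_of_isLocExact hE (Y := N') (Z := T) (f := ObjectProperty.homMk k)
      (g := ObjectProperty.homMk b) hN
    exact ⟨N', ObjectProperty.homMk a, ObjectProperty.homMk b,
      IsPullback.of_map (IndRel.toLex κ E Q) (ObjectProperty.hom_ext _ sq.w) sq,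
      _, _, h, trivial, hS'⟩

end IndExact

end RelTate

namespace RelTate

/-! ### Representables among Ind objects -/

section IndYoneda

open Opposite

variable {A : Type u} [Category.{v} A] [Preadditive A] {E : ObjectProperty (ShortComplex A)}
  {κ : Cardinal.{w}} {Q : ObjectProperty A}

lemma lexYoneda_isLocExact (hE : IsExactStructure E) {X Y Z : A} {f : X ⟶ Y} {g : Y ⟶ Z}
    {h : f ≫ g = 0} (hS : E (.mk f g h)) :
    IsLocExact E ((lexYoneda hE).map f).hom ((lexYoneda hE).map g).hom where
  inj {T} x hx := by
    have := hE.mono hS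
    exact (cancel_mono f).1 ((show lunsec hE x ≫ f = 0 from hx).trans zero_comp.symm)
  zero {T} x := show (lunsec hE x ≫ f) ≫ g = 0 by rw [Category.assoc, h, comp_zero]
  mid {T} y hy := hE.lift hS (lunsec hE y) hy
  surj {T} z := by
    obtain ⟨Y', f', p', i', h', sq, e, hS'⟩ := hE.exists_pullback hS (lunsec hE z)
    exact ⟨Y', p', lsec hE f', IsExactStructure.admEpi_of_confl hS' trivial, sq.w⟩

/-- The inclusion of an exact category into the category of its admissible Ind objects. -/
abbrev indYoneda (hκ : Cardinal.aleph0 ≤ κ) (hE : IsExactStructure E)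
    (hQ : IsExtensionClosed E Q) : A ⥤ IndRel κ E Q :=
  toInd hκ (fun _ hS => (hE.isKernelCokernelPair hS).2) (fun _ => hQ.monoCokerIn_of_isIso hE _)

/-- The morphism from a representable Ind object defined by a section. -/
def indElt (hκ : Cardinal.aleph0 ≤ κ) (hE : IsExactStructure E) (hQ : IsExtensionClosed E Q)
    (V : IndRel κ E Q) {X : A} (y : V.obj.obj.obj (op X)) : (indYoneda hκ hE hQ).obj X ⟶ V :=
  ObjectProperty.homMk (V.obj.elt hE y)

variable (hκ : Cardinal.aleph0 ≤ κ) (hE : IsExactStructure E) (hQ : IsExtensionClosed E Q)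

lemma exists_indElt {V : IndRel κ E Q} {X : A} (φ : (indYoneda hκ hE hQ).obj X ⟶ V) :
    ∃ y, indElt hκ hE hQ V y = φ :=
  ⟨_, ObjectProperty.hom_ext _ (Lex.elt_lsec_id hE φ.hom)⟩

lemma indYoneda_map_indElt {V : IndRel κ E Q} {X Y : A} (f : X ⟶ Y) (y : V.obj.obj.obj (op Y)) :
    (indYoneda hκ hE hQ).map f ≫ indElt hκ hE hQ V y = indElt hκ hE hQ V (res V.obj.obj f y) :=
  ObjectProperty.hom_ext _ (Lex.yoneda_map_elt hE f y)

lemma indElt_comp {V W : IndRel κ E Q} {X : A} (x : V.obj.obj.obj (op X)) (φ : V ⟶ W) :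
    indElt hκ hE hQ V x ≫ φ = indElt hκ hE hQ W (ap φ.hom.hom x) :=
  ObjectProperty.hom_ext _ (Lex.elt_comp hE x φ.hom)

lemma indElt_injective {V : IndRel κ E Q} {X : A} {x y : V.obj.obj.obj (op X)}
    (h : indElt hκ hE hQ V x = indElt hκ hE hQ V y) : x = y :=
  Lex.elt_injective hE (congrArg InducedCategory.Hom.hom h)

lemma indElt_lsec {X Y : A} (f : X ⟶ Y) :
    indElt hκ hE hQ ((indYoneda hκ hE hQ).obj Y) (lsec hE f) = (indYoneda hκ hE hQ).map f :=
  ObjectProperty.hom_ext _ (Lex.yoneda_hom_ext hE rfl)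

lemma indYoneda_full : (indYoneda hκ hE hQ).Full where
  map_surjective φ := by
    obtain ⟨y, rfl⟩ := exists_indElt hκ hE hQ φ
    exact ⟨lunsec hE y, (indElt_lsec hκ hE hQ _).symm⟩

lemma indYoneda_faithful : (indYoneda hκ hE hQ).Faithful where
  map_injective {X Y f g} h := by
    rw [← indElt_lsec, ← indElt_lsec] at h
    exact indElt_injective hκ hE hQ h

lemma indYoneda_additive : (indYoneda hκ hE hQ).Additive where
  map_add {X Y f g} := ObjectProperty.hom_ext _ (Lex.yoneda_hom_ext hE
    (show 𝟙 X ≫ (f + g) = 𝟙 X ≫ f + 𝟙 X ≫ g from Preadditive.comp_add _ _ _ _ _ _))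

lemma indYoneda_exact : IsExactFunctor E (indConfl κ E Q) (indYoneda hκ hE hQ) where
  additive := indYoneda_additive hκ hE hQ
  map_mem S hS := (indConfl_iff hE).2 (lexYoneda_isLocExact hE (f := S.f) (g := S.g) hS)

lemma indYoneda_confl {X Y Z : A} {f : X ⟶ Y} {g : Y ⟶ Z} {h : f ≫ g = 0} (hS : E (.mk f g h)) :
    ∃ h' : (indYoneda hκ hE hQ).map f ≫ (indYoneda hκ hE hQ).map g = 0,
      indConfl κ E Q (.mk _ _ h') :=
  indConfl_of_isLocExact hE (lexYoneda_isLocExact hE hS)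

/-- A morphism from a representable object to an admissible Ind object factors through an
admissible monomorphism from a representable object. -/
lemma exists_factor_indYoneda [UnivLE.{w, v}] {X : A} {V : IndRel κ E Q}
    (φ : (indYoneda hκ hE hQ).obj X ⟶ V) :
    ∃ (Y : A) (r : X ⟶ Y) (ψ : (indYoneda hκ hE hQ).obj Y ⟶ V),
      monoCokerIn (indConfl κ E Q) (fun W => indPresented κ E Q Q W.obj) ψ ∧
        (indYoneda hκ hE hQ).map r ≫ ψ = φ := by
  obtain ⟨y, rfl⟩ := exists_indElt hκ hE hQ φ
  obtain ⟨I, _, _, _, Y, x, hI, -, hx⟩ := exists_isPres_of_indPresented hE V.property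
  obtain ⟨i, r, rfl⟩ := hx.surj y
  obtain ⟨W, g, hW, hS⟩ := hx.exists_quotient hE hI i
  have hW' : indPresented κ E ⊤ Q W := by
    obtain ⟨I, a, b, c, X, d, e₁, e₂, e₃, e₄⟩ := hW
    exact ⟨I, a, b, c, X, d, e₁, fun _ => trivial, e₃, e₄⟩
  obtain ⟨h, hS'⟩ := indConfl_of_isLocExact hE (Z := ⟨W, hW'⟩) (f := indElt hκ hE hQ V (x i))
    (g := ObjectProperty.homMk g) hS
  exact ⟨Y i, r, _, ⟨_, _, h, hW, hS'⟩, indYoneda_map_indElt hκ hE hQ _ _⟩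

/-- A conflation of admissible Ind objects that ends with a representable object comes from a
conflation of representable objects by pushout. -/
lemma exists_confl_of_indConfl [UnivLE.{w, v}] {F G : IndRel κ E Q} {Z : A} {f : F ⟶ G}
    {g : G ⟶ (indYoneda hκ hE hQ).obj Z} {h : f ≫ g = 0} (hS : indConfl κ E Q (.mk f g h)) :
    ∃ (X Y : A) (i : X ⟶ Y) (p : Y ⟶ Z) (h' : i ≫ p = 0) (a : (indYoneda hκ hE hQ).obj X ⟶ F)
      (b : (indYoneda hκ hE hQ).obj Y ⟶ G), E (.mk i p h') ∧
        (indYoneda hκ hE hQ).map i ≫ b = a ≫ f ∧ b ≫ g = (indYoneda hκ hE hQ).map p := by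
  obtain ⟨I, _, _, _, Y, x, hI, -, hx⟩ := exists_isPres_of_indPresented hE F.property
  -- The required conflation is a chart over the universal section of `Z`.
  obtain ⟨j, P, i, q, p, hP⟩ := exists_chart hE (f := f.hom) (g := g.hom) ((indConfl_iff hE).1 hS)
    hx (lsec hE (𝟙 Z))
  refine ⟨Y j, P, i, q, hP.zero, indElt hκ hE hQ F (x j), indElt hκ hE hQ G p, hP.confl, ?_, ?_⟩
  · rw [indYoneda_map_indElt, indElt_comp, hP.res_eq]
  · rw [indElt_comp, ← indElt_lsec]
    exact congrArg _ (hP.ap_eq.trans (congrArg (lsec hE) (Category.comp_id q)))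

/-- The representable objects are closed under extensions. -/
lemma exists_iso_of_indConfl [UnivLE.{w, v}] {V : IndRel κ E Q} {X Z : A}
    {f : (indYoneda hκ hE hQ).obj X ⟶ V} {g : V ⟶ (indYoneda hκ hE hQ).obj Z} {h : f ≫ g = 0}
    (hS : indConfl κ E Q (.mk f g h)) :
    ∃ (Y : A) (i : X ⟶ Y) (p : Y ⟶ Z) (h' : i ≫ p = 0), E (.mk i p h') ∧
      Nonempty ((indYoneda hκ hE hQ).obj Y ≅ V) := by
  -- Presenting `X` by a single stage forces a chart over the universal section of `Z` to have the
  -- given ends; its middle term is then isomorphic to `V` by the five lemma.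
  have hx : IsPres E Q ((indYoneda hκ hE hQ).obj X).obj (fun _ : PUnit.{w + 1} => X)
      (fun _ => lsec hE (𝟙 X)) :=
    { inj := fun f hf => (Category.comp_id f).symm.trans hf
      surj := fun y => ⟨PUnit.unit, lunsec hE y, Category.comp_id (lunsec hE y)⟩
      le := fun _ => ⟨𝟙 X, hQ.monoCokerIn_of_isIso hE _, Category.comp_id (𝟙 X)⟩ }
  obtain ⟨j, P, i, q, p, hP⟩ := exists_chart hE (f := f.hom) (g := g.hom) ((indConfl_iff hE).1 hS)
    hx (lsec hE (𝟙 Z))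
  obtain ⟨h', hS'⟩ := indYoneda_confl hκ hE hQ hP.confl
  have : IsIso (indElt hκ hE hQ V p) :=
    (isExactStructure_indConfl hκ hE hQ).isIso_of_confl hS' hS _ (by
      rw [indYoneda_map_indElt, hP.res_eq]
      exact ObjectProperty.hom_ext _ (Lex.elt_lsec_id hE f.hom)) (by
      rw [indElt_comp, ← indElt_lsec]
      exact congrArg _ (hP.ap_eq.trans (congrArg (lsec hE) (Category.comp_id q))))
  exact ⟨P, i, q, hP.zero, hP.confl, ⟨asIso (indElt hκ hE hQ V p)⟩⟩

end IndYoneda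

/-- The properties of a subcategory `P` of an exact category that are used for the construction of
the quotient by `P`. -/
structure IsSplitRightSFiltering {A : Type u} [Category.{v} A] [Preadditive A]
    (E : ObjectProperty (ShortComplex A)) (P : ObjectProperty A) : Prop where
  ext : IsExtensionClosed E P
  filtering : ∀ {Y X : A} (f : Y ⟶ X), P X → ∃ (X' : A) (p : Y ⟶ X') (g : X' ⟶ X),
    P X' ∧ admEpi E p ∧ p ≫ g = f
  special : ∀ {Z G F : A} {a : Z ⟶ G} {b : G ⟶ F} {h : a ≫ b = 0}, E (.mk a b h) → P Z →
    ∃ (Y X : A) (j : Z ⟶ Y) (q : Y ⟶ X) (h' : j ≫ q = 0) (s : G ⟶ Y) (t : F ⟶ X),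
      P Y ∧ P X ∧ E (.mk j q h') ∧ a ≫ s = j ∧ b ≫ t = s ≫ q
  split : ∀ {X : A} (e : X ⟶ X), P X → e ≫ e = e → ∃ (Y : A) (i : Y ⟶ X) (r : X ⟶ Y),
    P Y ∧ i ≫ r = 𝟙 Y ∧ r ≫ i = e

/-! ### Pro objects, and C as a subcategory of Pro(D) -/

section Pro

variable {D : Type u} [Category.{v} D] [Preadditive D] {κ : Cardinal.{w}}
  {E : ObjectProperty (ShortComplex D)}

theorem isExactStructure_proConfl [UnivLE.{w, v}] (hκ : Cardinal.aleph0 ≤ κ)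
    (hE : IsExactStructure E) :
    IsExactStructure (proConfl κ E) :=
  (isExactStructure_indConfl hκ hE.op (isExtensionClosed_top hE.op)).op

variable (hκ : Cardinal.aleph0 ≤ κ) (hE : IsExactStructure E)

lemma toPro_full : (toPro hκ hE).Full where
  map_surjective φ := by
    obtain ⟨f, hf⟩ := (indYoneda_full hκ hE.op (isExtensionClosed_top hE.op)).map_surjective φ.unop
    exact ⟨f.unop, Quiver.Hom.unop_inj hf⟩

lemma toPro_faithful : (toPro hκ hE).Faithful where
  map_injective {X Y f g} h :=
    Quiver.Hom.op_inj ((indYoneda_faithful hκ hE.op (isExtensionClosed_top hE.op)).map_injective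
      (congrArg Quiver.Hom.unop h))

lemma toPro_exact : IsExactFunctor E (proConfl κ E) (toPro hκ hE) where
  additive := ⟨fun {X Y f g} => Quiver.Hom.unop_inj
    ((indYoneda_additive hκ hE.op (isExtensionClosed_top hE.op)).map_add (f := f.op) (g := g.op))⟩
  map_mem S hS := (indYoneda_exact hκ hE.op (isExtensionClosed_top hE.op)).map_mem S.op hS

lemma toPro_confl {X Y Z : D} {f : X ⟶ Y} {g : Y ⟶ Z} {h : f ≫ g = 0} (hS : E (.mk f g h)) :
    ∃ h' : (toPro hκ hE).map f ≫ (toPro hκ hE).map g = 0, proConfl κ E (.mk _ _ h') :=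
  ⟨_, (toPro_exact hκ hE).map_mem (.mk f g h) hS⟩

lemma admEpi_toPro {X Y : D} {f : X ⟶ Y} (hf : admEpi E f) :
    admEpi (proConfl κ E) ((toPro hκ hE).map f) := by
  obtain ⟨K, k, hk, -, hS⟩ := hf
  obtain ⟨h', hS'⟩ := toPro_confl hκ hE hS
  exact IsExactStructure.admEpi_of_confl hS' trivial

lemma IsRightSFiltering.exists_factor {C : ObjectProperty D}
    (hs : IsRightSFiltering (restrict E C) E C.ι) {Y X : D} (hX : C X) (r : Y ⟶ X) :
    ∃ (X' : D) (p : Y ⟶ X') (g : X' ⟶ X), C X' ∧ admEpi E p ∧ p ≫ g = r := by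
  obtain ⟨X', p, g, hp, e⟩ := hs.filtering (X := ⟨X, hX⟩) r
  exact ⟨X'.obj, p, g, X'.property, hp, e⟩

lemma IsRightSFiltering.exists_confl {C : ObjectProperty D}
    (hs : IsRightSFiltering (restrict E C) E C.ι) {Z G F : D} (hZ : C Z) {a : Z ⟶ G} {b : G ⟶ F}
    {h : a ≫ b = 0} (hS : E (.mk a b h)) :
    ∃ (Y X : D) (j : Z ⟶ Y) (q : Y ⟶ X) (h' : j ≫ q = 0) (s : G ⟶ Y) (t : F ⟶ X),
      C Y ∧ C X ∧ E (.mk j q h') ∧ a ≫ s = j ∧ b ≫ t = s ≫ q := by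
  obtain ⟨Y, X, j, q, h', hT, s, t, w₁, w₂⟩ := hs.special (Z := ⟨Z, hZ⟩) a b h hS
  exact ⟨Y.obj, X.obj, j.hom, q.hom, congrArg InducedCategory.Hom.hom h', s, t, Y.property,
    X.property, hT, w₁, w₂⟩

/-- If `D` is idempotent complete, then every retract of an object of a right filtering
subcategory `C` is isomorphic to an object of `C`. -/
lemma exists_split_of_filtering {C : ObjectProperty D} (hE : IsExactStructure E)
    (hD : IsIdempotentComplete D)
    (hs : IsRightSFiltering (restrict E C) E C.ι) {X : D} (hX : C X) (e : X ⟶ X)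
    (he : e ≫ e = e) :
    ∃ (Y : D) (i : Y ⟶ X) (r : X ⟶ Y), C Y ∧ i ≫ r = 𝟙 Y ∧ r ≫ i = e := by
  obtain ⟨Y, i, r, h₁, h₂⟩ := hD.idempotents_split X e he
  -- The split monomorphism `i` factors through the epimorphism `p`, so `p` is a split monomorphism
  -- as well and hence invertible: the image of `e` is the object `X'` of `C`.
  obtain ⟨X', p, g, hX', ⟨K, k, hk, -, hp⟩, hpg⟩ := hs.exists_factor hX i
  have hm : p ≫ g ≫ r = 𝟙 Y := by rw [← h₁, ← hpg, Category.assoc]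
  have := hE.epi hp
  have hm' : (g ≫ r) ≫ p = 𝟙 X' := by
    rw [← cancel_epi p, Category.assoc, reassoc_of% hm]
    exact (Category.comp_id p).symm
  refine ⟨X', g, r ≫ p, hX', ?_, ?_⟩
  · rw [← Category.assoc, hm']
  · rw [← h₂, ← hpg, Category.assoc]

lemma inPro_toPro {C : ObjectProperty D} {X : D} (hX : C X) :
    inPro hκ hE C ((toPro hκ hE).obj X) :=
  ⟨X, hX, ⟨Iso.refl _⟩⟩

lemma subToPro_full (C : ObjectProperty D) : (subToPro hκ hE C).Full := by
  have := toPro_full hκ hE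
  infer_instance

lemma subToPro_faithful (C : ObjectProperty D) : (subToPro hκ hE C).Faithful := by
  have := toPro_faithful hκ hE
  infer_instance

lemma subToPro_exact (C : ObjectProperty D) :
    IsExactFunctor (restrict E C) (proConfl κ E) (subToPro hκ hE C) where
  additive := by
    have := (toPro_exact hκ hE).additive
    infer_instance
  map_mem S hS := (toPro_exact hκ hE).map_mem (S.map C.ι) hS

variable [UnivLE.{w, v}]

/-- A morphism from a Pro object to an object of `D` factors through an admissible epimorphism
to an object of `D`. -/
lemma exists_factor_toPro {V : Pro κ E} {X : D} (φ : V ⟶ (toPro hκ hE).obj X) :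
    ∃ (Y : D) (ψ : V ⟶ (toPro hκ hE).obj Y) (r : Y ⟶ X), admEpi (proConfl κ E) ψ ∧
      ψ ≫ (toPro hκ hE).map r = φ := by
  obtain ⟨Y, r, ψ, hψ, e⟩ := exists_factor_indYoneda hκ hE.op (isExtensionClosed_top hE.op)
    (X := .op X) φ.unop
  refine ⟨Y.unop, ψ.op, r.unop, ?_, Quiver.Hom.unop_inj e⟩
  exact (admEpi_opConfl_iff (E := indConfl κ (opConfl E) ⊤) ψ.op).2
    (IsExactStructure.monoCokerIn_mono le_top hψ)

/-- Dual of `exists_confl_of_indConfl`. It carries a conflation of Pro objects that starts in `D`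
down to `D`, where the specialness of `C` applies. -/
lemma exists_confl_of_proConfl {Z : D} {G F : Pro κ E} {a : (toPro hκ hE).obj Z ⟶ G} {b : G ⟶ F}
    {h : a ≫ b = 0} (hS : proConfl κ E (.mk a b h)) :
    ∃ (Y X : D) (i : Z ⟶ Y) (p : Y ⟶ X) (h' : i ≫ p = 0) (s : G ⟶ (toPro hκ hE).obj Y)
      (t : F ⟶ (toPro hκ hE).obj X), E (.mk i p h') ∧
        a ≫ s = (toPro hκ hE).map i ∧ b ≫ t = s ≫ (toPro hκ hE).map p := by
  obtain ⟨X, Y, i, p, h', s, t, hS', w₁, w₂⟩ :=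
    exists_confl_of_indConfl hκ hE.op (isExtensionClosed_top hE.op) (Z := .op Z)
      (f := b.unop) (g := a.unop) (h := Quiver.Hom.op_inj h) hS
  exact ⟨Y.unop, X.unop, p.unop, i.unop, Quiver.Hom.op_inj h', t.op, s.op, hS',
    Quiver.Hom.unop_inj w₂, Quiver.Hom.unop_inj w₁.symm⟩

lemma exists_iso_of_proConfl {V : Pro κ E} {X Z : D} {f : (toPro hκ hE).obj X ⟶ V}
    {g : V ⟶ (toPro hκ hE).obj Z} {h : f ≫ g = 0} (hS : proConfl κ E (.mk f g h)) :
    ∃ (Y : D) (i : X ⟶ Y) (p : Y ⟶ Z) (h' : i ≫ p = 0), E (.mk i p h') ∧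
      Nonempty ((toPro hκ hE).obj Y ≅ V) := by
  obtain ⟨Y, i, p, h', hS', ⟨e⟩⟩ :=
    exists_iso_of_indConfl hκ hE.op (isExtensionClosed_top hE.op) (X := .op Z) (Z := .op X)
      (f := g.unop) (g := f.unop) (h := Quiver.Hom.op_inj h) hS
  exact ⟨Y.unop, p.unop, i.unop, Quiver.Hom.op_inj h', hS', ⟨e.symm.op⟩⟩

variable {C : ObjectProperty D}

/-- The factorization has two steps: from `V` onto an object of `D`, then from there onto an object
of `C`. -/
lemma exists_filtering_toPro (hs : IsRightSFiltering (restrict E C) E C.ι) {V : Pro κ E} {X : D}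
    (hX : C X) (f : V ⟶ (toPro hκ hE).obj X) :
    ∃ (X' : D) (p : V ⟶ (toPro hκ hE).obj X') (g : X' ⟶ X), C X' ∧ admEpi (proConfl κ E) p ∧
      p ≫ (toPro hκ hE).map g = f := by
  have hE' := isExactStructure_proConfl hκ hE
  obtain ⟨Y, ψ, r, hψ, e⟩ := exists_factor_toPro hκ hE f
  obtain ⟨X', p, g, hX', hp, e'⟩ := hs.exists_factor hX r
  refine ⟨X', ψ ≫ (toPro hκ hE).map p, g, hX', hE'.comp_admEpi _ _ hψ (admEpi_toPro hκ hE hp), ?_⟩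
  rw [← e, ← e', Functor.map_comp, Category.assoc]

/-- Two morphisms of conflations are composed, one from Pro(D) to `D` and one from `D` to `C`; both
are the identity on `Z`. -/
lemma exists_special_toPro (hs : IsRightSFiltering (restrict E C) E C.ι) {Z : D} (hZ : C Z)
    {G F : Pro κ E} {a : (toPro hκ hE).obj Z ⟶ G} {b : G ⟶ F} {h : a ≫ b = 0}
    (hS : proConfl κ E (.mk a b h)) :
    ∃ (Y X : D) (j : Z ⟶ Y) (q : Y ⟶ X) (h' : j ≫ q = 0) (s : G ⟶ (toPro hκ hE).obj Y)
      (t : F ⟶ (toPro hκ hE).obj X), C Y ∧ C X ∧ E (.mk j q h') ∧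
        a ≫ s = (toPro hκ hE).map j ∧ b ≫ t = s ≫ (toPro hκ hE).map q := by
  obtain ⟨Y₁, X₁, i, p, h', s, t, hS', w₁, w₂⟩ := exists_confl_of_proConfl hκ hE hS
  obtain ⟨Y, X, j, q, h'', s', t', hY, hX, hT, w₃, w₄⟩ := hs.exists_confl hZ hS'
  refine ⟨Y, X, j, q, h'', s ≫ (toPro hκ hE).map s', t ≫ (toPro hκ hE).map t', hY, hX, hT, ?_, ?_⟩
  · rw [reassoc_of% w₁, ← Functor.map_comp, w₃]
  · rw [reassoc_of% w₂, ← Functor.map_comp, w₄, Functor.map_comp, Category.assoc]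

theorem isRightSFiltering_subToPro (hs : IsRightSFiltering (restrict E C) E C.ι) :
    IsRightSFiltering (restrict E C) (proConfl κ E) (subToPro hκ hE C) where
  full := subToPro_full hκ hE C
  faithful := subToPro_faithful hκ hE C
  exact := subToPro_exact hκ hE C
  filtering {V X} f := by
    obtain ⟨X', p, g, hX', hp, e⟩ := exists_filtering_toPro hκ hE hs X.property f
    exact ⟨⟨X', hX'⟩, p, (toPro hκ hE).map g, hp, e⟩
  special {Z G F} a b h hS := by
    obtain ⟨Y, X, j, q, h', s, t, hY, hX, hT, w₁, w₂⟩ :=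
      exists_special_toPro hκ hE hs Z.property hS
    exact ⟨⟨Y, hY⟩, ⟨X, hX⟩, ObjectProperty.homMk j, ObjectProperty.homMk q,
      ObjectProperty.hom_ext _ h', hT, s, t, w₁, w₂⟩

/-- An extension of objects of `D` lies in `D` by `exists_iso_of_proConfl`, and then in `C` because
`C` is extension-closed in `D`. -/
lemma inPro_ext (hC : IsExtensionClosed E C) {U V W : Pro κ E} {f : U ⟶ V} {g : V ⟶ W}
    {h : f ≫ g = 0} (hS : proConfl κ E (.mk f g h)) (hU : inPro hκ hE C U)
    (hW : inPro hκ hE C W) : inPro hκ hE C V := by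
  obtain ⟨X, hX, ⟨e⟩⟩ := hU
  obtain ⟨Z, hZ, ⟨e'⟩⟩ := hW
  obtain ⟨h', hS'⟩ := (isExactStructure_proConfl hκ hE).of_isos hS (f' := e.hom ≫ f)
    (g' := g ≫ e'.inv) e.symm (Iso.refl _) e'.symm (by simp) (by simp)
  obtain ⟨Y, i, p, h', hY, ⟨e''⟩⟩ := exists_iso_of_proConfl hκ hE hS'
  exact ⟨Y, hC.ext _ hY hX hZ, ⟨e''⟩⟩

lemma isExtensionClosed_inPro (hC : IsExtensionClosed E C) :
    IsExtensionClosed (proConfl κ E) (inPro hκ hE C) where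
  zero := by
    obtain ⟨Z, hZ, hCZ⟩ := hC.zero
    exact ⟨_, toPro_isZero hκ hE hZ, inPro_toPro hκ hE hCZ⟩
  ext S hS hU hW := inPro_ext hκ hE hC (f := S.f) (g := S.g) (h := S.zero) hS hU hW

lemma exists_special_inPro (hs : IsRightSFiltering (restrict E C) E C.ι) {Z G F : Pro κ E}
    {a : Z ⟶ G} {b : G ⟶ F} {h : a ≫ b = 0} (hS : proConfl κ E (.mk a b h))
    (hZ : inPro hκ hE C Z) :
    ∃ (Y X : Pro κ E) (j : Z ⟶ Y) (q : Y ⟶ X) (h' : j ≫ q = 0) (s : G ⟶ Y) (t : F ⟶ X),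
      inPro hκ hE C Y ∧ inPro hκ hE C X ∧ proConfl κ E (.mk j q h') ∧ a ≫ s = j ∧
        b ≫ t = s ≫ q := by
  obtain ⟨Z', hZ', ⟨e⟩⟩ := hZ
  have hE' := isExactStructure_proConfl hκ hE
  obtain ⟨h₁, hS'⟩ := hE'.of_isos hS (f' := e.hom ≫ a) (g' := b) e.symm (Iso.refl _) (Iso.refl _)
    (by simp) (by simp)
  obtain ⟨Y, X, j, q, h', s, t, hY, hX, hT, w₁, w₂⟩ := exists_special_toPro hκ hE hs hZ' hS'
  obtain ⟨z', hT'⟩ := toPro_confl hκ hE hT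
  obtain ⟨z, hT''⟩ := hE'.of_isos hT' (f' := e.inv ≫ (toPro hκ hE).map j)
    (g' := (toPro hκ hE).map q) e (Iso.refl _) (Iso.refl _) (by simp) (by simp)
  refine ⟨_, _, _, _, z, s, t, inPro_toPro hκ hE hY, inPro_toPro hκ hE hX, hT'', ?_, w₂⟩
  rw [← w₁, Category.assoc, e.inv_hom_id_assoc]

lemma exists_split_inPro (hD : IsIdempotentComplete D)
    (hs : IsRightSFiltering (restrict E C) E C.ι) {V : Pro κ E} (e : V ⟶ V)
    (hV : inPro hκ hE C V) (he : e ≫ e = e) :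
    ∃ (Y : Pro κ E) (i : Y ⟶ V) (r : V ⟶ Y), inPro hκ hE C Y ∧ i ≫ r = 𝟙 Y ∧ r ≫ i = e := by
  obtain ⟨X, hX, ⟨ε⟩⟩ := hV
  obtain ⟨e', he'⟩ := (toPro_full hκ hE).map_surjective (ε.hom ≫ e ≫ ε.inv)
  obtain ⟨Y, i, r, hY, h₁, h₂⟩ := exists_split_of_filtering hE hD hs hX e' (by
    apply (toPro_faithful hκ hE).map_injective
    rw [Functor.map_comp, he', Category.assoc, Category.assoc, ε.inv_hom_id_assoc,
      reassoc_of% he])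
  refine ⟨_, (toPro hκ hE).map i ≫ ε.hom, ε.inv ≫ (toPro hκ hE).map r, inPro_toPro hκ hE hY,
    ?_, ?_⟩
  · rw [Category.assoc, ε.hom_inv_id_assoc, ← Functor.map_comp, h₁, CategoryTheory.Functor.map_id]
  · rw [Category.assoc, ← Functor.map_comp_assoc, h₂, he', Category.assoc, Category.assoc,
      ε.inv_hom_id, Category.comp_id, ε.inv_hom_id_assoc]

lemma exists_filtering_inPro (hs : IsRightSFiltering (restrict E C) E C.ι) {Y X : Pro κ E}
    (f : Y ⟶ X) (hX : inPro hκ hE C X) : ∃ (X' : Pro κ E) (p : Y ⟶ X') (g : X' ⟶ X),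
      inPro hκ hE C X' ∧ admEpi (proConfl κ E) p ∧ p ≫ g = f := by
  obtain ⟨X', hX', ⟨e⟩⟩ := hX
  obtain ⟨X₁, p, g, hX₁, hp, hpg⟩ := exists_filtering_toPro hκ hE hs hX' (f ≫ e.inv)
  exact ⟨_, p, (toPro hκ hE).map g ≫ e.hom, inPro_toPro hκ hE hX₁, hp, by
    rw [reassoc_of% hpg, e.inv_hom_id, Category.comp_id]⟩

theorem isSplitRightSFiltering_inPro (hD : IsIdempotentComplete D) (hC : IsExtensionClosed E C)
    (hs : IsRightSFiltering (restrict E C) E C.ι) :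
    IsSplitRightSFiltering (proConfl κ E) (inPro hκ hE C) where
  ext := isExtensionClosed_inPro hκ hE hC
  filtering := exists_filtering_inPro hκ hE hs
  special := exists_special_inPro hκ hE hs
  split := exists_split_inPro hκ hE hD hs

end Pro

end RelTate

namespace RelTate

/-! ### Calculus of fractions for the quotient by P -/

section Calculus

variable {A : Type u} [Category.{v} A] [Preadditive A] {E : ObjectProperty (ShortComplex A)}
  {P : ObjectProperty A}

namespace IsSplitRightSFiltering

/-- The Ore condition for admissible monomorphisms with cokernel in `P`. -/
lemma exists_ore (hE : IsExactStructure E) (hP : IsSplitRightSFiltering E P) {V Y Y' : A}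
    (f : V ⟶ Y) {s : Y' ⟶ Y} (hs : monoCokerIn E P s) :
    ∃ (V' : A) (t : V' ⟶ V) (f' : V' ⟶ Y'), monoCokerIn E P t ∧ t ≫ f = f' ≫ s := by
  obtain ⟨B, q, hq, hB, hS⟩ := hs
  -- The preimage of `Y'` in `V` need not be an admissible subobject. The kernel of the admissible
  -- epimorphism through which `V → Y → B` factors replaces it.
  obtain ⟨B', p, g, hB', ⟨K, k, hk, -, hp⟩, hpg⟩ := hP.filtering (f ≫ q) hB
  obtain ⟨f', hf'⟩ := hE.lift hS (k ≫ f) (by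
    rw [Category.assoc, ← hpg, reassoc_of% hk, zero_comp])
  exact ⟨K, k, f', ⟨B', p, hk, hB', hp⟩, hf'.symm⟩

lemma hasRightCalculusOfFractions (hE : IsExactStructure E) (hP : IsSplitRightSFiltering E P) :
    (monoCokerIn E P).HasRightCalculusOfFractions where
  id_mem _ := hP.ext.monoCokerIn_of_isIso hE _
  comp_mem _ _ hf hg := hP.ext.monoCokerIn_comp hE hf hg
  exists_rightFraction X Y φ := by
    obtain ⟨V', t, f', ht, e⟩ := hP.exists_ore hE φ.f φ.hs
    exact ⟨.mk t ht f', e⟩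
  ext {X Y Y'} f₁ f₂ s hs h := by
    have := hE.mono_of_monoCokerIn hs
    exact ⟨X, 𝟙 X, hP.ext.monoCokerIn_of_isIso hE _, by rw [(cancel_mono s).1 h]⟩

/-- A functor that inverts the admissible monomorphisms with cokernel in `P` inverts the
admissible epimorphisms with kernel in `P`. -/
lemma isIso_map_of_epiKerIn (hE : IsExactStructure E) (hP : IsSplitRightSFiltering E P)
    {B : Type u'} [Category.{v'} B] (L : A ⥤ B) (hL : (monoCokerIn E P).IsInvertedBy L)
    {G F : A} {b : G ⟶ F} (hb : epiKerIn E P b) : IsIso (L.map b) := by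
  have := hE.hasBinaryBiproducts
  obtain ⟨Z, a, h, hZ, hS⟩ := hb
  obtain ⟨Y, X, j, q, h', s, t, hY, hX, hT, w₁, w₂⟩ := hP.special hS hZ
  -- By specialness `b` is a pullback of the admissible epimorphism `q : Y → X` of `P`. So `(s, b) :
  -- G → Y ⊞ F` is an admissible monomorphism with cokernel `X`, and the projection to `F` is
  -- inverted because its section is.
  have sq := hE.isPullback_of_confl hT hS t s w₁ w₂.symm
  have h₁ := hL _ ⟨_, _, _, hX, hE.confl_of_isPullback ⟨_, _, _, trivial, hT⟩ sq⟩
  have h₂ := hL _ ⟨_, _, _, hY, hE.confl_inr_fst Y F⟩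
  have h₃ : IsIso (L.map (biprod.snd : Y ⊞ F ⟶ F)) := by
    have : IsIso (L.map (biprod.inr : F ⟶ Y ⊞ F) ≫ L.map (biprod.snd : Y ⊞ F ⟶ F)) := by
      rw [← L.map_comp, biprod.inr_snd]
      infer_instance
    exact IsIso.of_isIso_comp_left (L.map (biprod.inr : F ⟶ Y ⊞ F)) _
  rw [← biprod.lift_snd s b, L.map_comp]
  infer_instance

lemma weakIso_isInvertedBy (hE : IsExactStructure E) (hP : IsSplitRightSFiltering E P)
    {B : Type u'} [Category.{v'} B] (L : A ⥤ B) (hL : (monoCokerIn E P).IsInvertedBy L) :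
    (weakIso E P).IsInvertedBy L := by
  rintro X Y f (hf | hf)
  · exact hL f hf
  · exact hP.isIso_map_of_epiKerIn hE L hL hf

lemma quotFunctor_inverts (E : ObjectProperty (ShortComplex A)) (P : ObjectProperty A) {X Y : A}
    {f : X ⟶ Y} (hf : monoCokerIn E P f) : IsIso ((quotFunctor E P).map f) :=
  (weakIso E P).Q_inverts f (Or.inl hf)

/-- The quotient functor is the localization functor at the admissible monomorphisms with cokernel
in `P`. -/
lemma isLocalization (hE : IsExactStructure E) (hP : IsSplitRightSFiltering E P) :
    (quotFunctor E P).IsLocalization (monoCokerIn E P) :=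
  Functor.IsLocalization.mk' _ _
    { inverts := fun _ _ _ hf => quotFunctor_inverts E P hf
      lift := fun F hF => Localization.Construction.lift F (hP.weakIso_isInvertedBy hE F hF)
      fac := fun F hF => Localization.Construction.fac F _
      uniq := fun F G h => Localization.Construction.uniq F G h }
    { inverts := fun _ _ _ hf => quotFunctor_inverts E P hf
      lift := fun F hF => Localization.Construction.lift F (hP.weakIso_isInvertedBy hE F hF)
      fac := fun F hF => Localization.Construction.fac F _
      uniq := fun F G h => Localization.Construction.uniq F G h }

/-- The additive structure of the quotient category. -/
lemma exists_preadditive (hE : IsExactStructure E) (hP : IsSplitRightSFiltering E P) :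
    ∃ (_ : Preadditive (Quot E P)), (quotFunctor E P).Additive := by
  have := hP.isLocalization hE
  have := hP.hasRightCalculusOfFractions hE
  -- `Localization.preadditive` works with left fractions, so the additive structure is built on the
  -- opposite category.
  have : (monoCokerIn E P).op.HasLeftCalculusOfFractions := inferInstance
  let h := Localization.preadditive (quotFunctor E P).op (monoCokerIn E P).op
  let _ : Preadditive (Quot E P)ᵒᵖ := h
  have hadd : (quotFunctor E P).op.Additive :=
    Localization.functor_additive (quotFunctor E P).op (monoCokerIn E P).op
  let inst : Preadditive (Quot E P) :=
    { homGroup := fun X Y => Equiv.addCommGroup (Quiver.Hom.opEquiv (X := X) (Y := Y))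
      add_comp := fun X Y Z f f' g => Quiver.Hom.op_inj (h.comp_add _ _ _ g.op f.op f'.op)
      comp_add := fun X Y Z f g g' => Quiver.Hom.op_inj (h.add_comp _ _ _ g.op g'.op f.op) }
  refine ⟨inst, ⟨fun {X Y f g} => Quiver.Hom.op_inj ?_⟩⟩
  exact hadd.map_add (f := f.op) (g := g.op)

end IsSplitRightSFiltering

end Calculus

/-! ### Exactness of the quotient functor -/

section Fractions

variable {A : Type u} [Category.{v} A] [Preadditive A] {E : ObjectProperty (ShortComplex A)}
  {P : ObjectProperty A}

/-- Restriction of a conflation to subobjects with quotients in `P`. -/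
lemma IsSplitRightSFiltering.exists_restriction (hE : IsExactStructure E)
    (hP : IsSplitRightSFiltering E P) {X Y Z : A} {f : X ⟶ Y} {g : Y ⟶ Z} {h : f ≫ g = 0}
    (hS : E (.mk f g h)) {Y' : A} {s : Y' ⟶ Y} (hs : monoCokerIn E P s) {X₁ : A} {t : X₁ ⟶ X}
    (ht : monoCokerIn E P t) :
    ∃ (X' Y'' M : A) (i : X' ⟶ Y'') (p : Y'' ⟶ M) (h' : i ≫ p = 0) (x : X' ⟶ X₁) (y : Y'' ⟶ Y')
      (m : M ⟶ Z), E (.mk i p h') ∧ monoCokerIn E P (x ≫ t) ∧ monoCokerIn E P (y ≫ s) ∧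
        IsIso ((quotFunctor E P).map m) ∧ i ≫ y ≫ s = x ≫ t ≫ f ∧ p ≫ m = y ≫ s ≫ g := by
  -- `X'` is a part of `X₁` whose image in `Y` lies in `Y'`.
  obtain ⟨X', x, k, hx, hk⟩ := hP.exists_ore hE (t ≫ f) hs
  have hxt := hP.ext.monoCokerIn_comp hE hx ht
  obtain ⟨B', c, hc, hB', hT⟩ := id hxt
  obtain ⟨B, q, hq, hB, hU⟩ := id hs
  -- `Z₁` is `Y / X'`, and `n : Z₁ → Z` has kernel `B' = X / X'` in `P`.
  obtain ⟨Z₁, π, hπ, a, n, han, hV, hca, hπn, hN⟩ := hE.exists_comp_confl hT hS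
  obtain ⟨q₁, hq₁⟩ := hE.desc hV q (by
    simp only [Category.assoc]
    rw [reassoc_of% hk, hq, comp_zero])
  -- `Y''` will be the preimage in `Y` of the kernel `M` of `e : Z₁ → B''`. It lies in `Y'` because
  -- `Y → B` factors through `e`, and its cokernel in `Y` is `B''`.
  obtain ⟨B'', e, b, hB'', ⟨M, μ, hμ, -, hM⟩, heb⟩ := hP.filtering q₁ hB
  obtain ⟨Y'', y₁, p, i, hip, sq, hi, hC⟩ := hE.exists_pullback hV μ
  obtain ⟨h₁, hy₁⟩ := hE.confl_of_isPullback_admMono ⟨_, _, _, trivial, hV⟩ hM sq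
  obtain ⟨y, hy⟩ := hE.lift hU y₁ (by
    rw [← hq₁, ← heb, ← Category.assoc, sq.w, Category.assoc, reassoc_of% hμ, zero_comp,
      comp_zero])
  refine ⟨X', Y'', M, i, p, hip, x, y, μ ≫ n, hC, hxt, ?_, ?_, ?_, ?_⟩
  · rw [hy]
    exact ⟨B'', _, h₁, hB'', hy₁⟩
  · have h₂ := IsSplitRightSFiltering.quotFunctor_inverts E P ⟨B'', e, hμ, hB'', hM⟩
    have h₃ : IsIso ((quotFunctor E P).map n) :=
      (weakIso E P).Q_inverts n (Or.inr ⟨B', a, han, hB', hN⟩)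
    rw [Functor.map_comp]
    infer_instance
  · rw [hy, hi, Category.assoc]
  · rw [← hπn, reassoc_of% hy, reassoc_of% sq.w]

lemma exists_quot_obj_eq (T : Quot E P) : ∃ X, (quotFunctor E P).obj X = T :=
  (Localization.Construction.objEquiv _).surjective T

namespace IsSplitRightSFiltering

lemma map_eq_map_iff (hE : IsExactStructure E) (hP : IsSplitRightSFiltering E P) {X Y : A}
    (f g : X ⟶ Y) : (quotFunctor E P).map f = (quotFunctor E P).map g ↔
      ∃ (X' : A) (s : X' ⟶ X), monoCokerIn E P s ∧ s ≫ f = s ≫ g := by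
  have := hP.isLocalization hE
  have := hP.hasRightCalculusOfFractions hE
  rw [MorphismProperty.map_eq_iff_precomp (quotFunctor E P) (monoCokerIn E P)]
  exact ⟨fun ⟨X', s, hs, e⟩ => ⟨X', s, hs, e⟩, fun ⟨X', s, hs, e⟩ => ⟨X', s, hs, e⟩⟩

lemma exists_fraction (hE : IsExactStructure E) (hP : IsSplitRightSFiltering E P) {X Y : A}
    (φ : (quotFunctor E P).obj X ⟶ (quotFunctor E P).obj Y) :
    ∃ (X' : A) (s : X' ⟶ X) (f : X' ⟶ Y), monoCokerIn E P s ∧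
      (quotFunctor E P).map s ≫ φ = (quotFunctor E P).map f := by
  have := hP.isLocalization hE
  have := hP.hasRightCalculusOfFractions hE
  obtain ⟨ψ, rfl⟩ := Localization.exists_rightFraction (quotFunctor E P) (monoCokerIn E P) φ
  exact ⟨ψ.X', ψ.s, ψ.f, ψ.hs, ψ.map_s_comp_map _ _⟩

end IsSplitRightSFiltering

variable [Preadditive (Quot E P)] [(quotFunctor E P).Additive]

namespace IsSplitRightSFiltering

lemma map_eq_zero_iff (hE : IsExactStructure E) (hP : IsSplitRightSFiltering E P) {X Y : A}
    (f : X ⟶ Y) : (quotFunctor E P).map f = 0 ↔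
      ∃ (X' : A) (s : X' ⟶ X), monoCokerIn E P s ∧ s ≫ f = 0 := by
  rw [← (quotFunctor E P).map_zero, hP.map_eq_map_iff hE]
  simp only [comp_zero]

/-- A morphism that becomes invertible in the quotient is the composition of an admissible
monomorphism with cokernel in `P` and the projection from a biproduct with an object of `P`. -/
lemma exists_lift_of_isIso (hE : IsExactStructure E) (hP : IsSplitRightSFiltering E P)
    [HasBinaryBiproducts A] {Y Y₁ : A} (t : Y ⟶ Y₁) [IsIso ((quotFunctor E P).map t)] :
    ∃ (N : A) (c : Y ⟶ N), P N ∧ monoCokerIn E P (biprod.lift t c) := by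
  -- The inverse of `t` is a fraction, which after shrinking its source gives a section `r` of `t`
  -- over a subobject `V` of `Y₁`.
  obtain ⟨V, s, r, ⟨B, q, hq, hB, hS⟩, hrt⟩ : ∃ (V : A) (s : V ⟶ Y₁) (r : V ⟶ Y),
      monoCokerIn E P s ∧ r ≫ t = s := by
    obtain ⟨V, s, r, hs, e⟩ := hP.exists_fraction hE (inv ((quotFunctor E P).map t))
    rw [IsIso.comp_inv_eq, ← Functor.map_comp, hP.map_eq_map_iff hE] at e
    obtain ⟨V', v, hv, e⟩ := e
    exact ⟨V', v ≫ s, v ≫ r, hP.ext.monoCokerIn_comp hE hv hs, by rw [Category.assoc, e]⟩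
  -- In the pushout `Y₂` the object `Y₁` becomes a retract through `d`, and `t` is `i'` followed by
  -- `d`, where `i'` has cokernel in `P`. It remains to see that the complement of `Y₁` in `Y₂` lies
  -- in `P`.
  obtain ⟨Y₂, f', i', p', h', sq, e₁, hS'⟩ := hE.exists_pushout hS r
  have hi' : monoCokerIn E P i' := ⟨B, p', h', hB, hS'⟩
  let d : Y₂ ⟶ Y₁ := sq.desc (𝟙 Y₁) t (by rw [hrt, Category.comp_id])
  have hd₁ : f' ≫ d = 𝟙 Y₁ := sq.inl_desc _ _ _
  have hd₂ : i' ≫ d = t := sq.inr_desc _ _ _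
  have := quotFunctor_inverts E P hi'
  have hd : IsIso ((quotFunctor E P).map d) := by
    have : IsIso ((quotFunctor E P).map i' ≫ (quotFunctor E P).map d) := by
      rw [← Functor.map_comp, hd₂]
      infer_instance
    exact IsIso.of_isIso_comp_left ((quotFunctor E P).map i') _
  -- This idempotent projects onto the complement. It vanishes in the quotient, where `d` is
  -- invertible.
  have he : (𝟙 Y₂ - d ≫ f') ≫ d = 0 := by
    rw [Preadditive.sub_comp, Category.assoc, hd₁, Category.id_comp, Category.comp_id, sub_self]
  have he' : f' ≫ (𝟙 Y₂ - d ≫ f') = 0 := by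
    rw [Preadditive.comp_sub, reassoc_of% hd₁, Category.comp_id, sub_self]
  have hee : (𝟙 Y₂ - d ≫ f') ≫ (𝟙 Y₂ - d ≫ f') = 𝟙 Y₂ - d ≫ f' := by
    rw [Preadditive.comp_sub, reassoc_of% he, zero_comp, sub_zero, Category.comp_id]
  have hm : (quotFunctor E P).map (𝟙 Y₂ - d ≫ f') = 0 := by
    rw [← cancel_mono ((quotFunctor E P).map d), ← Functor.map_comp, he, Functor.map_zero,
      zero_comp]
  have hdf : 𝟙 Y₂ = d ≫ f' + (𝟙 Y₂ - d ≫ f') := (add_sub_cancel _ _).symm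
  generalize 𝟙 Y₂ - d ≫ f' = e at he he' hee hm hdf
  -- Vanishing in the quotient means that `e` factors through an object `B₃` of `P`. The idempotent
  -- of `Y₂` is thereby exchanged for one of `B₃`, which splits in `P` and has the same image `N`.
  obtain ⟨Y₃, w, ⟨B₃, q₃, hq₃, hB₃, hw⟩, hwe⟩ := (hP.map_eq_zero_iff hE _).1 hm
  obtain ⟨b, hb⟩ := hE.desc hw e hwe
  have hqb : q₃ ≫ b ≫ e = e := by rw [reassoc_of% hb, hee]
  obtain ⟨N, i, ρ, hN, hiρ, hρi⟩ := hP.split ((b ≫ e) ≫ q₃) hB₃ (by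
    simp only [Category.assoc]
    rw [reassoc_of% hqb, reassoc_of% hee])
  have hβα : (q₃ ≫ ρ) ≫ i ≫ b ≫ e = e := by
    rw [Category.assoc, reassoc_of% hρi, reassoc_of% hqb, hqb, hee]
  have hαβ : (i ≫ b ≫ e) ≫ q₃ ≫ ρ = 𝟙 N := by
    have : i ≫ (((b ≫ e) ≫ q₃)) ≫ ρ = 𝟙 N := by
      rw [← hρi, Category.assoc, hiρ, Category.comp_id, hiρ]
    simpa using this
  generalize q₃ ≫ ρ = β at hβα hαβ
  have hαd : (i ≫ b ≫ e) ≫ d = 0 := by rw [Category.assoc, Category.assoc, he, comp_zero, comp_zero]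
  generalize i ≫ b ≫ e = α at hβα hαβ hαd
  have hfβ : f' ≫ β = 0 := by
    have : β = e ≫ β := by rw [← hβα, Category.assoc, hαβ, Category.comp_id]
    rw [this, reassoc_of% he', zero_comp]
  have hiso : IsIso (biprod.lift d β) := by
    refine ⟨biprod.desc f' α, ?_, ?_⟩
    · rw [biprod.lift_desc, hβα, ← hdf]
    · apply biprod.hom_ext' <;> apply biprod.hom_ext <;> simp [hd₁, hfβ, hαd, hαβ]
  refine ⟨N, i' ≫ β, hN, ?_⟩
  have : biprod.lift t (i' ≫ β) = i' ≫ biprod.lift d β := by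
    apply biprod.hom_ext <;> simp [hd₂]
  rw [this]
  exact hP.ext.monoCokerIn_comp hE hi' (hP.ext.monoCokerIn_of_isIso hE _)

/-- After restriction to subobjects of `T`, `φ` is a morphism of `A` whose composite with the
monomorphism `f` vanishes. -/
lemma eq_zero_of_comp_map (hE : IsExactStructure E) (hP : IsSplitRightSFiltering E P)
    {X Y Z : A} {f : X ⟶ Y} {g : Y ⟶ Z} {h : f ≫ g = 0} (hS : E (.mk f g h)) {T : A}
    {φ : (quotFunctor E P).obj T ⟶ (quotFunctor E P).obj X}
    (hφ : φ ≫ (quotFunctor E P).map f = 0) : φ = 0 := by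
  have hf := hE.mono hS
  obtain ⟨T', s, a, hs, e⟩ := hP.exists_fraction hE φ
  have := quotFunctor_inverts E P hs
  have : (quotFunctor E P).map (a ≫ f) = 0 := by
    rw [Functor.map_comp, ← e, Category.assoc, hφ, comp_zero]
  obtain ⟨T'', r, hr, hra⟩ := (hP.map_eq_zero_iff hE _).1 this
  rw [← cancel_epi ((quotFunctor E P).map s), e, comp_zero]
  exact (hP.map_eq_zero_iff hE _).2 ⟨T'', r, hr, by
    rw [← cancel_mono f, Category.assoc, hra, zero_comp]⟩

lemma exists_comp_map_eq (hE : IsExactStructure E) (hP : IsSplitRightSFiltering E P)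
    {X Y Z : A} {f : X ⟶ Y} {g : Y ⟶ Z} {h : f ≫ g = 0} (hS : E (.mk f g h)) {T : A}
    (φ : (quotFunctor E P).obj T ⟶ (quotFunctor E P).obj Y)
    (hφ : φ ≫ (quotFunctor E P).map g = 0) : ∃ l, l ≫ (quotFunctor E P).map f = φ := by
  obtain ⟨T', s, a, hs, e⟩ := hP.exists_fraction hE φ
  have : (quotFunctor E P).map (a ≫ g) = 0 := by
    rw [Functor.map_comp, ← e, Category.assoc, hφ, comp_zero]
  obtain ⟨T'', r, hr, hra⟩ := (hP.map_eq_zero_iff hE _).1 this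
  obtain ⟨l, hl⟩ := hE.lift hS (r ≫ a) (by rw [Category.assoc, hra])
  have := quotFunctor_inverts E P (hP.ext.monoCokerIn_comp hE hr hs)
  refine ⟨inv ((quotFunctor E P).map (r ≫ s)) ≫ (quotFunctor E P).map l, ?_⟩
  rw [Category.assoc, ← Functor.map_comp, hl, IsIso.inv_comp_eq, Functor.map_comp,
    Functor.map_comp, Category.assoc, e]

/-- Represent `φ` by `a` on a subobject `Z'` of `Z`. Then `a` vanishes after pullback to a subobject
of `Y'`, and `exists_restriction` supplies a conflation there whose last term `M` is isomorphic to
`Z'` in the quotient; `a` vanishes on `M`. -/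
lemma eq_zero_of_map_comp (hE : IsExactStructure E) (hP : IsSplitRightSFiltering E P)
    {X Y Z : A} {f : X ⟶ Y} {g : Y ⟶ Z} {h : f ≫ g = 0} (hS : E (.mk f g h)) {T : A}
    {φ : (quotFunctor E P).obj Z ⟶ (quotFunctor E P).obj T}
    (hφ : (quotFunctor E P).map g ≫ φ = 0) : φ = 0 := by
  obtain ⟨Z', s, a, hs, e⟩ := hP.exists_fraction hE φ
  have := quotFunctor_inverts E P hs
  obtain ⟨Y', s', g', i, hi, sq, -, hS'⟩ := hE.exists_pullback hS s
  have : (quotFunctor E P).map (g' ≫ a) = 0 := by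
    rw [Functor.map_comp, ← e, ← Functor.map_comp_assoc, ← sq.w, Functor.map_comp_assoc, hφ,
      comp_zero]
  obtain ⟨Y'', r, hr, hra⟩ := (hP.map_eq_zero_iff hE _).1 this
  obtain ⟨X₁, Y₁, M, i', p, h', x, y, m, hT, -, -, hm, -, w⟩ := hP.exists_restriction hE hS' hr
    (hP.ext.monoCokerIn_of_isIso hE (𝟙 X))
  have hma : m ≫ a = 0 := by
    have := hE.epi hT
    rw [← cancel_epi p, reassoc_of% w, hra, comp_zero, comp_zero]
  rw [← cancel_epi ((quotFunctor E P).map s), e, comp_zero,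
    ← cancel_epi ((quotFunctor E P).map m), ← Functor.map_comp, hma, Functor.map_zero, comp_zero]

/-- Represent `φ` by `a` on a subobject of `Y`; it vanishes on a subobject of `X`. On a conflation
restricted to these subobjects `a` descends to the last term, which is isomorphic to `Z` in the
quotient. -/
lemma exists_map_comp_eq (hE : IsExactStructure E) (hP : IsSplitRightSFiltering E P)
    {X Y Z : A} {f : X ⟶ Y} {g : Y ⟶ Z} {h : f ≫ g = 0} (hS : E (.mk f g h)) {T : A}
    (φ : (quotFunctor E P).obj Y ⟶ (quotFunctor E P).obj T)
    (hφ : (quotFunctor E P).map f ≫ φ = 0) : ∃ l, (quotFunctor E P).map g ≫ l = φ := by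
  obtain ⟨Y', s, a, hs, e⟩ := hP.exists_fraction hE φ
  obtain ⟨X₀, t, k, ht, hk⟩ := hP.exists_ore hE f hs
  have : (quotFunctor E P).map (k ≫ a) = 0 := by
    rw [Functor.map_comp, ← e, ← Functor.map_comp_assoc, ← hk, Functor.map_comp_assoc, hφ,
      comp_zero]
  obtain ⟨X₁, r, hr, hra⟩ := (hP.map_eq_zero_iff hE _).1 this
  obtain ⟨X', Y'', M, i, p, h', x, y, m, hT, -, hys, hm, w₁, w₂⟩ := hP.exists_restriction hE hS hs
    (hP.ext.monoCokerIn_comp hE hr ht)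
  have hiy : i ≫ y = x ≫ r ≫ k := by
    have := hE.mono_of_monoCokerIn hs
    rw [← cancel_mono s, Category.assoc, w₁]
    simp only [Category.assoc, hk]
  obtain ⟨b, hb⟩ := hE.desc hT (y ≫ a) (by
    rw [reassoc_of% hiy, hra, comp_zero])
  have := quotFunctor_inverts E P hys
  refine ⟨inv ((quotFunctor E P).map m) ≫ (quotFunctor E P).map b, ?_⟩
  rw [← cancel_epi ((quotFunctor E P).map (y ≫ s)), ← Functor.map_comp_assoc, Category.assoc,
    ← w₂, Functor.map_comp_assoc, IsIso.hom_inv_id_assoc, ← Functor.map_comp, hb,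
    Functor.map_comp, Functor.map_comp_assoc, e]

/-- The quotient functor maps conflations to kernel-cokernel pairs. -/
lemma isKernelCokernelPair_map (hE : IsExactStructure E) (hP : IsSplitRightSFiltering E P)
    {X Y Z : A} {f : X ⟶ Y} {g : Y ⟶ Z} {h : f ≫ g = 0} (hS : E (.mk f g h)) :
    IsKernelCokernelPair ((ShortComplex.mk f g h).map (quotFunctor E P)) := by
  rw [isKernelCokernelPair_iff]
  refine ⟨⟨Preadditive.mono_of_cancel_zero _ fun {T} φ hφ => ?_, fun T φ hφ => ?_⟩,
    ⟨Preadditive.epi_of_cancel_zero _ fun {T} φ hφ => ?_, fun T φ hφ => ?_⟩⟩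
  all_goals obtain ⟨T, rfl⟩ := exists_quot_obj_eq T
  · exact eq_zero_of_comp_map hE hP hS hφ
  · exact exists_comp_map_eq hE hP hS φ hφ
  · exact eq_zero_of_map_comp hE hP hS hφ
  · exact exists_map_comp_eq hE hP hS φ hφ

end IsSplitRightSFiltering

end Fractions

end RelTate

namespace RelTate

/-! ### The exact structure on the quotient -/

section QuotientExact

variable {A : Type u} [Category.{v} A] [Preadditive A] {E : ObjectProperty (ShortComplex A)}
  {P : ObjectProperty A} [Preadditive (Quot E P)] [(quotFunctor E P).Additive]

lemma quotConfl_of_isos {X Y Z : A} {f : X ⟶ Y} {g : Y ⟶ Z} {h : f ≫ g = 0} (hS : E (.mk f g h))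
    {X' Y' Z' : Quot E P} {f' : X' ⟶ Y'} {g' : Y' ⟶ Z'} (e₁ : (quotFunctor E P).obj X ≅ X')
    (e₂ : (quotFunctor E P).obj Y ≅ Y') (e₃ : (quotFunctor E P).obj Z ≅ Z')
    (w₁ : (quotFunctor E P).map f ≫ e₂.hom = e₁.hom ≫ f')
    (w₂ : (quotFunctor E P).map g ≫ e₃.hom = e₂.hom ≫ g') :
    ∃ h' : f' ≫ g' = 0, quotConfl E P (.mk f' g' h') :=
  ⟨by rw [← cancel_epi e₁.hom, ← reassoc_of% w₁, ← w₂, ← Functor.map_comp_assoc, h,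
    Functor.map_zero, zero_comp, comp_zero], _, hS, e₁, e₂, e₃, w₁, w₂⟩

lemma quotConfl_map {X Y Z : A} {f : X ⟶ Y} {g : Y ⟶ Z} {h : f ≫ g = 0} (hS : E (.mk f g h)) :
    ∃ h', quotConfl E P (.mk ((quotFunctor E P).map f) ((quotFunctor E P).map g) h') :=
  quotConfl_of_isos hS (Iso.refl _) (Iso.refl _) (Iso.refl _) (by simp) (by simp)

lemma quotFunctor_exact : IsExactFunctor E (quotConfl E P) (quotFunctor E P) where
  additive := inferInstance
  map_mem S hS := (quotConfl_map (f := S.f) (g := S.g) (h := S.zero) hS).snd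

lemma admMono_quotConfl_of_iso {X Y : A} {f : X ⟶ Y} (hf : admMono E f) {X' Y' : Quot E P}
    {φ : X' ⟶ Y'} (e₁ : (quotFunctor E P).obj X ≅ X') (e₂ : (quotFunctor E P).obj Y ≅ Y')
    (w : (quotFunctor E P).map f ≫ e₂.hom = e₁.hom ≫ φ) : admMono (quotConfl E P) φ := by
  obtain ⟨Z, g, h, -, hS⟩ := hf
  obtain ⟨h', hS'⟩ := quotConfl_of_isos hS e₁ e₂ (Iso.refl _)
    (g' := e₂.inv ≫ (quotFunctor E P).map g) w (by simp)
  exact ⟨_, _, h', trivial, hS'⟩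

lemma admEpi_quotConfl_of_iso {Y Z : A} {g : Y ⟶ Z} (hg : admEpi E g) {Y' Z' : Quot E P}
    {φ : Y' ⟶ Z'} (e₂ : (quotFunctor E P).obj Y ≅ Y') (e₃ : (quotFunctor E P).obj Z ≅ Z')
    (w : (quotFunctor E P).map g ≫ e₃.hom = e₂.hom ≫ φ) : admEpi (quotConfl E P) φ := by
  obtain ⟨X, f, h, -, hS⟩ := hg
  obtain ⟨h', hS'⟩ := quotConfl_of_isos hS (Iso.refl _) e₂ e₃
    (f' := (quotFunctor E P).map f ≫ e₂.hom) (by simp) w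
  exact ⟨_, _, h', trivial, hS'⟩

lemma exists_of_admMono_quotConfl {X' Y' : Quot E P} {φ : X' ⟶ Y'}
    (hφ : admMono (quotConfl E P) φ) : ∃ (X Y Z : A) (f : X ⟶ Y) (g : Y ⟶ Z) (h : f ≫ g = 0)
      (e₁ : (quotFunctor E P).obj X ≅ X') (e₂ : (quotFunctor E P).obj Y ≅ Y'), E (.mk f g h) ∧
        (quotFunctor E P).map f ≫ e₂.hom = e₁.hom ≫ φ := by
  obtain ⟨Z', ψ, h', -, S, hS, e₁, e₂, e₃, w₁, w₂⟩ := hφ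
  exact ⟨_, _, _, S.f, S.g, S.zero, e₁, e₂, hS, w₁⟩

lemma exists_of_admEpi_quotConfl {Y' Z' : Quot E P} {φ : Y' ⟶ Z'}
    (hφ : admEpi (quotConfl E P) φ) : ∃ (X Y Z : A) (f : X ⟶ Y) (g : Y ⟶ Z) (h : f ≫ g = 0)
      (e₂ : (quotFunctor E P).obj Y ≅ Y') (e₃ : (quotFunctor E P).obj Z ≅ Z'), E (.mk f g h) ∧
        (quotFunctor E P).map g ≫ e₃.hom = e₂.hom ≫ φ := by
  obtain ⟨Z', ψ, h', -, S, hS, e₁, e₂, e₃, w₁, w₂⟩ := hφ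
  exact ⟨_, _, _, S.f, S.g, S.zero, e₂, e₃, hS, w₂⟩

namespace IsSplitRightSFiltering

/-- The square is encoded by the conflation `X → Y ⊞ X' → Y'`, which the quotient functor sends to a
kernel-cokernel pair. -/
lemma isPushout_map (hE : IsExactStructure E) (hP : IsSplitRightSFiltering E P) {X Y X' Y' : A}
    {i : X ⟶ Y} (hi : admMono E i) {f : X ⟶ X'} {f' : Y ⟶ Y'} {i' : X' ⟶ Y'}
    (sq : IsPushout i f f' i') :
    IsPushout ((quotFunctor E P).map i) ((quotFunctor E P).map f) ((quotFunctor E P).map f')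
      ((quotFunctor E P).map i') := by
  have := hE.hasBinaryBiproducts
  have hS := hE.confl_of_isPushout hi sq
  obtain ⟨-, ⟨hepi, hd⟩⟩ := (isKernelCokernelPair_iff _).1 (isKernelCokernelPair_map hE hP hS)
  have e₁ : (quotFunctor E P).map biprod.inl ≫ (quotFunctor E P).map (biprod.desc f' i') =
      (quotFunctor E P).map f' := by rw [← Functor.map_comp, biprod.inl_desc]
  have e₂ : (quotFunctor E P).map biprod.inr ≫ (quotFunctor E P).map (biprod.desc f' i') =
      (quotFunctor E P).map i' := by rw [← Functor.map_comp, biprod.inr_desc]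
  have key : ∀ s : PushoutCocone ((quotFunctor E P).map i) ((quotFunctor E P).map f),
      ∃ l : (quotFunctor E P).obj Y' ⟶ s.pt, (quotFunctor E P).map (biprod.desc f' i') ≫ l =
        (quotFunctor E P).map biprod.fst ≫ s.inl + (quotFunctor E P).map biprod.snd ≫ s.inr :=
    fun s => hd _ _ (by
      change (quotFunctor E P).map (biprod.lift i (-f)) ≫ _ = 0
      rw [Preadditive.comp_add, ← Functor.map_comp_assoc, ← Functor.map_comp_assoc,
        biprod.lift_fst, biprod.lift_snd, s.condition, Functor.map_neg, Preadditive.neg_comp,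
        add_neg_cancel])
  choose l hl using key
  have t₁ : ∀ s, (quotFunctor E P).map f' ≫ l s = s.inl := fun s => by
    rw [← e₁, Category.assoc, hl, Preadditive.comp_add, ← Functor.map_comp_assoc,
      ← Functor.map_comp_assoc, biprod.inl_fst, biprod.inl_snd]
    simp
  have t₂ : ∀ s, (quotFunctor E P).map i' ≫ l s = s.inr := fun s => by
    rw [← e₂, Category.assoc, hl, Preadditive.comp_add, ← Functor.map_comp_assoc,
      ← Functor.map_comp_assoc, biprod.inr_fst, biprod.inr_snd]
    simp
  refine
    { w := by rw [← Functor.map_comp, sq.w, Functor.map_comp]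
      isColimit' := ⟨PushoutCocone.IsColimit.mk _ l t₁ t₂ fun s m h₁ h₂ => ?_⟩ }
  refine hepi.left_cancellation (Z := s.pt) m (l s) ?_
  change (quotFunctor E P).map (biprod.desc f' i') ≫ m =
    (quotFunctor E P).map (biprod.desc f' i') ≫ l s
  rw [hl, biprod.desc_eq, Functor.map_add, Functor.map_comp, Functor.map_comp,
    Preadditive.add_comp, Category.assoc, Category.assoc, h₁, h₂]

lemma isPullback_map (hE : IsExactStructure E) (hP : IsSplitRightSFiltering E P) {Y Z Z' Y' : A}
    {p : Y ⟶ Z} (hp : admEpi E p) {f : Z' ⟶ Z} {f' : Y' ⟶ Y} {p' : Y' ⟶ Z'}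
    (sq : IsPullback f' p' p f) :
    IsPullback ((quotFunctor E P).map f') ((quotFunctor E P).map p') ((quotFunctor E P).map p)
      ((quotFunctor E P).map f) := by
  have := hE.hasBinaryBiproducts
  have hS := hE.confl_of_isPullback hp sq
  obtain ⟨⟨hmono, hd⟩, -⟩ := (isKernelCokernelPair_iff _).1 (isKernelCokernelPair_map hE hP hS)
  have e₁ : (quotFunctor E P).map (biprod.lift f' p') ≫ (quotFunctor E P).map biprod.fst =
      (quotFunctor E P).map f' := by rw [← Functor.map_comp, biprod.lift_fst]
  have e₂ : (quotFunctor E P).map (biprod.lift f' p') ≫ (quotFunctor E P).map biprod.snd =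
      (quotFunctor E P).map p' := by rw [← Functor.map_comp, biprod.lift_snd]
  have key : ∀ s : PullbackCone ((quotFunctor E P).map p) ((quotFunctor E P).map f),
      ∃ l : s.pt ⟶ (quotFunctor E P).obj Y', l ≫ (quotFunctor E P).map (biprod.lift f' p') =
        s.fst ≫ (quotFunctor E P).map biprod.inl + s.snd ≫ (quotFunctor E P).map biprod.inr :=
    fun s => hd _ _ (by
      change _ ≫ (quotFunctor E P).map (biprod.desc p (-f)) = 0
      rw [Preadditive.add_comp, Category.assoc, Category.assoc, ← Functor.map_comp,
        ← Functor.map_comp, biprod.inl_desc, biprod.inr_desc, s.condition, Functor.map_neg,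
        Preadditive.comp_neg, add_neg_cancel])
  choose l hl using key
  have t₁ : ∀ s, l s ≫ (quotFunctor E P).map f' = s.fst := fun s => by
    rw [← e₁, reassoc_of% hl, Preadditive.add_comp, Category.assoc, Category.assoc,
      ← Functor.map_comp, ← Functor.map_comp, biprod.inl_fst, biprod.inr_fst]
    simp
  have t₂ : ∀ s, l s ≫ (quotFunctor E P).map p' = s.snd := fun s => by
    rw [← e₂, reassoc_of% hl, Preadditive.add_comp, Category.assoc, Category.assoc,
      ← Functor.map_comp, ← Functor.map_comp, biprod.inl_snd, biprod.inr_snd]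
    simp
  refine
    { w := by rw [← Functor.map_comp, sq.w, Functor.map_comp]
      isLimit' := ⟨PullbackCone.IsLimit.mk _ l t₁ t₂ fun s m h₁ h₂ => ?_⟩ }
  refine hmono.right_cancellation (Z := s.pt) m (l s) ?_
  change m ≫ (quotFunctor E P).map (biprod.lift f' p') =
    l s ≫ (quotFunctor E P).map (biprod.lift f' p')
  rw [hl, biprod.lift_eq, Functor.map_add, Functor.map_comp, Functor.map_comp,
    Preadditive.comp_add, reassoc_of% h₁, reassoc_of% h₂]

lemma isIso_map_biprod_fst (hE : IsExactStructure E) [HasBinaryBiproducts A] (Y : A) {N : A}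
    (hN : P N) : IsIso ((quotFunctor E P).map (biprod.fst : Y ⊞ N ⟶ Y)) :=
  (weakIso E P).Q_inverts _ (Or.inr ⟨_, _, _, hN, hE.confl_inr_fst Y N⟩)

/-- Lifts of `φ` and `ψ` to `A` meet only up to an isomorphism of the quotient, given by a fraction.
The first conflation is restricted to the source of the fraction, and its numerator is lifted to an
admissible monomorphism into `Y₂ ⊞ N`. Composing with `f₂ ⊕ 1` gives an admissible monomorphism of
`A` into `V ⊞ N`, which is `V` in the quotient. -/
lemma admMono_quotConfl_comp (hE : IsExactStructure E) (hP : IsSplitRightSFiltering E P)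
    {X' Y' Z' : Quot E P} {φ : X' ⟶ Y'} {ψ : Y' ⟶ Z'} (hφ : admMono (quotConfl E P) φ)
    (hψ : admMono (quotConfl E P) ψ) : admMono (quotConfl E P) (φ ≫ ψ) := by
  have := hE.hasBinaryBiproducts
  obtain ⟨X, Y, Z, f, g, h, e₁, e₂, hS, w⟩ := exists_of_admMono_quotConfl hφ
  obtain ⟨Y₂, V, Z₂, f₂, g₂, h₂, d₁, d₂, hT, w'⟩ := exists_of_admMono_quotConfl hψ
  obtain ⟨Y₃, s, t, hs, e⟩ := hP.exists_fraction hE (e₂.hom ≫ d₁.inv)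
  have hst : (quotFunctor E P).map s ≫ e₂.hom = (quotFunctor E P).map t ≫ d₁.hom := by
    rw [← e]
    simp
  obtain ⟨X₃, Y₄, M, i, p, h', x, y, m, hU, hx, hys, -, w₁, -⟩ := hP.exists_restriction hE hS hs
    (hP.ext.monoCokerIn_of_isIso hE (𝟙 X))
  have i₁ := quotFunctor_inverts E P hs
  have i₂ := quotFunctor_inverts E P hx
  have i₃ := quotFunctor_inverts E P hys
  have i₄ : IsIso ((quotFunctor E P).map t) := by
    rw [← e]
    infer_instance
  have i₅ : IsIso ((quotFunctor E P).map y) := by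
    rw [Functor.map_comp] at i₃
    exact IsIso.of_isIso_comp_right _ ((quotFunctor E P).map s)
  have i₆ : IsIso ((quotFunctor E P).map (y ≫ t)) := by
    rw [Functor.map_comp]
    infer_instance
  obtain ⟨N, c, hN, hc⟩ := hP.exists_lift_of_isIso hE (y ≫ t)
  have i₇ := isIso_map_biprod_fst hE V hN
  refine admMono_quotConfl_of_iso (f := i ≫ biprod.lift (y ≫ t) c ≫ biprod.map f₂ (𝟙 N))
    (hE.comp_admMono _ _ ⟨_, _, _, trivial, hU⟩ (hE.comp_admMono _ _
      (IsExactStructure.monoCokerIn_mono le_top hc)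
      ⟨_, _, _, trivial, hE.confl_biprod_map_id hT N⟩))
    (asIso ((quotFunctor E P).map (x ≫ 𝟙 X)) ≪≫ e₁)
    (asIso ((quotFunctor E P).map (biprod.fst : V ⊞ N ⟶ V)) ≪≫ d₂) ?_
  have a₁ : (i ≫ biprod.lift (y ≫ t) c ≫ biprod.map f₂ (𝟙 N)) ≫ biprod.fst = i ≫ y ≫ t ≫ f₂ := by
    simp
  rw [Iso.trans_hom, asIso_hom, ← Functor.map_comp_assoc, a₁, Iso.trans_hom, asIso_hom,
    Category.assoc, ← reassoc_of% w, ← Functor.map_comp_assoc, Category.assoc, ← w₁]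
  simp only [Functor.map_comp, Category.assoc]
  rw [w', reassoc_of% hst]

/-- The numerator of the comparison fraction is lifted to an admissible monomorphism into `Y₂ ⊞ N`.
The admissible epimorphism from `Y₂ ⊞ N` to `V` is restricted to a subobject `Y₄` of its source,
along which the first epimorphism is pulled back; the two then compose in `A`. -/
lemma admEpi_quotConfl_comp (hE : IsExactStructure E) (hP : IsSplitRightSFiltering E P)
    {X' Y' Z' : Quot E P} {φ : X' ⟶ Y'} {ψ : Y' ⟶ Z'} (hφ : admEpi (quotConfl E P) φ)
    (hψ : admEpi (quotConfl E P) ψ) : admEpi (quotConfl E P) (φ ≫ ψ) := by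
  have := hE.hasBinaryBiproducts
  obtain ⟨K, X, Y, k, f, h, e₁, e₂, hS, w⟩ := exists_of_admEpi_quotConfl hφ
  obtain ⟨K₂, Y₂, V, k₂, g, h₂, d₁, d₂, hT, w'⟩ := exists_of_admEpi_quotConfl hψ
  obtain ⟨Y₃, s, t, hs, e⟩ := hP.exists_fraction hE (e₂.hom ≫ d₁.inv)
  have hst : (quotFunctor E P).map s ≫ e₂.hom = (quotFunctor E P).map t ≫ d₁.hom := by
    rw [← e]
    simp
  have i₁ := quotFunctor_inverts E P hs
  have i₂ : IsIso ((quotFunctor E P).map t) := by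
    rw [← e]
    infer_instance
  obtain ⟨N, c, hN, hc⟩ := hP.exists_lift_of_isIso hE t
  have i₃ := quotFunctor_inverts E P hc
  obtain ⟨X₃, a, f₃, k₃, hk₃, sq, -, hS₃⟩ := hE.exists_pullback hS s
  have hh : admEpi E ((biprod.fst : Y₂ ⊞ N ⟶ Y₂) ≫ g) :=
    hE.comp_admEpi _ _ ⟨_, _, _, trivial, hE.confl_inr_fst Y₂ N⟩ ⟨_, _, _, trivial, hT⟩
  obtain ⟨K₄, k₄, hk₄, -, hS₄⟩ := hh
  obtain ⟨K', Y₄, M, i, p, h', x, y, m, hU, hx, hys, hm, w₁, w₂⟩ :=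
    hP.exists_restriction hE hS₄ hc (hP.ext.monoCokerIn_of_isIso hE (𝟙 K₄))
  have i₄ := quotFunctor_inverts E P hys
  have i₅ : IsIso ((quotFunctor E P).map y) := by
    rw [Functor.map_comp] at i₄
    exact IsIso.of_isIso_comp_right _ ((quotFunctor E P).map (biprod.lift t c))
  obtain ⟨X₄, b, f₄, k₅, hk₅, sq', -, hS₅⟩ := hE.exists_pullback hS₃ y
  have i₆ : IsIso ((quotFunctor E P).map b) :=
    (hP.isPullback_map hE ⟨_, _, _, trivial, hS₃⟩ sq').isIso_fst_of_isIso
  have i₇ : IsIso ((quotFunctor E P).map a) :=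
    (hP.isPullback_map hE ⟨_, _, _, trivial, hS⟩ sq).isIso_fst_of_isIso
  refine admEpi_quotConfl_of_iso (g := f₄ ≫ p)
    (hE.comp_admEpi _ _ ⟨_, _, _, trivial, hS₅⟩ ⟨_, _, _, trivial, hU⟩)
    (asIso ((quotFunctor E P).map b) ≪≫ asIso ((quotFunctor E P).map a) ≪≫ e₁)
    (asIso ((quotFunctor E P).map m) ≪≫ d₂) ?_
  have a₁ : (f₄ ≫ p) ≫ m = b ≫ f₃ ≫ t ≫ g := by
    rw [Category.assoc, w₂, biprod.lift_fst_assoc, ← reassoc_of% sq'.w]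
  simp only [Iso.trans_hom, asIso_hom, Category.assoc]
  rw [← Functor.map_comp_assoc, a₁, ← reassoc_of% w, ← Functor.map_comp_assoc _ a, sq.w]
  simp only [Functor.map_comp, Category.assoc]
  rw [w', reassoc_of% hst]

lemma exists_pushout_quotConfl (hE : IsExactStructure E) (hP : IsSplitRightSFiltering E P)
    {U V U' : Quot E P} (φ : U ⟶ V) (ψ : U ⟶ U') (hφ : admMono (quotConfl E P) φ) :
    ∃ (V' : Quot E P) (ψ' : V ⟶ V') (φ' : U' ⟶ V'), IsPushout φ ψ ψ' φ' ∧
      admMono (quotConfl E P) φ' := by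
  obtain ⟨X, Y, Z, f, g, h, e₁, e₂, hS, w⟩ := exists_of_admMono_quotConfl hφ
  obtain ⟨X', rfl⟩ := exists_quot_obj_eq U'
  -- Shrinking `X` to `X₀` turns `ψ` into a morphism of `A` and keeps the map to `Y` an admissible
  -- monomorphism.
  obtain ⟨X₀, s, a, hs, e⟩ := hP.exists_fraction hE (e₁.hom ≫ ψ)
  have i₁ := quotFunctor_inverts E P hs
  have hsf : admMono E (s ≫ f) := hE.comp_admMono _ _
    (IsExactStructure.monoCokerIn_mono le_top hs) ⟨_, _, _, trivial, hS⟩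
  obtain ⟨Y', a', i', sq, hi'⟩ := hE.pushout_admMono _ a hsf
  refine ⟨_, e₂.inv ≫ (quotFunctor E P).map a', (quotFunctor E P).map i',
    IsPushout.of_iso (hP.isPushout_map hE hsf sq) (asIso ((quotFunctor E P).map s) ≪≫ e₁) e₂
      (Iso.refl _) (Iso.refl _) ?_ ?_ ?_ ?_,
    admMono_quotConfl_of_iso hi' (Iso.refl _) (Iso.refl _) (by simp)⟩
  · simp [w]
  · simp [e]
  · simp
  · simp

lemma exists_pullback_quotConfl (hE : IsExactStructure E) (hP : IsSplitRightSFiltering E P)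
    {V W W' : Quot E P} (φ : V ⟶ W) (ψ : W' ⟶ W) (hφ : admEpi (quotConfl E P) φ) :
    ∃ (V' : Quot E P) (ψ' : V' ⟶ V) (φ' : V' ⟶ W'), IsPullback ψ' φ' φ ψ ∧
      admEpi (quotConfl E P) φ' := by
  obtain ⟨X, Y, Z, f, g, h, e₂, e₃, hS, w⟩ := exists_of_admEpi_quotConfl hφ
  obtain ⟨Z', rfl⟩ := exists_quot_obj_eq W'
  obtain ⟨Z₀, s, a, hs, e⟩ := hP.exists_fraction hE (ψ ≫ e₃.inv)
  have i₁ := quotFunctor_inverts E P hs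
  have hg : admEpi E g := ⟨_, _, _, trivial, hS⟩
  obtain ⟨Y', a', p', sq, hp'⟩ := hE.pullback_admEpi _ a hg
  refine ⟨_, (quotFunctor E P).map a' ≫ e₂.hom, (quotFunctor E P).map p' ≫ (quotFunctor E P).map s,
    IsPullback.of_iso (hP.isPullback_map hE hg sq) (Iso.refl _) e₂
      (asIso ((quotFunctor E P).map s)) e₃ ?_ ?_ ?_ ?_,
    admEpi_quotConfl_of_iso hp' (Iso.refl _) (asIso ((quotFunctor E P).map s)) (by simp)⟩
  · simp
  · simp
  · simp [w]
  · simp [← e]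

/-- The quotient of an exact category by a right s-filtering subcategory whose idempotents split
is an exact category. -/
theorem isExactStructure_quotConfl (hE : IsExactStructure E) (hP : IsSplitRightSFiltering E P) :
    IsExactStructure (quotConfl E P) where
  hasZeroObject := by
    have := hE.hasZeroObject
    exact (quotFunctor E P).hasZeroObject_of_additive
  hasBinaryBiproducts := by
    have := hE.hasBinaryBiproducts
    refine ⟨fun X' Y' => ?_⟩
    obtain ⟨X, rfl⟩ := exists_quot_obj_eq X'
    obtain ⟨Y, rfl⟩ := exists_quot_obj_eq Y'
    have : PreservesBinaryBiproducts (quotFunctor E P) :=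
      preservesBinaryBiproducts_of_preservesBiproducts _
    exact ⟨⟨(quotFunctor E P).mapBinaryBicone (BinaryBiproduct.bicone X Y),
      isBinaryBilimitOfPreserves (quotFunctor E P) (BinaryBiproduct.isBilimit X Y)⟩⟩
  of_iso := by
    rintro S T e ⟨S', hS', e₁, e₂, e₃, w₁, w₂⟩
    refine ⟨S', hS', e₁ ≪≫ ShortComplex.π₁.mapIso e, e₂ ≪≫ ShortComplex.π₂.mapIso e,
      e₃ ≪≫ ShortComplex.π₃.mapIso e, ?_, ?_⟩
    · change _ ≫ e₂.hom ≫ e.hom.τ₂ = (e₁.hom ≫ e.hom.τ₁) ≫ T.f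
      rw [reassoc_of% w₁, Category.assoc, e.hom.comm₁₂]
    · change _ ≫ e₃.hom ≫ e.hom.τ₃ = (e₂.hom ≫ e.hom.τ₂) ≫ T.g
      rw [reassoc_of% w₂, Category.assoc, e.hom.comm₂₃]
  isKernelCokernelPair := by
    rintro S ⟨S', hS', e₁, e₂, e₃, w₁, w₂⟩
    exact (isKernelCokernelPair_map hE hP (f := S'.f) (g := S'.g) (h := S'.zero) hS').of_iso
      (ShortComplex.isoMk e₁ e₂ e₃ w₁.symm w₂.symm)
  id_admMono X' := by
    obtain ⟨X, rfl⟩ := exists_quot_obj_eq X'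
    exact admMono_quotConfl_of_iso (hE.id_admMono X) (Iso.refl _) (Iso.refl _) (by simp)
  id_admEpi X' := by
    obtain ⟨X, rfl⟩ := exists_quot_obj_eq X'
    exact admEpi_quotConfl_of_iso (hE.id_admEpi X) (Iso.refl _) (Iso.refl _) (by simp)
  comp_admMono _ _ hf hg := hP.admMono_quotConfl_comp hE hf hg
  comp_admEpi _ _ hf hg := hP.admEpi_quotConfl_comp hE hf hg
  pushout_admMono i f hi := hP.exists_pushout_quotConfl hE i f hi
  pullback_admEpi p f hp := hP.exists_pullback_quotConfl hE p f hp

end IsSplitRightSFiltering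

end QuotientExact

end RelTate

namespace RelTate

/-! ### Stalks of Ind objects in the quotient -/

section Stalks

open Opposite

variable {A : Type u} [Category.{v} A] [Preadditive A] {E : ObjectProperty (ShortComplex A)}
  {P : ObjectProperty A}

/-- A stalk of a left exact presheaf `F` in the quotient category: an object of `A`, whose image in
the quotient is the colimit of the images of the representable presheaves over `F`. -/
structure Stalk (E : ObjectProperty (ShortComplex A)) (P : ObjectProperty A) (F : Lex E) where
  /-- the object -/
  pt : A
  /-- the universal section -/
  elt : F.obj.obj (op pt)
  /-- the germ of a section -/
  germ : ∀ {Y : A}, F.obj.obj (op Y) → ((quotFunctor E P).obj Y ⟶ (quotFunctor E P).obj pt)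
  germ_res : ∀ {Y Y' : A} (f : Y' ⟶ Y) (y : F.obj.obj (op Y)),
    germ (res F.obj f y) = (quotFunctor E P).map f ≫ germ y
  germ_elt : germ elt = 𝟙 _
  exists_res : ∀ {Y : A} (y : F.obj.obj (op Y)), ∃ (Y' : A) (f : Y ⟶ Y') (g : pt ⟶ Y')
    (y' : F.obj.obj (op Y')), monoCokerIn E P g ∧ res F.obj f y' = y ∧ res F.obj g y' = elt

/-- Transition maps are inverted in the quotient, so a section given by `f : Y → X j` has as germ
the image of `f` followed by the inverse of `X i₀ → X j`. Directedness makes it independent of `j`.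
The `HEq` retains that the universal section is `x i₀`, as needed to identify the cokernel of the
stalk in the Ind object. -/
lemma IsPres.exists_stalk (hE : IsExactStructure E) (hP : IsExtensionClosed E P) {F : Lex E}
    {I : Type w} [PartialOrder I] [IsDirected I (· ≤ ·)] {X : I → A}
    {x : ∀ i, F.obj.obj (op (X i))} (hx : IsPres E P F X x) (i₀ : I) :
    ∃ (s : Stalk E P F) (e : s.pt = X i₀), HEq s.elt (x i₀) := by
  have dom : ∀ {Y : A} (y : F.obj.obj (op Y)), ∃ (j : I) (f : Y ⟶ X j) (g : X i₀ ⟶ X j),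
      monoCokerIn E P g ∧ res F.obj f (x j) = y ∧ res F.obj g (x j) = x i₀ := by
    intro Y y
    obtain ⟨j, hj, f, hf⟩ := hx.surj_le i₀ y
    obtain ⟨g, hg, hg'⟩ := hx.le hj
    exact ⟨j, f, g, hg, hf, hg'⟩
  have key : ∀ {Y : A} (y : F.obj.obj (op Y)),
      ∃ τ : (quotFunctor E P).obj Y ⟶ (quotFunctor E P).obj (X i₀), ∀ {j : I} (f : Y ⟶ X j)
        (g : X i₀ ⟶ X j), monoCokerIn E P g → res F.obj f (x j) = y → res F.obj g (x j) = x i₀ →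
          τ ≫ (quotFunctor E P).map g = (quotFunctor E P).map f := by
    intro Y y
    obtain ⟨j₀, f₀, g₀, hg₀, hf₀, hg₀'⟩ := dom y
    have i₁ := IsSplitRightSFiltering.quotFunctor_inverts E P hg₀
    refine ⟨(quotFunctor E P).map f₀ ≫ inv ((quotFunctor E P).map g₀), fun {j} f g hg hf hg' => ?_⟩
    obtain ⟨k, hk, hk'⟩ := exists_ge_ge j₀ j
    obtain ⟨h₀, hh₀, e₀⟩ := hx.le hk
    obtain ⟨h, hh, e⟩ := hx.le hk'
    have i₂ := IsSplitRightSFiltering.quotFunctor_inverts E P hh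
    have a₁ : f₀ ≫ h₀ = f ≫ h := hx.eq_of_res (by rw [res_comp, res_comp, e₀, e, hf₀, hf])
    have a₂ : g₀ ≫ h₀ = g ≫ h := hx.eq_of_res (by rw [res_comp, res_comp, e₀, e, hg₀', hg'])
    rw [← cancel_mono ((quotFunctor E P).map h), Category.assoc, Category.assoc,
      ← Functor.map_comp, ← a₂, ← Functor.map_comp, ← a₁, Functor.map_comp, Functor.map_comp,
      IsIso.inv_hom_id_assoc]
  choose τ hτ using @key
  refine ⟨⟨X i₀, x i₀, τ, fun f' y => ?_, ?_, fun y => ?_⟩, rfl, HEq.rfl⟩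
  · obtain ⟨j, f, g, hg, hf, hg'⟩ := dom y
    have i₁ := IsSplitRightSFiltering.quotFunctor_inverts E P hg
    rw [← cancel_mono ((quotFunctor E P).map g), Category.assoc, hτ _ f g hg hf hg',
      hτ _ (f' ≫ f) g hg (by rw [res_comp, hf]) hg', Functor.map_comp]
  · have := hτ (x i₀) (𝟙 _) (𝟙 _) (hP.monoCokerIn_of_isIso hE _) (res_id _ (x i₀)) (res_id _ (x i₀))
    rw [CategoryTheory.Functor.map_id, Category.comp_id] at this
    exact this
  · obtain ⟨j, f, g, hg, hf, hg'⟩ := dom y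
    exact ⟨X j, f, g, x j, hg, hf, hg'⟩

namespace Stalk

variable {F G H : Lex E} (s : Stalk E P F) (s' : Stalk E P G)

lemma exists_isIso_germ {Y : A} (y : F.obj.obj (op Y)) : ∃ (Y' : A) (f : Y ⟶ Y') (g : s.pt ⟶ Y')
    (y' : F.obj.obj (op Y')), monoCokerIn E P g ∧ res F.obj f y' = y ∧ res F.obj g y' = s.elt ∧
      IsIso (s.germ y') ∧ s.germ y' ≫ (quotFunctor E P).map g = 𝟙 _ := by
  obtain ⟨Y', f, g, y', hg, hf, hg'⟩ := s.exists_res y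
  have i₁ := IsSplitRightSFiltering.quotFunctor_inverts E P hg
  have e : (quotFunctor E P).map g ≫ s.germ y' = 𝟙 _ := by rw [← s.germ_res, hg', s.germ_elt]
  have e' : s.germ y' = inv ((quotFunctor E P).map g) := by
    rw [← cancel_epi ((quotFunctor E P).map g), e, IsIso.hom_inv_id]
  refine ⟨Y', f, g, y', hg, hf, hg', ?_, ?_⟩
  · rw [e']
    infer_instance
  · rw [e', IsIso.inv_hom_id]

/-- The morphism between stalks. -/
def map (φ : F ⟶ G) : (quotFunctor E P).obj s.pt ⟶ (quotFunctor E P).obj s'.pt :=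
  s'.germ (ap φ.hom s.elt)

lemma germ_map (φ : F ⟶ G) {Y : A} (y : F.obj.obj (op Y)) :
    s.germ y ≫ s.map s' φ = s'.germ (ap φ.hom y) := by
  obtain ⟨Y', f, g, y', hg, rfl, hg', -, e⟩ := s.exists_isIso_germ y
  rw [map, ← hg', ap_res, s'.germ_res, s.germ_res, Category.assoc, reassoc_of% e, ap_res,
    s'.germ_res]

/-- Both sections are restrictions of one section over `Y ⊞ Y`, so additivity reduces to that of the
quotient functor. -/
lemma germ_add (hE : IsExactStructure E) [Preadditive (Quot E P)] [(quotFunctor E P).Additive]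
    {Y : A} (y y' : F.obj.obj (op Y)) : s.germ (y + y') = s.germ y + s.germ y' := by
  have := hE.hasBinaryBiproducts
  let z := res F.obj (biprod.fst : Y ⊞ Y ⟶ Y) y + res F.obj (biprod.snd : Y ⊞ Y ⟶ Y) y'
  have h₁ : res F.obj biprod.inl z = y := by
    rw [res_add, ← res_comp, ← res_comp, biprod.inl_fst, biprod.inl_snd, res_id, zero_res, add_zero]
  have h₂ : res F.obj biprod.inr z = y' := by
    rw [res_add, ← res_comp, ← res_comp, biprod.inr_fst, biprod.inr_snd, res_id, zero_res, zero_add]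
  rw [← h₁, ← h₂, ← add_res, s.germ_res, s.germ_res, s.germ_res, Functor.map_add,
    Preadditive.add_comp]

/-- The stalk need not come from the presentation `hx`. At a stage `k` that contains the universal
section the germ is a split epimorphism. It is also a monomorphism: it is `f₂` followed by an
isomorphism, and the image of `f₂` is the first factor of the inverted transition map `g₃`. -/
lemma isIso_germ {I : Type w} [PartialOrder I] [IsDirected I (· ≤ ·)] {X : I → A}
    {x : ∀ i, F.obj.obj (op (X i))} (hx : IsPres E P F X x) (j : I) : IsIso (s.germ (x j)) := by
  obtain ⟨k, hk, f, hf⟩ := hx.surj_le j s.elt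
  obtain ⟨g, hg, hg'⟩ := hx.le hk
  have i₁ := IsSplitRightSFiltering.quotFunctor_inverts E P hg
  rw [← hg', s.germ_res]
  suffices IsIso (s.germ (x k)) by infer_instance
  obtain ⟨Y', f₂, g₂, y', hg₂, hf₂, hg₂', i₂, e⟩ := s.exists_isIso_germ (x k)
  obtain ⟨l, hl, f₃, hf₃⟩ := hx.surj_le k y'
  obtain ⟨g₃, hg₃, hg₃'⟩ := hx.le hl
  have i₃ := IsSplitRightSFiltering.quotFunctor_inverts E P hg₃
  have e₁ : f₂ ≫ f₃ = g₃ := hx.eq_of_res (by rw [res_comp, hf₃, hf₂, hg₃'])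
  have e₂ : (quotFunctor E P).map f ≫ s.germ (x k) = 𝟙 _ := by rw [← s.germ_res, hf, s.germ_elt]
  have e₃ : (quotFunctor E P).map f₂ ≫ s.germ y' = s.germ (x k) := by rw [← s.germ_res, hf₂]
  have h₁ : IsSplitEpi (s.germ (x k)) := ⟨⟨⟨_, e₂⟩⟩⟩
  have h₂ : Mono ((quotFunctor E P).map f₂) := by
    have : Mono ((quotFunctor E P).map f₂ ≫ (quotFunctor E P).map f₃) := by
      rw [← Functor.map_comp, e₁]
      infer_instance
    exact mono_of_mono _ ((quotFunctor E P).map f₃)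
  have h₃ : Mono (s.germ (x k)) := by
    rw [← e₃]
    infer_instance
  exact isIso_of_mono_of_isSplitEpi _

/-- The stalks of a conflation of left exact presheaves. -/
lemma exists_isChart (hE : IsExactStructure E) (hP : IsExtensionClosed E P) {f : F ⟶ G} {g : G ⟶ H}
    (hx : IsLocExact E f.hom g.hom) {I : Type w} [PartialOrder I] [IsDirected I (· ≤ ·)]
    [Nonempty I] {X : I → A} {u : ∀ b, F.obj.obj (op (X b))} {K : Type w} [PartialOrder K]
    [IsDirected K (· ≤ ·)] [Nonempty K] {Z : K → A} {z : ∀ k, H.obj.obj (op (Z k))}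
    (hU : IsPres E P F X u) (hW : IsPres E P H Z z) :
    ∃ (a : I) (k : K) (R : A) (i : X a ⟶ R) (q : R ⟶ Z k) (p : G.obj.obj (op R)),
      IsChart f g (u a) (z k) i q p ∧ IsIso (s'.germ p) := by
  obtain ⟨J, _, ⟨j⟩, _, a, k, R, i, q, p, -, -, -, -, -, hc, hV⟩ :=
    exists_straightening hE hP hx hU hW
  exact ⟨a j, k j, R j, i j, q j, p j, hc j, s'.isIso_germ hV j⟩

end Stalk

end Stalks

/-! ### The stalk functor -/

section StalkFunctor

open Opposite

variable {A : Type u} [Category.{v} A] [Preadditive A] {E : ObjectProperty (ShortComplex A)}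
  {P : ObjectProperty A} {κ : Cardinal.{w}}

/-- The full subcategory of `Ind(A, P)` formed by the objects presented by diagrams in `P`. -/
abbrev indSub (κ : Cardinal.{w}) (E : ObjectProperty (ShortComplex A)) (P : ObjectProperty A) :
    ObjectProperty (IndRel κ E P) :=
  fun V => indPresented κ E P P V.obj

/-- The quotient of `V` by a stage is a union of objects of `P`. This is what identifies `V` with
its stalk modulo Ind(P). -/
lemma exists_stalk [UnivLE.{w, v}] (hκ : Cardinal.aleph0 ≤ κ) (hE : IsExactStructure E)
    (hP : IsExtensionClosed E P) (V : IndRel κ E P) : ∃ s : Stalk E P V.obj,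
      monoCokerIn (indConfl κ E P) (indSub κ E P) (indElt hκ hE hP V s.elt) := by
  obtain ⟨I, _, ⟨i₀⟩, _, X, x, hI, -, hx⟩ := exists_isPres_of_indPresented hE V.property
  obtain ⟨⟨pt, elt, germ, h₁, h₂, h₃⟩, rfl, h⟩ := hx.exists_stalk hE hP i₀
  obtain rfl := eq_of_heq h
  have : Nonempty I := ⟨i₀⟩
  obtain ⟨W, g, hW, hS⟩ := hx.exists_quotient hE hI i₀
  have hW' : indPresented κ E ⊤ P W := by
    obtain ⟨I, a, b, c, X, d, e₁, e₂, e₃, e₄⟩ := hW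
    exact ⟨I, a, b, c, X, d, e₁, fun _ => trivial, e₃, e₄⟩
  obtain ⟨h, hS'⟩ := indConfl_of_isLocExact hE (Z := ⟨W, hW'⟩) (f := indElt hκ hE hP V (x i₀))
    (g := ObjectProperty.homMk g) hS
  exact ⟨⟨_, _, germ, h₁, h₂, h₃⟩, _, _, h, hW, hS'⟩

/-- The stalk functor, for a choice of stalks. -/
def stalkFunctor (σ : ∀ V : IndRel κ E P, Stalk E P V.obj) : IndRel κ E P ⥤ Quot E P where
  obj V := (quotFunctor E P).obj (σ V).pt
  map {V W} φ := (σ V).map (σ W) φ.hom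
  map_id V := (σ V).germ_elt
  map_comp {U V W} φ ψ := ((σ V).germ_map (σ W) ψ.hom _).symm

variable (σ : ∀ V : IndRel κ E P, Stalk E P V.obj)

/-- The germ of a section, as a morphism to the value of the stalk functor. -/
def indGerm (V : IndRel κ E P) {Y : A} (y : V.obj.obj.obj (op Y)) :
    (quotFunctor E P).obj Y ⟶ (stalkFunctor σ).obj V :=
  (σ V).germ y

lemma indGerm_res (V : IndRel κ E P) {Y Y' : A} (f : Y' ⟶ Y) (y : V.obj.obj.obj (op Y)) :
    indGerm σ V (res V.obj.obj f y) = (quotFunctor E P).map f ≫ indGerm σ V y :=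
  (σ V).germ_res f y

lemma indGerm_comp_map {V W : IndRel κ E P} (φ : V ⟶ W) {Y : A} (y : V.obj.obj.obj (op Y)) :
    indGerm σ V y ≫ (stalkFunctor σ).map φ = indGerm σ W (ap φ.hom.hom y) :=
  (σ V).germ_map (σ W) φ.hom y

lemma isIso_indGerm (V : IndRel κ E P) {I : Type w} [PartialOrder I] [IsDirected I (· ≤ ·)]
    {X : I → A} {x : ∀ i, V.obj.obj.obj (op (X i))} (hx : IsPres E P V.obj X x) (j : I) :
    IsIso (indGerm σ V (x j)) :=
  (σ V).isIso_germ hx j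

lemma stalkFunctor_additive (hE : IsExactStructure E) [Preadditive (Quot E P)]
    [(quotFunctor E P).Additive] : (stalkFunctor σ).Additive where
  map_add {V W φ ψ} := (σ W).germ_add hE _ _

/-- Germs identify a chart with the sequence of stalks. The properties `R₁` and `R₂` record that an
end of the chart can be taken in `P` when that end of the sequence lies in Ind(P). -/
lemma IsExtensionClosed.exists_isChart_of_indConfl [UnivLE.{w, v}] (hE : IsExactStructure E)
    (hP : IsExtensionClosed E P) {U V W : IndRel κ E P} {f : U ⟶ V} {g : V ⟶ W} {h : f ≫ g = 0}
    (hS : indConfl κ E P (.mk f g h)) {R₁ R₂ : ObjectProperty A} (hU : indPresented κ E R₁ P U.obj)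
    (hW : indPresented κ E R₂ P W.obj) :
    ∃ (X Y Z : A) (i : X ⟶ Y) (p : Y ⟶ Z) (h' : i ≫ p = 0) (x : U.obj.obj.obj (op X))
      (y : V.obj.obj.obj (op Y)) (z : W.obj.obj.obj (op Z)), R₁ X ∧ R₂ Z ∧ E (.mk i p h') ∧
        IsIso (indGerm σ U x) ∧ IsIso (indGerm σ V y) ∧ IsIso (indGerm σ W z) ∧
        (quotFunctor E P).map i ≫ indGerm σ V y = indGerm σ U x ≫ (stalkFunctor σ).map f ∧
        (quotFunctor E P).map p ≫ indGerm σ W z = indGerm σ V y ≫ (stalkFunctor σ).map g := by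
  obtain ⟨I, _, _, _, X, u, hI, hX, hu⟩ := exists_isPres_of_indPresented hE hU
  obtain ⟨K, _, _, _, Z, z, hK, hZ, hz⟩ := exists_isPres_of_indPresented hE hW
  obtain ⟨a, k, R, i, q, p, hc, hp⟩ := (σ V).exists_isChart hE hP (f := f.hom) (g := g.hom)
    ((indConfl_iff hE).1 hS) hu hz
  refine ⟨X a, R, Z k, i, q, hc.zero, u a, p, z k, hX a, hZ k, hc.confl, isIso_indGerm σ U hu a,
    hp, isIso_indGerm σ W hz k, ?_, ?_⟩
  · rw [indGerm_comp_map, ← indGerm_res, hc.res_eq]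
  · rw [indGerm_comp_map, ← indGerm_res]
    exact congrArg _ hc.ap_eq.symm

/-- The stalk functor inverts the weak isomorphisms. -/
lemma stalkFunctor_inverts [UnivLE.{w, v}] (hE : IsExactStructure E) (hP : IsExtensionClosed E P) :
    (weakIso (indConfl κ E P) (indSub κ E P)).IsInvertedBy (stalkFunctor σ) := by
  rintro U V f (⟨W, g, h, hW, hS⟩ | ⟨W, g, h, hW, hS⟩)
  -- Since the cokernel lies in Ind(P), the last term of the chart lies in `P` and `i` is inverted.
  · obtain ⟨X, Y, Z, i, p, h', x, y, z, -, hZ, hT, i₁, i₂, i₃, e, -⟩ :=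
      hP.exists_isChart_of_indConfl σ hE hS U.property hW
    have i₄ : IsIso ((quotFunctor E P).map i) :=
      IsSplitRightSFiltering.quotFunctor_inverts E P ⟨_, _, _, hZ, hT⟩
    have : IsIso (indGerm σ U x ≫ (stalkFunctor σ).map f) := by
      rw [← e]
      infer_instance
    exact IsIso.of_isIso_comp_left (indGerm σ U x) _
  · obtain ⟨X, Y, Z, i, p, h', x, y, z, hX, -, hT, i₁, i₂, i₃, -, e⟩ :=
      hP.exists_isChart_of_indConfl σ hE hS hW V.property
    have i₄ : IsIso ((quotFunctor E P).map p) :=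
      (weakIso E P).Q_inverts p (Or.inr ⟨_, _, _, hX, hT⟩)
    have : IsIso (indGerm σ U y ≫ (stalkFunctor σ).map f) := by
      rw [← e]
      infer_instance
    exact IsIso.of_isIso_comp_left (indGerm σ U y) _

lemma stalkFunctor_confl [UnivLE.{w, v}] (hE : IsExactStructure E) (hP : IsExtensionClosed E P)
    [Preadditive (Quot E P)] [(quotFunctor E P).Additive] {U V W : IndRel κ E P} {f : U ⟶ V}
    {g : V ⟶ W} {h : f ≫ g = 0} (hS : indConfl κ E P (.mk f g h)) :
    ∃ h', quotConfl E P (.mk ((stalkFunctor σ).map f) ((stalkFunctor σ).map g) h') := by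
  obtain ⟨X, Y, Z, i, p, h', x, y, z, -, -, hT, i₁, i₂, i₃, e, e'⟩ :=
    hP.exists_isChart_of_indConfl σ hE hS U.property W.property
  exact quotConfl_of_isos hT (asIso (indGerm σ U x)) (asIso (indGerm σ V y)) (asIso (indGerm σ W z))
    e e'

lemma isIso_indGerm_indYoneda (hκ : Cardinal.aleph0 ≤ κ) (hE : IsExactStructure E)
    (hP : IsExtensionClosed E P) (X : A) :
    IsIso (indGerm σ ((indYoneda hκ hE hP).obj X) (lsec hE (𝟙 X))) := by
  have hx : IsPres E P ((indYoneda hκ hE hP).obj X).obj (fun _ : PUnit.{w + 1} => X)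
      (fun _ => lsec hE (𝟙 X)) :=
    { inj := fun f hf => (Category.comp_id f).symm.trans hf
      surj := fun y => ⟨PUnit.unit, lunsec hE y, Category.comp_id (lunsec hE y)⟩
      le := fun _ => ⟨𝟙 X, hP.monoCokerIn_of_isIso hE _, Category.comp_id (𝟙 X)⟩ }
  exact isIso_indGerm σ _ hx PUnit.unit

lemma map_comp_indGerm_indYoneda (hκ : Cardinal.aleph0 ≤ κ) (hE : IsExactStructure E)
    (hP : IsExtensionClosed E P) {X Y : A} (f : X ⟶ Y) :
    (quotFunctor E P).map f ≫ indGerm σ ((indYoneda hκ hE hP).obj Y) (lsec hE (𝟙 Y)) =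
      indGerm σ ((indYoneda hκ hE hP).obj X) (lsec hE (𝟙 X)) ≫
        (stalkFunctor σ).map ((indYoneda hκ hE hP).map f) := by
  refine Eq.trans ?_ (indGerm_comp_map σ ((indYoneda hκ hE hP).map f) (lsec hE (𝟙 X))).symm
  refine (indGerm_res σ ((indYoneda hκ hE hP).obj Y) f (lsec hE (𝟙 Y))).symm.trans ?_
  exact congrArg (indGerm σ ((indYoneda hκ hE hP).obj Y))
    ((Category.comp_id f).trans (Category.id_comp f).symm)

/-- The stalk functor extends the quotient functor. -/
noncomputable def indYonedaCompStalkFunctor (hκ : Cardinal.aleph0 ≤ κ) (hE : IsExactStructure E)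
    (hP : IsExtensionClosed E P) :
    quotFunctor E P ≅ indYoneda hκ hE hP ⋙ stalkFunctor σ :=
  NatIso.ofComponents
    (fun X => @asIso _ _ _ _ (indGerm σ ((indYoneda hκ hE hP).obj X) (lsec hE (𝟙 X)))
      (isIso_indGerm_indYoneda σ hκ hE hP X))
    (fun f => map_comp_indGerm_indYoneda σ hκ hE hP f)

end StalkFunctor

end RelTate

namespace RelTate

/-! ### Transport of exact structures along equivalences -/

section Equivalence

variable {A : Type u} [Category.{v} A] [Preadditive A] {B : Type u'} [Category.{v'} B]
  [Preadditive B] {E : ObjectProperty (ShortComplex A)} (F : B ⥤ A) [F.IsEquivalence] [F.Additive]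

lemma admMono_map_iff (hE : IsExactStructure E) {X Y : B} (f : X ⟶ Y) :
    admMono (fun S => E (S.map F)) f ↔ admMono E (F.map f) := by
  constructor
  · rintro ⟨Z, g, h, -, hS⟩
    exact ⟨F.obj Z, F.map g, ((ShortComplex.mk f g h).map F).zero, trivial, hS⟩
  · rintro ⟨Z, g, h, -, hS⟩
    let e := F.objObjPreimageIso Z
    have h' : f ≫ F.preimage (g ≫ e.inv) = 0 := F.map_injective (by simp [reassoc_of% h])
    refine ⟨F.objPreimage Z, F.preimage (g ≫ e.inv), h', trivial, hE.of_iso ?_ hS⟩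
    exact ShortComplex.isoMk (Iso.refl _) (Iso.refl _) e.symm
      ((Category.id_comp _).trans (Category.comp_id _).symm)
      ((Category.id_comp _).trans (F.map_preimage _))

lemma admEpi_map_iff (hE : IsExactStructure E) {Y Z : B} (g : Y ⟶ Z) :
    admEpi (fun S => E (S.map F)) g ↔ admEpi E (F.map g) := by
  constructor
  · rintro ⟨X, f, h, -, hS⟩
    exact ⟨F.obj X, F.map f, ((ShortComplex.mk f g h).map F).zero, trivial, hS⟩
  · rintro ⟨X, f, h, -, hS⟩
    let e := F.objObjPreimageIso X
    have h' : F.preimage (e.hom ≫ f) ≫ g = 0 := F.map_injective (by simp [h])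
    refine ⟨F.objPreimage X, F.preimage (e.hom ≫ f), h', trivial, hE.of_iso ?_ hS⟩
    exact ShortComplex.isoMk e.symm (Iso.refl _) (Iso.refl _)
      (((congrArg _ (F.map_preimage _)).trans (e.inv_hom_id_assoc f)).trans
        (Category.comp_id _).symm)
      ((Category.id_comp _).trans (Category.comp_id _).symm)

/-- Transport of an exact structure along an equivalence of categories. -/
theorem IsExactStructure.of_equivalence (hE : IsExactStructure E) :
    IsExactStructure (fun S : ShortComplex B => E (S.map F)) := by
  have h₀ := hE.hasZeroObject
  have h₁ := hE.hasBinaryBiproducts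
  have : HasBinaryProducts B := Adjunction.hasLimitsOfShape_of_equivalence F
  refine
    { hasZeroObject := ?_
      hasBinaryBiproducts := HasBinaryBiproducts.of_hasBinaryProducts
      of_iso := fun e hS => hE.of_iso (F.mapShortComplex.mapIso e) hS
      isKernelCokernelPair := fun hS => IsKernelCokernelPair.of_map F (hE.isKernelCokernelPair hS)
      id_admMono := fun X => ?_
      id_admEpi := fun X => ?_
      comp_admMono := fun f g hf hg => ?_
      comp_admEpi := fun f g hf hg => ?_
      pushout_admMono := fun {X Y X'} i f hi => ?_
      pullback_admEpi := fun {Y Z Z'} p f hp => ?_ }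
  · obtain ⟨Z, hZ⟩ := h₀
    refine ⟨F.objPreimage Z, ?_⟩
    rw [IsZero.iff_id_eq_zero]
    exact F.map_injective ((hZ.of_iso (F.objObjPreimageIso Z)).eq_of_src _ _)
  · rw [admMono_map_iff F hE, F.map_id]
    exact hE.id_admMono _
  · rw [admEpi_map_iff F hE, F.map_id]
    exact hE.id_admEpi _
  · rw [admMono_map_iff F hE] at *
    rw [F.map_comp]
    exact hE.comp_admMono _ _ hf hg
  · rw [admEpi_map_iff F hE] at *
    rw [F.map_comp]
    exact hE.comp_admEpi _ _ hf hg
  · rw [admMono_map_iff F hE] at hi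
    obtain ⟨Y', f', i', sq, hi'⟩ := hE.pushout_admMono (F.map i) (F.map f) hi
    let e := F.objObjPreimageIso Y'
    refine ⟨F.objPreimage Y', F.preimage (f' ≫ e.inv), F.preimage (i' ≫ e.inv), ?_, ?_⟩
    · apply IsPushout.of_map_of_faithful F
      exact sq.of_iso (Iso.refl _) (Iso.refl _) (Iso.refl _) e.symm (by simp) (by simp) (by simp)
        (by simp)
    · rw [admMono_map_iff F hE, F.map_preimage]
      obtain ⟨Z, g, h, hZ, hS⟩ := hi'
      obtain ⟨h', hS'⟩ := hE.of_isos (f' := i' ≫ e.inv) (g' := e.hom ≫ g) hS (Iso.refl _) e.symm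
        (Iso.refl _) (by simp) (by simp)
      exact ⟨Z, e.hom ≫ g, h', hZ, hS'⟩
  · rw [admEpi_map_iff F hE] at hp
    obtain ⟨Y', f', p', sq, hp'⟩ := hE.pullback_admEpi (F.map p) (F.map f) hp
    let e := F.objObjPreimageIso Y'
    refine ⟨F.objPreimage Y', F.preimage (e.hom ≫ f'), F.preimage (e.hom ≫ p'), ?_, ?_⟩
    · apply IsPullback.of_map_of_faithful F
      exact sq.of_iso e.symm (Iso.refl _) (Iso.refl _) (Iso.refl _) (by simp) (by simp) (by simp)
        (by simp)
    · rw [admEpi_map_iff F hE, F.map_preimage]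
      obtain ⟨X, g, h, hX, hS⟩ := hp'
      obtain ⟨h', hS'⟩ := hE.of_isos (f' := g ≫ e.inv) (g' := e.hom ≫ p') hS (Iso.refl _) e.symm
        (Iso.refl _) (by simp) (by simp)
      exact ⟨X, g ≫ e.inv, h', hX, hS'⟩

end Equivalence

/-! ### The two quotients are equivalent -/

section Quotients

open Opposite

variable {A : Type u} [Category.{v} A] [Preadditive A] {E : ObjectProperty (ShortComplex A)}
  {P : ObjectProperty A} {κ : Cardinal.{w}}

lemma lift_map_map {C : Type*} [Category* C] {D : Type*} [Category* D] {W : MorphismProperty C}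
    {G : C ⥤ D} (hG : W.IsInvertedBy G) {X Y : C} (f : X ⟶ Y) :
    (Localization.Construction.lift G hG).map (W.Q.map f) = G.map f := by
  refine (Functor.congr_hom (Localization.Construction.fac G hG) f).trans ?_
  exact (Category.id_comp _).trans (Category.comp_id _)

lemma map_comp_map_eq {C : Type*} [Category* C] {D : Type*} [Category* D] (F : C ⥤ D) {X Y Z : C}
    {s : X ⟶ Y} [IsIso s] {r : Y ⟶ X} (e : s ≫ r = 𝟙 X) {f : Z ⟶ Y} {T : D} {a : F.obj X ⟶ T}
    {b : F.obj Y ⟶ T} {c : F.obj Z ⟶ T} (h : F.map s ≫ b = a) (h' : F.map f ≫ b = c) :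
    F.map (f ≫ r) ≫ a = c := by
  obtain rfl : r = inv s := by rw [← cancel_epi s, e, IsIso.hom_inv_id]
  rw [← h, ← h', ← Functor.map_comp_assoc, Category.assoc, IsIso.inv_hom_id, Category.comp_id]

variable (hκ : Cardinal.aleph0 ≤ κ) (hE : IsExactStructure E) (hP : IsExtensionClosed E P)

lemma indSub_indYoneda {X : A} (hX : P X) : indSub κ E P ((indYoneda hκ hE hP).obj X) :=
  yoneda_indPresented hκ (fun _ hS => (hE.isKernelCokernelPair hS).2)
    (fun _ => hP.monoCokerIn_of_isIso hE _) X hX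

lemma weakIso_indYoneda {X Y : A} {f : X ⟶ Y} (hf : weakIso E P f) :
    weakIso (indConfl κ E P) (indSub κ E P) ((indYoneda hκ hE hP).map f) := by
  obtain ⟨Z, g, h, hZ, hS⟩ | ⟨Z, g, h, hZ, hS⟩ := hf
  · obtain ⟨h', hS'⟩ := indYoneda_confl hκ hE hP hS
    exact Or.inl ⟨_, _, h', indSub_indYoneda hκ hE hP hZ, hS'⟩
  · obtain ⟨h', hS'⟩ := indYoneda_confl hκ hE hP hS
    exact Or.inr ⟨_, _, h', indSub_indYoneda hκ hE hP hZ, hS'⟩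

/-- The functor from an exact category to the quotient of its category of Ind objects. -/
noncomputable abbrev toIndQuot : A ⥤ Quot (indConfl κ E P) (indSub κ E P) :=
  indYoneda hκ hE hP ⋙ quotFunctor (indConfl κ E P) (indSub κ E P)

lemma toIndQuot_inverts : (weakIso E P).IsInvertedBy (toIndQuot hκ hE hP) :=
  fun _ _ _ hf => (weakIso _ _).Q_inverts _ (weakIso_indYoneda hκ hE hP hf)

/-- The functor between the quotients that is induced by the inclusion of an exact category into
its category of Ind objects. -/
noncomputable abbrev quotToIndQuot : Quot E P ⥤ Quot (indConfl κ E P) (indSub κ E P) :=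
  Localization.Construction.lift _ (toIndQuot_inverts hκ hE hP)

variable (σ : ∀ V : IndRel κ E P, Stalk E P V.obj) 
lemma quotToIndQuot_map {X Y : A} (f : X ⟶ Y) :
    (quotToIndQuot hκ hE hP).map ((quotFunctor E P).map f) =
      (quotFunctor (indConfl κ E P) (indSub κ E P)).map ((indYoneda hκ hE hP).map f) :=
  lift_map_map (toIndQuot_inverts hκ hE hP) f

/-- Both `y` and the universal section are restrictions of one section `y'`, the latter along the
inverted `g`. The germ of `y` is `f` followed by the inverse of `g`, so composing it with the
universal section gives back `y`. Naturality of the counit is a special case. -/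
lemma quotToIndQuot_map_indGerm (V : IndRel κ E P) {Y : A} (y : V.obj.obj.obj (op Y)) :
    (quotToIndQuot hκ hE hP).map (indGerm σ V y) ≫
      (quotFunctor (indConfl κ E P) (indSub κ E P)).map (indElt hκ hE hP V (σ V).elt) =
        (quotFunctor (indConfl κ E P) (indSub κ E P)).map (indElt hκ hE hP V y) := by
  obtain ⟨Y', f, g, y', hg, rfl, e⟩ := (σ V).exists_res y
  have i₁ := IsSplitRightSFiltering.quotFunctor_inverts E P hg
  have e₁ : (quotFunctor E P).map g ≫ indGerm σ V y' = 𝟙 _ := by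
    rw [← indGerm_res, e]
    exact (σ V).germ_elt
  have e₂ {X : A} (h : X ⟶ Y') : (quotToIndQuot hκ hE hP).map ((quotFunctor E P).map h) ≫
      (quotFunctor (indConfl κ E P) (indSub κ E P)).map (indElt hκ hE hP V y') =
        (quotFunctor (indConfl κ E P) (indSub κ E P)).map
          (indElt hκ hE hP V (res V.obj.obj h y')) :=
    (congrArg (· ≫ _) (quotToIndQuot_map hκ hE hP h)).trans ((Functor.map_comp _ _ _).symm.trans
      (congrArg _ (indYoneda_map_indElt hκ hE hP h y')))
  rw [indGerm_res]
  exact map_comp_map_eq (quotToIndQuot hκ hE hP) e₁ ((e₂ g).trans (congrArg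
    (fun t => (quotFunctor (indConfl κ E P) (indSub κ E P)).map (indElt hκ hE hP V t)) e)) (e₂ f)

variable (hσ : ∀ V, monoCokerIn (indConfl κ E P) (indSub κ E P) (indElt hκ hE hP V (σ V).elt))

/-- The components of the counit. -/
noncomputable def indQuotIso (V : IndRel κ E P) :
    (stalkFunctor σ ⋙ quotToIndQuot hκ hE hP).obj V ≅
      (quotFunctor (indConfl κ E P) (indSub κ E P)).obj V :=
  @asIso _ _ _ _ ((quotFunctor (indConfl κ E P) (indSub κ E P)).map (indElt hκ hE hP V (σ V).elt))
    (IsSplitRightSFiltering.quotFunctor_inverts _ _ (hσ V))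

lemma indQuotIso_naturality {V W : IndRel κ E P} (φ : V ⟶ W) :
    (stalkFunctor σ ⋙ quotToIndQuot hκ hE hP).map φ ≫ (indQuotIso hκ hE hP σ hσ W).hom =
      (indQuotIso hκ hE hP σ hσ V).hom ≫
        (quotFunctor (indConfl κ E P) (indSub κ E P)).map φ := by
  refine (quotToIndQuot_map_indGerm hκ hE hP σ W (ap φ.hom.hom (σ V).elt)).trans ?_
  rw [← indElt_comp, Functor.map_comp]
  rfl

variable [UnivLE.{w, v}]

/-- The functor on the quotient that is induced by the stalk functor. -/
noncomputable abbrev indQuotToQuot : Quot (indConfl κ E P) (indSub κ E P) ⥤ Quot E P :=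
  Localization.Construction.lift _ (stalkFunctor_inverts σ hE hP)

lemma indQuotToQuot_map {V W : IndRel κ E P} (f : V ⟶ W) :
    (indQuotToQuot hE hP σ).map ((quotFunctor (indConfl κ E P) (indSub κ E P)).map f) =
      (stalkFunctor σ).map f :=
  lift_map_map (stalkFunctor_inverts σ hE hP) f

/-- The functor induced by the stalk functor is a left inverse. -/
noncomputable def quotCompIso : 𝟭 (Quot E P) ≅ quotToIndQuot hκ hE hP ⋙ indQuotToQuot hE hP σ :=
  letI : Localization.Lifting (quotFunctor E P) (weakIso E P)
      (indYoneda hκ hE hP ⋙ stalkFunctor σ) (quotToIndQuot hκ hE hP ⋙ indQuotToQuot hE hP σ) :=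
    ⟨eqToIso (by
      rw [← Functor.assoc, Localization.Construction.fac, Functor.assoc,
        Localization.Construction.fac])⟩
  Localization.liftNatIso (quotFunctor E P) (weakIso E P) _ _ _ _
    (indYonedaCompStalkFunctor σ hκ hE hP)

/-- The functor induced by the stalk functor is a right inverse. -/
noncomputable def indQuotCompIso :
    indQuotToQuot hE hP σ ⋙ quotToIndQuot hκ hE hP ≅ 𝟭 (Quot (indConfl κ E P) (indSub κ E P)) :=
  letI : Localization.Lifting (quotFunctor (indConfl κ E P) (indSub κ E P))
      (weakIso (indConfl κ E P) (indSub κ E P))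
      (stalkFunctor σ ⋙ quotToIndQuot hκ hE hP) (indQuotToQuot hE hP σ ⋙ quotToIndQuot hκ hE hP) :=
    ⟨eqToIso (by rw [← Functor.assoc, Localization.Construction.fac])⟩
  Localization.liftNatIso (quotFunctor (indConfl κ E P) (indSub κ E P))
    (weakIso (indConfl κ E P) (indSub κ E P)) _ _ _ _
    (NatIso.ofComponents (indQuotIso hκ hE hP σ hσ) (indQuotIso_naturality hκ hE hP σ hσ))

/-- The equivalence between the quotients. -/
noncomputable def quotEquivalence : Quot E P ≌ Quot (indConfl κ E P) (indSub κ E P) :=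
  CategoryTheory.Equivalence.mk (quotToIndQuot hκ hE hP) (indQuotToQuot hE hP σ)
    (quotCompIso hκ hE hP σ) (indQuotCompIso hκ hE hP σ hσ)

end Quotients

end RelTate

namespace RelTate

/-! ### Comparison of the exact structures -/

section ExactEquivalence

variable {A : Type u} [Category.{v} A] [Preadditive A] {E : ObjectProperty (ShortComplex A)}
  {P : ObjectProperty A} {κ : Cardinal.{w}} [UnivLE.{w, v}] (hκ : Cardinal.aleph0 ≤ κ)
  (hE : IsExactStructure E) (hP : IsExtensionClosed E P)
  (σ : ∀ V : IndRel κ E P, Stalk E P V.obj)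
  [Preadditive (Quot E P)]
  [Preadditive (Quot (indConfl κ E P) (indSub κ E P))] [(indQuotToQuot hE hP σ).Additive]

lemma quotConfl_map_indQuotToQuot [(quotFunctor E P).Additive]
    (hE' : IsExactStructure (quotConfl E P))
    {S : ShortComplex (Quot (indConfl κ E P) (indSub κ E P))}
    (hS : quotConfl (indConfl κ E P) (indSub κ E P) S) :
    quotConfl E P (S.map (indQuotToQuot hE hP σ)) := by
  obtain ⟨S₀, hS₀, e₁, e₂, e₃, w₁, w₂⟩ := hS
  obtain ⟨h, hS₁⟩ := stalkFunctor_confl σ hE hP (f := S₀.f) (g := S₀.g) (h := S₀.zero) hS₀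
  let T := indQuotToQuot hE hP σ
  refine (hE'.of_isos (f' := T.map S.f) (g' := T.map S.g) hS₁ (T.mapIso e₁) (T.mapIso e₂)
    (T.mapIso e₃) ?_ ?_).2
  · refine Eq.symm ((congrArg (· ≫ T.map e₂.hom) (indQuotToQuot_map hE hP σ S₀.f).symm).trans ?_)
    exact (T.map_comp _ _).symm.trans ((congrArg T.map w₁).trans (T.map_comp _ _))
  · refine Eq.symm ((congrArg (· ≫ T.map e₃.hom) (indQuotToQuot_map hE hP σ S₀.g).symm).trans ?_)
    exact (T.map_comp _ _).symm.trans ((congrArg T.map w₂).trans (T.map_comp _ _))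

/-- A conflation of `A` that represents the image of `S` is again a conflation of Ind objects, and
the counit compares it with `S`. -/
lemma quotConfl_of_map_indQuotToQuot [(quotFunctor (indConfl κ E P) (indSub κ E P)).Additive]
    (hσ : ∀ V, monoCokerIn (indConfl κ E P) (indSub κ E P) (indElt hκ hE hP V (σ V).elt))
    {S : ShortComplex (Quot (indConfl κ E P) (indSub κ E P))}
    (hS : quotConfl E P (S.map (indQuotToQuot hE hP σ))) :
    quotConfl (indConfl κ E P) (indSub κ E P) S := by
  obtain ⟨S₀, hS₀, e₁, e₂, e₃, w₁, w₂⟩ := hS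
  obtain ⟨h, hS₁⟩ := indYoneda_confl hκ hE hP (f := S₀.f) (g := S₀.g) (h := S₀.zero) hS₀
  let F := quotToIndQuot hκ hE hP
  let c := indQuotCompIso hκ hE hP σ hσ
  refine (quotConfl_of_isos hS₁ (F.mapIso e₁ ≪≫ c.app S.X₁) (F.mapIso e₂ ≪≫ c.app S.X₂)
    (F.mapIso e₃ ≪≫ c.app S.X₃) ?_ ?_).2
  · refine (congrArg (· ≫ F.map e₂.hom ≫ c.hom.app S.X₂)
      (quotToIndQuot_map hκ hE hP S₀.f).symm).trans ?_
    refine (F.map_comp_assoc _ _ _).symm.trans ?_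
    refine (congrArg (fun t => F.map t ≫ c.hom.app S.X₂) w₁).trans ?_
    refine (F.map_comp_assoc _ _ _).trans ?_
    refine (congrArg (F.map e₁.hom ≫ ·) (c.hom.naturality S.f)).trans ?_
    exact (Category.assoc _ _ _).symm
  · refine (congrArg (· ≫ F.map e₃.hom ≫ c.hom.app S.X₃)
      (quotToIndQuot_map hκ hE hP S₀.g).symm).trans ?_
    refine (F.map_comp_assoc _ _ _).symm.trans ?_
    refine (congrArg (fun t => F.map t ≫ c.hom.app S.X₃) w₂).trans ?_
    refine (F.map_comp_assoc _ _ _).trans ?_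
    refine (congrArg (F.map e₂.hom ≫ ·) (c.hom.naturality S.g)).trans ?_
    exact (Category.assoc _ _ _).symm

end ExactEquivalence

/-- Let `P` be a right s-filtering subcategory of an exact category `A` whose idempotents split.
The quotient of `A` by `P` is equivalent to the quotient of `Ind(A, P)` by `Ind(P)`. -/
theorem isExactEquivalence_quotToIndQuot {A : Type u} [Category.{v} A] [Preadditive A]
    {E : ObjectProperty (ShortComplex A)} {P : ObjectProperty A} {κ : Cardinal.{w}} [UnivLE.{w, v}]
    (hκ : Cardinal.aleph0 ≤ κ) (hE : IsExactStructure E) (hP : IsSplitRightSFiltering E P) :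
    ∃ (_ : Preadditive (Quot E P)) (_ : Preadditive (Quot (indConfl κ E P) (indSub κ E P))),
      IsExactStructure (quotConfl E P) ∧
      IsExactStructure (quotConfl (indConfl κ E P) (indSub κ E P)) ∧
      IsExactFunctor E (quotConfl E P) (quotFunctor E P) ∧
      IsExactFunctor (indConfl κ E P) (quotConfl (indConfl κ E P) (indSub κ E P))
        (quotFunctor (indConfl κ E P) (indSub κ E P)) ∧
      IsExactFunctor E (quotConfl (indConfl κ E P) (indSub κ E P)) (toIndQuot hκ hE hP.ext) ∧
      IsExactEquivalence (quotConfl E P) (quotConfl (indConfl κ E P) (indSub κ E P))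
        (quotToIndQuot hκ hE hP.ext) := by
  choose σ hσ using exists_stalk hκ hE hP.ext
  obtain ⟨_, _⟩ := hP.exists_preadditive hE
  have hE' := hP.isExactStructure_quotConfl hE
  let e := quotEquivalence hκ hE hP.ext σ hσ
  have i₁ : (indQuotToQuot hE hP.ext σ).IsEquivalence := e.isEquivalence_inverse
  have i₂ : (quotToIndQuot hκ hE hP.ext).IsEquivalence := e.isEquivalence_functor
  -- The additive structure is pulled back along the equivalence, which avoids fractions in Ind(A,
  -- P).
  let i₃ : Preadditive (Quot (indConfl κ E P) (indSub κ E P)) :=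
    Preadditive.ofFullyFaithful (Functor.FullyFaithful.ofFullyFaithful (indQuotToQuot hE hP.ext σ))
  have i₄ : (indQuotToQuot hE hP.ext σ).Additive := Functor.FullyFaithful.additive_ofFullyFaithful _
  have i₅ := stalkFunctor_additive σ hE
  have i₆ : (quotFunctor (indConfl κ E P) (indSub κ E P)).Additive := ⟨fun {V W f g} => by
    apply (indQuotToQuot hE hP.ext σ).map_injective
    refine (indQuotToQuot_map hE hP.ext σ (f + g)).trans (((stalkFunctor σ).map_add).trans ?_)
    refine Eq.trans ?_ ((indQuotToQuot hE hP.ext σ).map_add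
      (f := (quotFunctor (indConfl κ E P) (indSub κ E P)).map f)
      (g := (quotFunctor (indConfl κ E P) (indSub κ E P)).map g)).symm
    exact congrArg₂ (· + ·) (indQuotToQuot_map hE hP.ext σ f).symm
      (indQuotToQuot_map hE hP.ext σ g).symm⟩
  have i₇ : (quotToIndQuot hκ hE hP.ext ⋙ indQuotToQuot hE hP.ext σ).Additive :=
    Functor.additive_of_iso (quotCompIso hκ hE hP.ext σ)
  have i₈ : (quotToIndQuot hκ hE hP.ext).Additive := ⟨fun {X Y f g} => by
    apply (indQuotToQuot hE hP.ext σ).map_injective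
    exact (quotToIndQuot hκ hE hP.ext ⋙ indQuotToQuot hE hP.ext σ).map_add.trans
      (indQuotToQuot hE hP.ext σ).map_add.symm⟩
  -- The conflations of the quotient of Ind objects are exactly those transported from `Quot E P`,
  -- so the axioms of an exact structure come for free.
  have key (S : ShortComplex (Quot (indConfl κ E P) (indSub κ E P))) :
      quotConfl (indConfl κ E P) (indSub κ E P) S ↔
        quotConfl E P (S.map (indQuotToQuot hE hP.ext σ)) :=
    ⟨quotConfl_map_indQuotToQuot hE hP.ext σ hE',
      quotConfl_of_map_indQuotToQuot hκ hE hP.ext σ hσ⟩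
  have key' : quotConfl (indConfl κ E P) (indSub κ E P) =
      fun S => quotConfl E P (S.map (indQuotToQuot hE hP.ext σ)) :=
    funext fun S => propext (key S)
  have h₁ : IsExactFunctor (indConfl κ E P) (quotConfl (indConfl κ E P) (indSub κ E P))
      (quotFunctor (indConfl κ E P) (indSub κ E P)) := quotFunctor_exact
  have h₂ := indYoneda_exact (κ := κ) hκ hE hP.ext
  have h₃ := h₂.additive
  refine ⟨inferInstance, i₃, hE', ?_, quotFunctor_exact, h₁, ⟨inferInstance, fun S hS => ?_⟩,
    ⟨i₂, i₈, fun S => ?_⟩⟩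
  · rw [key']
    exact hE'.of_equivalence (indQuotToQuot hE hP.ext σ)
  · exact h₁.map_mem _ (h₂.map_mem S hS)
  · rw [key]
    let t := S.mapNatIso (quotCompIso hκ hE hP.ext σ)
    exact ⟨fun h => hE'.of_iso t.symm h, fun h => hE'.of_iso t h⟩

end RelTate

/-! ### The case of Pro(D) and C -/

theorem mainTheorem7 {D : Type u} [Category.{v} D] [Preadditive D]
    (E : ObjectProperty (ShortComplex D)) (hE : RelTate.IsExactStructure E)
    (hD : IsIdempotentComplete D)
    (C : ObjectProperty D) (hC : RelTate.IsExtensionClosed E C)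
    (hs : RelTate.IsRightSFiltering (RelTate.restrict E C) E C.ι)
    (κ : Cardinal.{v}) (hκ : Cardinal.aleph0 ≤ κ) :
    RelTate.IsRightSFiltering (RelTate.restrict E C) (RelTate.proConfl κ E)
      (RelTate.subToPro hκ hE C) ∧
    RelTate.IsExactStructure (RelTate.proConfl κ E) ∧
    ∃ (_ : Preadditive (RelTate.ProQuot hκ hE C)) (_ : Preadditive (RelTate.TateQuot hκ hE C)),
      RelTate.IsExactStructure (RelTate.quotConfl (RelTate.proConfl κ E) (RelTate.inPro hκ hE C)) ∧
      RelTate.IsExactStructure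
        (RelTate.quotConfl (RelTate.tateConfl hκ hE C) (RelTate.indInTate hκ hE C)) ∧
      RelTate.IsExactFunctor (RelTate.proConfl κ E)
        (RelTate.quotConfl (RelTate.proConfl κ E) (RelTate.inPro hκ hE C))
        (RelTate.quotFunctor (RelTate.proConfl κ E) (RelTate.inPro hκ hE C)) ∧
      RelTate.IsExactFunctor (RelTate.tateConfl hκ hE C)
        (RelTate.quotConfl (RelTate.tateConfl hκ hE C) (RelTate.indInTate hκ hE C))
        (RelTate.quotFunctor (RelTate.tateConfl hκ hE C) (RelTate.indInTate hκ hE C)) ∧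
      RelTate.IsExactFunctor (RelTate.proConfl κ E)
        (RelTate.quotConfl (RelTate.tateConfl hκ hE C) (RelTate.indInTate hκ hE C))
        (RelTate.proToTate hκ hE hC ⋙
          RelTate.quotFunctor (RelTate.tateConfl hκ hE C) (RelTate.indInTate hκ hE C)) ∧
      ∃ h : (RelTate.weakIso (RelTate.proConfl κ E) (RelTate.inPro hκ hE C)).IsInvertedBy
          (RelTate.proToTate hκ hE hC ⋙
            RelTate.quotFunctor (RelTate.tateConfl hκ hE C) (RelTate.indInTate hκ hE C)),
        RelTate.IsExactEquivalence
          (RelTate.quotConfl (RelTate.proConfl κ E) (RelTate.inPro hκ hE C))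
          (RelTate.quotConfl (RelTate.tateConfl hκ hE C) (RelTate.indInTate hκ hE C))
          (Localization.Construction.lift _ h) := by
  have hP := RelTate.isSplitRightSFiltering_inPro hκ hE hD hC hs
  have hPro : RelTate.IsExactStructure (RelTate.proConfl κ E) :=
    RelTate.isExactStructure_proConfl.{v, v} hκ hE
  -- By definition the elementary Tate objects are Ind(A, P) for A = Pro(D) and P = C; `indInTate`
  -- is `indSub`, and `proToTate` is `indYoneda`, since they differ only in proofs.
  obtain ⟨i₁, i₂, h₁, h₂, h₃, h₄, h₅, h₆⟩ := RelTate.isExactEquivalence_quotToIndQuot hκ hPro hP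
  exact ⟨RelTate.isRightSFiltering_subToPro hκ hE hs, hPro, i₁, i₂, h₁, h₂, h₃, h₄, h₅,
    RelTate.toIndQuot_inverts hκ hPro hP.ext, h₆⟩
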